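/- For $0\le c<1$ and $N\ge 1$ let $\mathrm{ERM}^c:\mathbb R_+^N\to\mathbb R_+$ be the following function: sort the $N$ arguments as $v_1\ge v_2\ge\dots\ge v_N$ and return $v_{i^*}$, where $i^*$ is the index $i$ with $cN<i\le N$ that maximizes $i\,v_i$ (the largest such index in case of ties). For $I\subseteq\{1,\dots,N\}$ with $|I|=m$, $v_I\in\mathbb R_+^m$ and $v_{-I}\in\mathbb R_+^{N-m}$, put $$\delta_I(v_I,v_{-I})=1-\frac{\inf_{b_I\in\mathbb R_+^m}\mathrm{ERM}^c(b_I,v_{-I})}{\mathrm{ERM}^c(v_I,v_{-I})}$$ (read as $0$ if the denominator is $0$), $\delta^{\mathrm{worst}}_m(v_{-I})=\sup_{v_I\in\mathbb R_+^m}\delta_I(v_I,v_{-I})$ and $\Delta^{\mathrm{worst}}_{N,m}=\mathbb E[\delta^{\mathrm{worst}}_m(v_{-I})]$, where the $N-m$ entries of $v_{-I}$ are i.i.d. samples from a distribution $F$. A distribution $F$ is called $\alpha$-strongly regular if it has a positive density $f$ on an interval with endpoints $0\le A\le B\le+\infty$ (and no mass elsewhere) such that $\phi(x)=x-\frac{1-F(x)}{f(x)}$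 satisfies $\phi(y)-\phi(x)\ge\alpha(y-x)$ for all $x<y$ in the interior of that interval; positivity of $f$ is required only in the interior. Let $0<\alpha\le 1$, and read $\alpha^{1/(1-\alpha)}$ as its limit $1/e$ if $\alpha=1$. There is a constant $C>0$ that depends only on $\alpha$ such that for every sequence $m=m(N)$ of non-negative integers with $m(N)/\sqrt N\to 0$ there is an $N_0$ (depending on $\alpha$ and the sequence) such that the following holds for all $N\ge N_0$. For every $\alpha$-strongly regular distribution $F$ and every $c$ with $$\frac{m}{N}\le\left(\frac{\log N}{N}\right)^{1/3}\le c\le\frac{\alpha^{1/(1-\alpha)}}{4},$$ and for every index set $I$ of size $m=m(N)$, the random variable $\delta^{\mathrm{worst}}_m(v_{-I})$ is integrable and $$\Delta^{\mathrm{worst}}_{N,m}\le C\,\frac{m\log^3N}{\sqrt N}.$$ -/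

import Mathlib

open MeasureTheory ProbabilityTheory Filter
open scoped NNReal Topology

noncomputable section

/-- The samples sorted non-increasingly: the paper's `v_k` (the `k`-th largest sample,
`1 ≤ k ≤ N`) is `sortedDesc v i` with `i = k - 1`. -/
def sortedDesc {N : ℕ} (v : Fin N → ℝ) (i : Fin N) : ℝ :=
  v (Tuple.sort v (Fin.rev i))

open Classical in
/-- The positions `i` (rank `k = i + 1`) with `c N < k ≤ N` that maximize `k * v_k` among all
ranks in that range. -/
def ermArgmax {N : ℕ} (c : ℝ) (v : Fin N → ℝ) : Finset (Fin N) :=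
  Finset.univ.filter fun i =>
    c * N < ((i : ℕ) : ℝ) + 1 ∧
      ∀ j : Fin N, c * N < ((j : ℕ) : ℝ) + 1 →
        (((j : ℕ) : ℝ) + 1) * sortedDesc v j ≤ (((i : ℕ) : ℝ) + 1) * sortedDesc v i

open Classical in
/-- `c`-guarded empirical revenue maximization; ties are broken towards the larger rank, that is,
the smaller sample. (The set of maximizers is nonempty whenever `0 ≤ c < 1` and `0 < N`.) -/
def ERM {N : ℕ} (c : ℝ) (v : Fin N → ℝ) : ℝ :=
  if h : (ermArgmax c v).Nonempty then sortedDesc v ((ermArgmax c v).max' h) else 0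

/-- The full sample vector `(b_I, v_{-I})`: the (non-negative) entries `b` on `I`, the entries `v`
off `I`. -/
def joinSamples {N : ℕ} (I : Finset (Fin N)) (b : {i : Fin N // i ∈ I} → ℝ≥0)
    (v : {j : Fin N // j ∉ I} → ℝ) : Fin N → ℝ :=
  fun j => if h : j ∈ I then ((b ⟨j, h⟩ : ℝ≥0) : ℝ) else v ⟨j, h⟩

open Classical in
/-- The incentive-awareness measure `δ_I(v_I, v_{-I}) = 1 - inf_b P(b, v_{-I}) / P(v_I, v_{-I})`,
read as `0` when the price `P(v_I, v_{-I})` is `0` (it cannot be reduced then). -/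
def awareness {N : ℕ} (P : (Fin N → ℝ) → ℝ) (I : Finset (Fin N))
    (vI : {i : Fin N // i ∈ I} → ℝ≥0) (v : {j : Fin N // j ∉ I} → ℝ) : ℝ :=
  if P (joinSamples I vI v) = 0 then 0
  else 1 - (⨅ b : {i : Fin N // i ∈ I} → ℝ≥0, P (joinSamples I b v)) / P (joinSamples I vI v)

/-- `δ^worst(v_{-I})`, the supremum of `δ_I(v_I, v_{-I})` over all non-negative `v_I`. -/
def worstAwareness {N : ℕ} (P : (Fin N → ℝ) → ℝ) (I : Finset (Fin N))
    (v : {j : Fin N // j ∉ I} → ℝ) : ℝ :=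
  ⨆ vI : {i : Fin N // i ∈ I} → ℝ≥0, awareness P I vI v

/-- The law of the samples `v_{-I}`, i.i.d. from the distribution `μ`. -/
def restLaw {N : ℕ} (μ : Measure ℝ) (I : Finset (Fin N)) :
    Measure ({j : Fin N // j ∉ I} → ℝ) :=
  Measure.pi fun _ => μ

/-- `Δ^worst`, the expectation of `δ^worst(v_{-I})` over i.i.d. samples `v_{-I}` from `μ`. -/
def DeltaWorst {N : ℕ} (μ : Measure ℝ) (P : (Fin N → ℝ) → ℝ) (I : Finset (Fin N)) : ℝ :=
  ∫ v, worstAwareness P I v ∂(restLaw μ I)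

/-- The interior of the interval `[A, B]`, where `B` may be `+∞`. -/
def supportInterior (A : ℝ) (B : EReal) : Set ℝ := {x : ℝ | A < x ∧ (x : EReal) < B}

/-- The virtual value function `φ(x) = x - (1 - F(x)) / f(x)`. -/
def virtualValue (μ : Measure ℝ) (f : ℝ → ℝ) (x : ℝ) : ℝ := x - (1 - cdf μ x) / f x

/-- `μ` is `α`-strongly regular: it has a positive density `f` on an interval with endpoints
`0 ≤ A ≤ B ≤ +∞`, and `φ(y) - φ(x) ≥ α (y - x)` for `x < y` there. The endpoints are null and
a density is free to take any value at them, so the conditions are imposed on the interior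
(this includes every distribution that satisfies them on the closed interval). -/
def IsStronglyRegular (α : ℝ) (μ : Measure ℝ) : Prop :=
  ∃ (A : ℝ) (B : EReal) (f : ℝ → ℝ),
    0 ≤ A ∧ (A : EReal) ≤ B ∧ Measurable f ∧
    (∀ x ∈ supportInterior A B, 0 < f x) ∧
    μ = (volume.restrict (supportInterior A B)).withDensity (fun x => ENNReal.ofReal (f x)) ∧
    ∀ x ∈ supportInterior A B, ∀ y ∈ supportInterior A B, x < y →
      α * (y - x) ≤ virtualValue μ f y - virtualValue μ f x

open Classical in
/-- `α ^ (1 / (1 - α))`, with its limit value `1 / e` at `α = 1`. -/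
def quantileConst (α : ℝ) : ℝ :=
  if α = 1 then Real.exp (-1) else α ^ (1 / (1 - α))

end

/-! Write each honest sample as the value at an upper quantile `u`, with the `u` i.i.d. uniform on
`(0, 1)`. The number of honest samples that are at least `p` is then `K (S p)`, where `S` is the
survival function and `K` counts uniforms. The `m` bids change this count by at most `m`, so every
price that they can produce maximizes `p * K (S p)` up to `m` extra samples (`IsCandidate`). From
there on the bids play no role: it suffices to compare two such near-maximizers `P₂ ≤ P₁`.

Put `η = √(log N / N)`. Outside an event of probability `O(1 / N)` all counts are correct up to `2 η
N` (Hoeffding and a union bound over a grid). Strong regularity makes the revenue curve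
quadratically curved at the monopoly quantile `q₀`, and the guard keeps prices away from tiny
quantiles, so the quantiles of all attainable prices lie within `ε = O(√η)` of `q₀`
(`IsCandidate.survival_close`). Near-optimality of `P₂` bounds `1 - P₂ / P₁` by a multiple of `S P₂
- S P₁ + 5 η` (`IsCandidate.ratio_ge`). The window alone would give only `O(√η)`, so the expected
spread of the attainable quantiles needs a finer argument.

Cut the window into cells of width `16 η`. The spread is `O(η)` plus `16 η` times the number of
cells that the attainable quantiles straddle. To bound the probability that a given cell is
straddled, choose an equally long reservoir interval of quantiles below all attainable ones.
Exchanging cell and reservoir in an arbitrary set of coordinates preserves the law. It leaves the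
counts beyond the cell alone and shifts every count between reservoir and cell by one common amount.
Straddling forces a revenue near-tie, so among all exchanges of one configuration that amount takes
at most `2 m + 1` consecutive values. It is binomial with about `η N` trials or more, and each value
has probability at most the inverse square root of that number. Hence a cell is straddled with
probability `O(m / √(η N))` (`measure_crossing_le`).

There are `O(ε / η)` cells, so the expected spread is `O(η + ε m / √(η N)) = O(η + m / √N)`, which
is stronger than the claim for `m ≥ 1`; for `m = 0` nothing can be manipulated. Integrability rests
on replacing arbitrary bids by countably many simple ones. -/

/-! ### Order statistics and ERM in terms of counts -/

/-- The number of entries of `x` that are at least `p`. -/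
noncomputable def countGE {ι : Type*} [Fintype ι] (x : ι → ℝ) (p : ℝ) : ℕ :=
  (Finset.univ.filter fun i => p ≤ x i).card

theorem countGE_le_card {ι : Type*} [Fintype ι] (x : ι → ℝ) (p : ℝ) :
    countGE x p ≤ Fintype.card ι :=
  Finset.card_le_univ _

theorem countGE_comp_perm {ι : Type*} [Fintype ι] (x : ι → ℝ) (e : Equiv.Perm ι) (p : ℝ) :
    countGE (x ∘ e) p = countGE x p := by
  unfold countGE
  refine Finset.card_bij (fun i _ => e i) ?_ ?_ ?_
  · intro i hi; simpa using hi
  · intro i _ j _ h; exact e.injective h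
  · intro j hj; exact ⟨e.symm j, by simpa using hj, by simp⟩

theorem le_apply_rev_iff_of_monotone {N : ℕ} {y : Fin N → ℝ} (hy : Monotone y) (p : ℝ)
    (i : Fin N) : p ≤ y i.rev ↔ (i : ℕ) + 1 ≤ countGE y p := by
  have hcard : (Finset.Ici i.rev).card = (i : ℕ) + 1 := by
    rw [Fin.card_Ici, Fin.val_rev]; omega
  constructor
  · intro h
    rw [← hcard]
    refine Finset.card_le_card fun j hj => ?_
    simp only [Finset.mem_filter, Finset.mem_univ, true_and]
    exact h.trans (hy (Finset.mem_Ici.1 hj))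
  · intro h
    by_contra hlt
    have hsub : (Finset.univ.filter fun j => p ≤ y j) ⊆ Finset.Ioi i.rev := by
      intro j hj
      simp only [Finset.mem_filter, Finset.mem_univ, true_and] at hj
      rw [Finset.mem_Ioi]
      by_contra hle
      exact hlt (hj.trans (hy (not_lt.1 hle)))
    have hle := Finset.card_le_card hsub
    rw [Fin.card_Ioi, Fin.val_rev] at hle
    unfold countGE at h
    omega

/-- The Galois connection between order statistics and counts. Through it the later arguments work
with counts and need not refer to the sorting permutation; the `+ 1` converts a zero-based position
into a rank. -/
theorem le_sortedDesc_iff {N : ℕ} (x : Fin N → ℝ) (p : ℝ) (i : Fin N) :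
    p ≤ sortedDesc x i ↔ (i : ℕ) + 1 ≤ countGE x p := by
  have h := le_apply_rev_iff_of_monotone (Tuple.monotone_sort x) p i
  rw [countGE_comp_perm] at h
  exact h

theorem exists_eq_sortedDesc {N : ℕ} (x : Fin N → ℝ) (i : Fin N) : ∃ j, sortedDesc x i = x j :=
  ⟨_, rfl⟩

theorem sortedDesc_eq_of_countGE {N : ℕ} (x : Fin N → ℝ) {i j : Fin N}
    (h : (i : ℕ) + 1 = countGE x (x j)) : sortedDesc x i = x j := by
  refine le_antisymm ?_ ((le_sortedDesc_iff x _ i).2 h.le)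
  by_contra hlt
  push Not at hlt
  have h1 : (i : ℕ) + 1 ≤ countGE x (sortedDesc x i) := (le_sortedDesc_iff x _ i).1 le_rfl
  have h2 : countGE x (sortedDesc x i) < countGE x (x j) := by
    refine Finset.card_lt_card ⟨fun k hk => ?_, fun hsub => ?_⟩
    · simp only [Finset.mem_filter, Finset.mem_univ, true_and] at hk ⊢
      exact hlt.le.trans hk
    · have := hsub (Finset.mem_filter.2 ⟨Finset.mem_univ j, le_rfl⟩)
      simp only [Finset.mem_filter, Finset.mem_univ, true_and] at this
      exact absurd this (not_le.2 hlt)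
  omega

theorem mem_ermArgmax {N : ℕ} {c : ℝ} {x : Fin N → ℝ} {i : Fin N} :
    i ∈ ermArgmax c x ↔ c * N < ((i : ℕ) : ℝ) + 1 ∧
      ∀ j : Fin N, c * N < ((j : ℕ) : ℝ) + 1 →
        (((j : ℕ) : ℝ) + 1) * sortedDesc x j ≤ (((i : ℕ) : ℝ) + 1) * sortedDesc x i := by
  simp [ermArgmax]

theorem ermArgmax_nonempty {N : ℕ} (hN : 0 < N) {c : ℝ} (hc : c < 1) (x : Fin N → ℝ) :
    (ermArgmax c x).Nonempty := by
  classical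
  have hne : (Finset.univ.filter fun i : Fin N => c * N < ((i : ℕ) : ℝ) + 1).Nonempty := by
    refine ⟨⟨N - 1, by omega⟩, ?_⟩
    simp only [Finset.mem_filter, Finset.mem_univ, true_and]
    rw [Nat.cast_sub (by omega)]
    have : (0 : ℝ) < N := by exact_mod_cast hN
    push_cast
    nlinarith
  obtain ⟨i, hi, hmax⟩ := Finset.exists_max_image _
    (fun i : Fin N => (((i : ℕ) : ℝ) + 1) * sortedDesc x i) hne
  simp only [Finset.mem_filter, Finset.mem_univ, true_and] at hi hmax
  exact ⟨i, mem_ermArgmax.2 ⟨hi, hmax⟩⟩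

theorem exists_ERM_eq {N : ℕ} (hN : 0 < N) {c : ℝ} (hc : c < 1) (x : Fin N → ℝ) :
    ∃ i ∈ ermArgmax c x, ERM c x = sortedDesc x i ∧ ∀ j ∈ ermArgmax c x, j ≤ i := by
  have h := ermArgmax_nonempty hN hc x
  refine ⟨(ermArgmax c x).max' h, Finset.max'_mem _ _, ?_, fun j hj => Finset.le_max' _ _ hj⟩
  unfold ERM
  rw [dif_pos h]

theorem ERM_nonneg {N : ℕ} (c : ℝ) {x : Fin N → ℝ} (hx : ∀ i, 0 ≤ x i) : 0 ≤ ERM c x := by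
  unfold ERM
  split_ifs with h
  · exact hx _
  · exact le_rfl

theorem ERM_mem {N : ℕ} (hN : 0 < N) {c : ℝ} (hc : c < 1) (x : Fin N → ℝ) :
    ∃ j, ERM c x = x j := by
  obtain ⟨i, -, h, -⟩ := exists_ERM_eq hN hc x
  exact h ▸ exists_eq_sortedDesc x i

theorem lt_countGE_ERM {N : ℕ} (hN : 0 < N) {c : ℝ} (hc : c < 1) (x : Fin N → ℝ) :
    c * N < countGE x (ERM c x) := by
  obtain ⟨i, hi, h, -⟩ := exists_ERM_eq hN hc x
  have h1 : (i : ℕ) + 1 ≤ countGE x (ERM c x) := (le_sortedDesc_iff x _ i).1 h.le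
  have h2 : ((i : ℕ) : ℝ) + 1 ≤ countGE x (ERM c x) := by exact_mod_cast h1
  exact (mem_ermArgmax.1 hi).1.trans_le h2

/-- Optimality of the chosen rank, in a form that also covers prices `p` that are not samples: `p`
is at most the sample of rank `countGE x p`, which earns at least as much. -/
theorem mul_countGE_le_ERM {N : ℕ} (hN : 0 < N) {c : ℝ} (hc : c < 1) (hc0 : 0 ≤ c)
    {x : Fin N → ℝ} (hx : ∀ i, 0 ≤ x i) {p : ℝ} (hp : c * N < countGE x p) :
    p * countGE x p ≤ ERM c x * countGE x (ERM c x) := by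
  obtain ⟨i, hi, h, -⟩ := exists_ERM_eq hN hc x
  have h1 : (i : ℕ) + 1 ≤ countGE x (ERM c x) := (le_sortedDesc_iff x _ i).1 h.le
  have h2 : ((i : ℕ) : ℝ) + 1 ≤ countGE x (ERM c x) := by exact_mod_cast h1
  have hpos : 0 < countGE x p := by
    have : (0 : ℝ) < countGE x p := lt_of_le_of_lt (by positivity) hp
    exact_mod_cast this
  have hle := countGE_le_card x p
  rw [Fintype.card_fin] at hle
  let j : Fin N := ⟨countGE x p - 1, by omega⟩
  have hj : ((j : ℕ) : ℝ) + 1 = countGE x p := by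
    have : (j : ℕ) + 1 = countGE x p := Nat.sub_add_cancel hpos
    exact_mod_cast this
  have hpj : p ≤ sortedDesc x j := (le_sortedDesc_iff x p j).2 (Nat.sub_add_cancel hpos).le
  have h3 := (mem_ermArgmax.1 hi).2 j (by rw [hj]; exact hp)
  rw [hj, ← h] at h3
  have h4 := ERM_nonneg c hx
  have h5 : (0 : ℝ) ≤ countGE x p := by positivity
  nlinarith

/-- Ranks below that of the chosen price are strictly worse. -/
theorem mul_sortedDesc_lt_ERM {N : ℕ} (hN : 0 < N) {c : ℝ} (hc : c < 1)
    {x : Fin N → ℝ} (hx : ∀ i, 0 ≤ x i) {j : Fin N} (hj : countGE x (ERM c x) ≤ j) :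
    (((j : ℕ) : ℝ) + 1) * sortedDesc x j < countGE x (ERM c x) * ERM c x := by
  obtain ⟨i, hi, h, hmax⟩ := exists_ERM_eq hN hc x
  have h1 : (i : ℕ) + 1 ≤ countGE x (ERM c x) := (le_sortedDesc_iff x _ i).1 h.le
  have h2 : ((i : ℕ) : ℝ) + 1 ≤ countGE x (ERM c x) := by exact_mod_cast h1
  have hij : i < j := by rw [Fin.lt_def]; omega
  have hij' : ((i : ℕ) : ℝ) < ((j : ℕ) : ℝ) := by exact_mod_cast hij
  obtain ⟨hi1, hi2⟩ := mem_ermArgmax.1 hi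
  have hcj : c * N < ((j : ℕ) : ℝ) + 1 := by linarith
  have h3 : (((j : ℕ) : ℝ) + 1) * sortedDesc x j < (((i : ℕ) : ℝ) + 1) * sortedDesc x i := by
    by_contra hle
    push Not at hle
    exact absurd (hmax j (mem_ermArgmax.2 ⟨hcj, fun k hk => (hi2 k hk).trans hle⟩))
      (not_le.2 hij)
  rw [← h] at h3
  have h4 := ERM_nonneg c hx
  nlinarith

/-- The converse criterion. A weak inequality suffices at ranks up to that of `x i₀`, but ties are
broken towards larger ranks, so those beyond it have to be strictly worse. -/
theorem ERM_eq_of_forall {N : ℕ} (hN : 0 < N) {c : ℝ} (hc : c < 1)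
    {x : Fin N → ℝ} {i₀ : Fin N} (h1 : c * N < countGE x (x i₀))
    (h2 : ∀ j : Fin N, (j : ℕ) + 1 ≤ countGE x (x i₀) → c * N < ((j : ℕ) : ℝ) + 1 →
      (((j : ℕ) : ℝ) + 1) * sortedDesc x j ≤ countGE x (x i₀) * x i₀)
    (h3 : ∀ j : Fin N, countGE x (x i₀) ≤ (j : ℕ) →
      (((j : ℕ) : ℝ) + 1) * sortedDesc x j < countGE x (x i₀) * x i₀) :
    ERM c x = x i₀ := by
  have hpos : 0 < countGE x (x i₀) :=
    Finset.card_pos.2 ⟨i₀, Finset.mem_filter.2 ⟨Finset.mem_univ _, le_rfl⟩⟩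
  have hle := countGE_le_card x (x i₀)
  rw [Fintype.card_fin] at hle
  let k : Fin N := ⟨countGE x (x i₀) - 1, by omega⟩
  have hk : (k : ℕ) + 1 = countGE x (x i₀) := Nat.sub_add_cancel hpos
  have hk' : ((k : ℕ) : ℝ) + 1 = countGE x (x i₀) := by exact_mod_cast hk
  have hsk : sortedDesc x k = x i₀ := sortedDesc_eq_of_countGE x hk
  have hmem : k ∈ ermArgmax c x := by
    refine mem_ermArgmax.2 ⟨by rw [hk']; exact h1, fun j hj => ?_⟩
    rw [hk', hsk]
    rcases lt_or_ge (j : ℕ) (countGE x (x i₀)) with h | h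
    · exact h2 j h hj
    · exact (h3 j h).le
  obtain ⟨i, hi, h, hmax⟩ := exists_ERM_eq hN hc x
  have hki := hmax k hmem
  have : i = k := by
    by_contra hne
    have hlt : k < i := lt_of_le_of_ne hki (Ne.symm hne)
    have hlt' : (k : ℕ) < i := hlt
    have h4 := h3 i (by omega)
    have h5 := (mem_ermArgmax.1 hi).2 k (mem_ermArgmax.1 hmem).1
    rw [hk', hsk] at h5
    linarith
  rw [h, this, hsk]

/-! ### Bids joined to honest samples, and reduction to countably many bids -/

theorem joinSamples_of_mem {N : ℕ} {I : Finset (Fin N)} (b : {i : Fin N // i ∈ I} → ℝ≥0)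
    (v : {j : Fin N // j ∉ I} → ℝ) {k : Fin N} (hk : k ∈ I) :
    joinSamples I b v k = b ⟨k, hk⟩ := by
  simp [joinSamples, hk]

theorem joinSamples_of_notMem {N : ℕ} {I : Finset (Fin N)} (b : {i : Fin N // i ∈ I} → ℝ≥0)
    (v : {j : Fin N // j ∉ I} → ℝ) {k : Fin N} (hk : k ∉ I) :
    joinSamples I b v k = v ⟨k, hk⟩ := by
  simp [joinSamples, hk]

theorem joinSamples_nonneg {N : ℕ} {I : Finset (Fin N)} (b : {i : Fin N // i ∈ I} → ℝ≥0)
    {v : {j : Fin N // j ∉ I} → ℝ} (hv : ∀ j, 0 ≤ v j) (k : Fin N) :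
    0 ≤ joinSamples I b v k := by
  by_cases hk : k ∈ I
  · rw [joinSamples_of_mem b v hk]; exact (b _).2
  · rw [joinSamples_of_notMem b v hk]; exact hv _

theorem countGE_le_countGE_joinSamples {N : ℕ} {I : Finset (Fin N)}
    (b : {i : Fin N // i ∈ I} → ℝ≥0) (v : {j : Fin N // j ∉ I} → ℝ) (p : ℝ) :
    countGE v p ≤ countGE (joinSamples I b v) p := by
  refine Finset.card_le_card_of_injOn (fun j => j.1) ?_ Subtype.val_injective.injOn
  intro j hj
  simp only [Finset.coe_filter, Finset.mem_univ, true_and, Set.mem_ofPred_eq] at hj ⊢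
  rwa [joinSamples_of_notMem b v j.2]

theorem countGE_joinSamples_le {N : ℕ} {I : Finset (Fin N)}
    (b : {i : Fin N // i ∈ I} → ℝ≥0) (v : {j : Fin N // j ∉ I} → ℝ) (p : ℝ) :
    countGE (joinSamples I b v) p ≤ countGE v p + I.card := by
  classical
  have hsub : (Finset.univ.filter fun k => p ≤ joinSamples I b v k) ⊆
      ((Finset.univ.filter fun j => p ≤ v j).map ⟨Subtype.val, Subtype.val_injective⟩) ∪ I := by
    intro k hk
    simp only [Finset.mem_filter, Finset.mem_univ, true_and] at hk
    by_cases hkI : k ∈ I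
    · exact Finset.mem_union_right _ hkI
    · rw [joinSamples_of_notMem b v hkI] at hk
      refine Finset.mem_union_left _ (Finset.mem_map.2 ⟨⟨k, hkI⟩, ?_, rfl⟩)
      simpa using hk
  refine (Finset.card_le_card hsub).trans ((Finset.card_union_le _ _).trans ?_)
  rw [Finset.card_map]; rfl

/-- Bids at or above the price may be moved to a common level that no honest sample separates from
the price, and the other bids to `0`; the price becomes that level. -/
theorem ERM_joinSamples_replace {N : ℕ} (hN : 0 < N) {c : ℝ} (hc0 : 0 ≤ c) (hc : c < 1)
    {I : Finset (Fin N)} (b : {i : Fin N // i ∈ I} → ℝ≥0) {v : {j : Fin N // j ∉ I} → ℝ}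
    (hv : ∀ j, 0 ≤ v j) (P' : ℝ≥0)
    (hP' : (P' : ℝ) = ERM c (joinSamples I b v) ∨
      ERM c (joinSamples I b v) < P' ∧ ∀ j, ERM c (joinSamples I b v) ≤ v j → (P' : ℝ) < v j) :
    ERM c (joinSamples I
      (fun i => if ERM c (joinSamples I b v) ≤ b i then P' else 0) v) = P' := by
  set x := joinSamples I b v with hx
  set P := ERM c x with hP
  set b' : {i : Fin N // i ∈ I} → ℝ≥0 := fun i => if P ≤ b i then P' else 0 with hb'
  set x' := joinSamples I b' v with hx'
  have hx0 : ∀ k, 0 ≤ x k := joinSamples_nonneg b hv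
  have hP0 : 0 ≤ P := ERM_nonneg c hx0
  have hPP' : P ≤ P' := by rcases hP' with h | h; exacts [h.ge, h.1.le]
  have hvP : ∀ j, P ≤ v j → (P' : ℝ) ≤ v j := fun j hj => by
    rcases hP' with h | h
    · rw [h]; exact hj
    · exact (h.2 j hj).le
  have f1 : ∀ k, (P' : ℝ) ≤ x' k ↔ P ≤ x k := by
    intro k
    by_cases hk : k ∈ I
    · rw [hx', hx, joinSamples_of_mem _ _ hk, joinSamples_of_mem _ _ hk]
      by_cases hle : P ≤ b ⟨k, hk⟩
      · simp [hb', hle]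
      · have : (0 : ℝ) ≤ b ⟨k, hk⟩ := (b _).2
        have h0 : (0 : ℝ) < P' := by push Not at hle; linarith
        simp [hb', hle]
        exact_mod_cast h0
    · rw [hx', hx, joinSamples_of_notMem _ _ hk, joinSamples_of_notMem _ _ hk]
      exact ⟨hPP'.trans, hvP _⟩
  have hI : ∀ k, ∀ hk : k ∈ I, x' k = 0 ∨ x' k = P' ∧ P ≤ x k := by
    intro k hk
    rw [hx', hx, joinSamples_of_mem _ _ hk, joinSamples_of_mem _ _ hk]
    by_cases hle : P ≤ b ⟨k, hk⟩
    · right; simp [hb', hle]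
    · left; simp [hb', hle]
  have hnI : ∀ k, k ∉ I → x' k = x k := by
    intro k hk
    rw [hx', hx, joinSamples_of_notMem _ _ hk, joinSamples_of_notMem _ _ hk]
  have hκ : countGE x' P' = countGE x P := by
    unfold countGE
    congr 1
    ext k
    simp [f1 k]
  have hκN := lt_countGE_ERM hN hc x
  have hκpos : (0 : ℝ) < countGE x P := lt_of_le_of_lt (by positivity) hκN
  -- Competing levels gain no supporters, except possibly levels in `(P, P']`, which carry no entry
  -- of `x'` other than `P'` itself. Positivity of `p` is needed because some bids have been lowered
  -- to `0`.
  have f2 : ∀ p, 0 < p → (p ≤ P ∨ (P' : ℝ) < p) → countGE x' p ≤ countGE x p := by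
    intro p hp0 hp
    refine Finset.card_le_card fun k hk => ?_
    simp only [Finset.mem_filter, Finset.mem_univ, true_and] at hk ⊢
    by_cases hkI : k ∈ I
    · rcases hI k hkI with h | ⟨h, h'⟩
      · rw [h] at hk; linarith
      · rw [h] at hk
        rcases hp with hp | hp
        · exact hp.trans h'
        · linarith
    · rwa [← hnI k hkI]
  obtain ⟨i₀, hi₀⟩ : ∃ i₀, x' i₀ = P' := by
    obtain ⟨k, hk⟩ := ERM_mem hN hc x
    rw [← hP] at hk
    by_cases hkI : k ∈ I
    · rcases hI k hkI with h | ⟨h, -⟩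
      · have h1 := (f1 k).2 hk.le
        rw [h] at h1
        refine ⟨k, h.trans (le_antisymm P'.2 h1)⟩
      · exact ⟨k, h⟩
    · rcases hP' with h | h
      · exact ⟨k, by rw [hnI k hkI, ← hk, h]⟩
      · have h1 := h.2 ⟨k, hkI⟩
        rw [← joinSamples_of_notMem b v hkI, ← hx, ← hk] at h1
        exact absurd (h1 le_rfl) (not_lt.2 hPP')
  rw [← hi₀]
  refine ERM_eq_of_forall hN hc ?_ ?_ ?_
  · rw [hi₀, hκ]; exact hκN
  · rw [hi₀, hκ]
    intro j hj hcj
    have hjc : ((j : ℕ) : ℝ) + 1 ≤ countGE x P := by exact_mod_cast hj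
    have hle : (P' : ℝ) ≤ sortedDesc x' j := (le_sortedDesc_iff _ _ _).2 (by rw [hκ]; exact hj)
    rcases hle.eq_or_lt with h | h
    · rw [← h]; exact mul_le_mul_of_nonneg_right hjc P'.2
    · have h0 : 0 < sortedDesc x' j := lt_of_le_of_lt P'.2 h
      have h1 : (j : ℕ) + 1 ≤ countGE x (sortedDesc x' j) :=
        ((le_sortedDesc_iff x' _ j).1 le_rfl).trans (f2 _ h0 (Or.inr h))
      have h1' : ((j : ℕ) : ℝ) + 1 ≤ countGE x (sortedDesc x' j) := by exact_mod_cast h1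
      have h2 := mul_countGE_le_ERM hN hc hc0 hx0 (hcj.trans_le h1')
      rw [← hP] at h2
      nlinarith
  · rw [hi₀, hκ]
    intro j hj
    have hlt : sortedDesc x' j < P' := by
      by_contra hle
      have := (le_sortedDesc_iff x' _ j).1 (not_lt.1 hle)
      rw [hκ] at this
      omega
    obtain ⟨k, hk⟩ := exists_eq_sortedDesc x' j
    have hj0 : 0 ≤ sortedDesc x' j := by rw [hk]; exact joinSamples_nonneg b' hv k
    rcases hj0.eq_or_lt with h0 | h0
    · rw [← h0, mul_zero]; exact mul_pos hκpos (h0 ▸ hlt)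
    · have hltP : sortedDesc x' j < P := by
        by_contra hle
        have := (f1 k).2
        by_cases hkI : k ∈ I
        · rcases hI k hkI with h | ⟨h, -⟩
          · rw [hk, h] at h0; exact lt_irrefl _ h0
          · rw [hk, h] at hlt; exact lt_irrefl _ hlt
        · rw [hk, hnI k hkI] at hle
          have := this (not_lt.1 hle)
          rw [hk] at hlt
          linarith
      have h1 : (j : ℕ) + 1 ≤ countGE x (sortedDesc x' j) :=
        ((le_sortedDesc_iff x' _ j).1 le_rfl).trans (f2 _ h0 (Or.inl hltP.le))
      have h2 : sortedDesc x' j ≤ sortedDesc x j := (le_sortedDesc_iff x _ j).2 h1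
      have h3 := mul_sortedDesc_lt_ERM hN hc hx0 (j := j) hj
      rw [← hP] at h3
      have : (0 : ℝ) ≤ (j : ℕ) := by positivity
      nlinarith

/-- Bids that are fixed rationals or copies of honest samples. -/
noncomputable def simpleBids {N : ℕ} {I : Finset (Fin N)}
    (g : {i : Fin N // i ∈ I} → ℚ≥0 ⊕ {j : Fin N // j ∉ I}) (v : {j : Fin N // j ∉ I} → ℝ)
    (i : {i : Fin N // i ∈ I}) : ℝ≥0 :=
  Sum.elim (fun q : ℚ≥0 => (q : ℝ≥0)) (fun j => (v j).toNNReal) (g i)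

/-- If the price is an honest sample, the supporting bids can be copies of it. Otherwise they can be
raised to a rational level below the next honest sample. Raising is the safe direction: the price
keeps its number of supporters and earns more per supporter, whereas lowering could let a competitor
win. -/
theorem exists_simpleBids_ERM {N : ℕ} (hN : 0 < N) {c : ℝ} (hc0 : 0 ≤ c) (hc : c < 1)
    {I : Finset (Fin N)} (b : {i : Fin N // i ∈ I} → ℝ≥0) {v : {j : Fin N // j ∉ I} → ℝ}
    (hv : ∀ j, 0 ≤ v j) {ε : ℝ} (hε : 0 < ε) :
    ∃ g, ERM c (joinSamples I b v) ≤ ERM c (joinSamples I (simpleBids g v) v) ∧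
      ERM c (joinSamples I (simpleBids g v) v) < ERM c (joinSamples I b v) + ε := by
  classical
  set P := ERM c (joinSamples I b v) with hP
  have hP0 : 0 ≤ P := ERM_nonneg c (joinSamples_nonneg b hv)
  by_cases h : ∃ j, v j = P
  · obtain ⟨j, hj⟩ := h
    have h1 := ERM_joinSamples_replace hN hc0 hc b hv (v j).toNNReal
      (Or.inl (by rw [Real.coe_toNNReal _ (hv j), hj]))
    rw [← hP] at h1
    refine ⟨fun i => if P ≤ b i then Sum.inr j else Sum.inl 0, ?_⟩
    have h2 : simpleBids (fun i => if P ≤ b i then Sum.inr j else Sum.inl 0) v =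
        fun i => if P ≤ b i then (v j).toNNReal else 0 := by
      funext i
      by_cases hi : P ≤ b i <;> simp [simpleBids, hi]
    rw [h2, h1, Real.coe_toNNReal _ (hv j), hj]
    exact ⟨le_rfl, by linarith⟩
  · push Not at h
    obtain ⟨δ, hδ, hδε, hδv⟩ : ∃ δ, 0 < δ ∧ δ ≤ ε ∧ ∀ j, P ≤ v j → P + δ ≤ v j := by
      by_cases hne : (Finset.univ.filter fun j => P ≤ v j).Nonempty
      · obtain ⟨j, hj, hmin⟩ := Finset.exists_min_image _ v hne
        simp only [Finset.mem_filter, Finset.mem_univ, true_and] at hj hmin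
        have hlt : P < v j := lt_of_le_of_ne hj (Ne.symm (h j))
        refine ⟨min ε (v j - P), lt_min hε (by linarith), min_le_left _ _, fun k hk => ?_⟩
        have := hmin k hk
        have := min_le_right ε (v j - P)
        linarith
      · refine ⟨ε, hε, le_rfl, fun j hj => ?_⟩
        exact absurd ⟨j, by simpa using hj⟩ hne
    obtain ⟨q, hq1, hq2⟩ := exists_rat_btwn (show P < P + δ by linarith)
    have hq0 : 0 ≤ q := by
      have : (0 : ℝ) ≤ q := by linarith
      exact_mod_cast this
    obtain ⟨r, rfl⟩ : ∃ r : ℚ≥0, (r : ℚ) = q := ⟨⟨q, hq0⟩, rfl⟩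
    have hr : (((r : ℝ≥0) : ℝ≥0) : ℝ) = ((r : ℚ) : ℝ) := by norm_cast
    have h1 := ERM_joinSamples_replace hN hc0 hc b hv (r : ℝ≥0)
      (Or.inr ⟨by rw [← hP, hr]; exact hq1, fun j hj => by
        rw [hr]; exact hq2.trans_le (hδv j hj)⟩)
    rw [← hP] at h1
    refine ⟨fun i => if P ≤ b i then Sum.inl r else Sum.inl 0, ?_⟩
    have h2 : simpleBids (fun i => if P ≤ b i then Sum.inl r else Sum.inl 0) v =
        fun i => if P ≤ b i then (r : ℝ≥0) else 0 := by
      funext i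
      by_cases hi : P ≤ b i <;> simp [simpleBids, hi]
    rw [h2, h1, hr]
    exact ⟨hq1.le, by linarith⟩

/-! ### Measurability of ERM -/

theorem measurable_countGE {ι : Type*} [Fintype ι] (p : ℝ) :
    Measurable fun x : ι → ℝ => countGE x p := by
  have : (fun x : ι → ℝ => countGE x p) = fun x => ∑ i, if p ≤ x i then 1 else 0 := by
    funext x
    simp [countGE]
  rw [this]
  refine Finset.measurable_sum _ fun i _ => ?_
  exact Measurable.ite (measurableSet_le measurable_const (measurable_pi_apply i))
    measurable_const measurable_const

theorem measurable_sortedDesc {N : ℕ} (i : Fin N) :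
    Measurable fun x : Fin N → ℝ => sortedDesc x i := by
  refine measurable_of_Ici fun p => ?_
  have : (fun x : Fin N → ℝ => sortedDesc x i) ⁻¹' Set.Ici p =
      (fun x : Fin N → ℝ => countGE x p) ⁻¹' Set.Ici ((i : ℕ) + 1) := by
    ext x
    simp only [Set.mem_preimage, Set.mem_Ici]
    exact le_sortedDesc_iff x p i
  rw [this]
  exact measurable_countGE p measurableSet_Ici

theorem measurableSet_mem_ermArgmax {N : ℕ} (c : ℝ) (i : Fin N) :
    MeasurableSet {x : Fin N → ℝ | i ∈ ermArgmax c x} := by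
  have : {x : Fin N → ℝ | i ∈ ermArgmax c x} = {x : Fin N → ℝ | c * N < ((i : ℕ) : ℝ) + 1} ∩
      ⋂ j : Fin N, ⋂ _ : c * N < ((j : ℕ) : ℝ) + 1, {x : Fin N → ℝ |
        (((j : ℕ) : ℝ) + 1) * sortedDesc x j ≤ (((i : ℕ) : ℝ) + 1) * sortedDesc x i} := by
    ext x
    simp [mem_ermArgmax]
  rw [this]
  refine (MeasurableSet.const _).inter <| MeasurableSet.iInter fun j => MeasurableSet.iInter fun _ => ?_
  exact measurableSet_le (measurable_const.mul (measurable_sortedDesc j))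
    (measurable_const.mul (measurable_sortedDesc i))

theorem measurable_ERM {N : ℕ} (c : ℝ) : Measurable (ERM c : (Fin N → ℝ) → ℝ) := by
  classical
  have hfib : ∀ s : Finset (Fin N), MeasurableSet {x : Fin N → ℝ | ermArgmax c x = s} := by
    intro s
    have : {x : Fin N → ℝ | ermArgmax c x = s} =
        ⋂ i, {x : Fin N → ℝ | i ∈ ermArgmax c x ↔ i ∈ s} := by
      ext x; simp [Finset.ext_iff]
    rw [this]
    refine MeasurableSet.iInter fun i => ?_
    exact (measurableSet_mem_ermArgmax c i).iff (MeasurableSet.const _)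
  have : (ERM c : (Fin N → ℝ) → ℝ) = fun x => ∑ s : Finset (Fin N),
      -- On each of the finitely many fibres of `ermArgmax` the price is a fixed order statistic.
      if ermArgmax c x = s then (if h : s.Nonempty then sortedDesc x (s.max' h) else 0) else 0 := by
    funext x
    rw [Finset.sum_ite_eq]
    simp [ERM]
  rw [this]
  refine Finset.measurable_sum _ fun s _ => Measurable.ite (hfib s) ?_ measurable_const
  split_ifs with h
  · exact measurable_sortedDesc _
  · exact measurable_const

theorem measurable_ERM_simpleBids {N : ℕ} (c : ℝ) {I : Finset (Fin N)}
    (g : {i : Fin N // i ∈ I} → ℚ≥0 ⊕ {j : Fin N // j ∉ I}) :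
    Measurable fun v : {j : Fin N // j ∉ I} → ℝ =>
      ERM c (joinSamples I (simpleBids g v) v) := by
  refine (measurable_ERM c).comp (measurable_pi_lambda _ fun k => ?_)
  by_cases hk : k ∈ I
  · simp only [joinSamples_of_mem _ _ hk, simpleBids]
    rcases g ⟨k, hk⟩ with q | j
    · simp only [Sum.elim_inl]; exact measurable_const
    · simp only [Sum.elim_inr]
      exact measurable_coe_nnreal_real.comp (measurable_real_toNNReal.comp (measurable_pi_apply j))
  · simp only [joinSamples_of_notMem _ _ hk]
    exact measurable_pi_apply _

/-! ### Bounds and measurability of the incentive-awareness measure -/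

/-- More than `c N ≥ |I|` entries support the price, so one of them is honest. This keeps the prices
bounded as the bids vary; without it the real-valued `⨆` would be a junk value. -/
theorem exists_ERM_joinSamples_le {N : ℕ} (hN : 0 < N) {c : ℝ} (hc : c < 1)
    {I : Finset (Fin N)} (hI : (I.card : ℝ) ≤ c * N) (b : {i : Fin N // i ∈ I} → ℝ≥0)
    (v : {j : Fin N // j ∉ I} → ℝ) : ∃ j, ERM c (joinSamples I b v) ≤ v j := by
  have h1 := lt_countGE_ERM hN hc (joinSamples I b v)
  have h2 := countGE_joinSamples_le b v (ERM c (joinSamples I b v))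
  have h3 : (countGE (joinSamples I b v) (ERM c (joinSamples I b v)) : ℝ) ≤
    countGE v (ERM c (joinSamples I b v)) + I.card := by exact_mod_cast h2
  have h4 : (0 : ℝ) < countGE v (ERM c (joinSamples I b v)) := by linarith
  have h5 : 0 < countGE v (ERM c (joinSamples I b v)) := by exact_mod_cast h4
  obtain ⟨j, hj⟩ := Finset.card_pos.1 h5
  exact ⟨j, by simpa using hj⟩

theorem bddAbove_ERM_joinSamples {N : ℕ} (hN : 0 < N) {c : ℝ} (hc : c < 1)
    {I : Finset (Fin N)} (hI : (I.card : ℝ) ≤ c * N) {v : {j : Fin N // j ∉ I} → ℝ}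
    (hv : ∀ j, 0 ≤ v j) :
    BddAbove (Set.range fun b : {i : Fin N // i ∈ I} → ℝ≥0 => ERM c (joinSamples I b v)) := by
  refine ⟨∑ j, v j, ?_⟩
  rintro _ ⟨b, rfl⟩
  obtain ⟨j, hj⟩ := exists_ERM_joinSamples_le hN hc hI b v
  exact hj.trans (Finset.single_le_sum (fun k _ => hv k) (Finset.mem_univ j))

theorem bddBelow_ERM_joinSamples {N : ℕ} (c : ℝ)
    {I : Finset (Fin N)} {v : {j : Fin N // j ∉ I} → ℝ} (hv : ∀ j, 0 ≤ v j) :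
    BddBelow (Set.range fun b : {i : Fin N // i ∈ I} → ℝ≥0 => ERM c (joinSamples I b v)) := by
  refine ⟨0, ?_⟩
  rintro _ ⟨b, rfl⟩
  exact ERM_nonneg c (joinSamples_nonneg b hv)

theorem awareness_le_of_forall {N : ℕ} {c : ℝ} {I : Finset (Fin N)}
    {v : {j : Fin N // j ∉ I} → ℝ} (hv : ∀ j, 0 ≤ v j) {D : ℝ} (hD : 0 ≤ D)
    (vI : {i : Fin N // i ∈ I} → ℝ≥0)
    (h : ∀ b, (1 - D) * ERM c (joinSamples I vI v) ≤ ERM c (joinSamples I b v)) :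
    awareness (ERM c) I vI v ≤ D := by
  unfold awareness
  split_ifs with h0
  · exact hD
  · have hpos := lt_of_le_of_ne (ERM_nonneg c (joinSamples_nonneg vI hv)) (Ne.symm h0)
    have : 1 - D ≤ (⨅ b, ERM c (joinSamples I b v)) / ERM c (joinSamples I vI v) := by
      rw [le_div_iff₀ hpos]
      exact le_ciInf h
    linarith

theorem awareness_nonneg {N : ℕ} {c : ℝ} {I : Finset (Fin N)}
    {v : {j : Fin N // j ∉ I} → ℝ} (hv : ∀ j, 0 ≤ v j) (vI : {i : Fin N // i ∈ I} → ℝ≥0) :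
    0 ≤ awareness (ERM c) I vI v := by
  unfold awareness
  split_ifs with h0
  · exact le_rfl
  · have hpos := lt_of_le_of_ne (ERM_nonneg c (joinSamples_nonneg vI hv)) (Ne.symm h0)
    rw [sub_nonneg, div_le_one hpos]
    exact ciInf_le (bddBelow_ERM_joinSamples c hv) vI

theorem awareness_le_one {N : ℕ} {c : ℝ} {I : Finset (Fin N)}
    {v : {j : Fin N // j ∉ I} → ℝ} (hv : ∀ j, 0 ≤ v j) (vI : {i : Fin N // i ∈ I} → ℝ≥0) :
    awareness (ERM c) I vI v ≤ 1 :=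
  awareness_le_of_forall hv zero_le_one vI fun b => by
    simpa using ERM_nonneg c (joinSamples_nonneg b hv)

theorem worstAwareness_le_of_forall {N : ℕ} {c : ℝ} {I : Finset (Fin N)}
    {v : {j : Fin N // j ∉ I} → ℝ} (hv : ∀ j, 0 ≤ v j) {D : ℝ} (hD : 0 ≤ D)
    (h : ∀ b₁ b₂, (1 - D) * ERM c (joinSamples I b₁ v) ≤ ERM c (joinSamples I b₂ v)) :
    worstAwareness (ERM c) I v ≤ D :=
  ciSup_le fun vI => awareness_le_of_forall hv hD vI (h vI)

theorem worstAwareness_le_one {N : ℕ} {c : ℝ} {I : Finset (Fin N)}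
    {v : {j : Fin N // j ∉ I} → ℝ} (hv : ∀ j, 0 ≤ v j) : worstAwareness (ERM c) I v ≤ 1 :=
  ciSup_le fun vI => awareness_le_one hv vI

theorem bddAbove_awareness {N : ℕ} {c : ℝ} {I : Finset (Fin N)}
    {v : {j : Fin N // j ∉ I} → ℝ} (hv : ∀ j, 0 ≤ v j) :
    BddAbove (Set.range fun vI => awareness (ERM c) I vI v) := by
  refine ⟨1, ?_⟩
  rintro _ ⟨vI, rfl⟩
  exact awareness_le_one hv vI

theorem worstAwareness_nonneg {N : ℕ} {c : ℝ} {I : Finset (Fin N)}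
    {v : {j : Fin N // j ∉ I} → ℝ} (hv : ∀ j, 0 ≤ v j) : 0 ≤ worstAwareness (ERM c) I v :=
  (awareness_nonneg hv fun _ => 0).trans (le_ciSup (bddAbove_awareness hv) _)

/-- The worst case compares the largest attainable price with the smallest, and both are already
approached by simple bids. The index set of these is countable, so the right-hand side is visibly
measurable in `v`. -/
theorem worstAwareness_eq {N : ℕ} (hN : 0 < N) {c : ℝ} (hc0 : 0 ≤ c) (hc : c < 1)
    {I : Finset (Fin N)} (hI : (I.card : ℝ) ≤ c * N)
    {v : {j : Fin N // j ∉ I} → ℝ} (hv : ∀ j, 0 ≤ v j) :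
    worstAwareness (ERM c) I v =
      if (⨆ g, ERM c (joinSamples I (simpleBids g v) v)) = 0 then 0
      else 1 - (⨅ g, ERM c (joinSamples I (simpleBids g v) v)) /
        ⨆ g, ERM c (joinSamples I (simpleBids g v) v) := by
  set f : ({i : Fin N // i ∈ I} → ℝ≥0) → ℝ := fun b => ERM c (joinSamples I b v) with hf
  have hbA : BddAbove (Set.range f) := bddAbove_ERM_joinSamples hN hc hI hv
  have hbB : BddBelow (Set.range f) := bddBelow_ERM_joinSamples c hv
  have hf0 : ∀ b, 0 ≤ f b := fun b => ERM_nonneg c (joinSamples_nonneg b hv)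
  have hne : Nonempty ({i : Fin N // i ∈ I} → ℚ≥0 ⊕ {j : Fin N // j ∉ I}) :=
    ⟨fun _ => Sum.inl 0⟩
  have hgA : BddAbove (Set.range fun g => f (simpleBids g v)) :=
    hbA.mono (by rintro _ ⟨g, rfl⟩; exact ⟨_, rfl⟩)
  have hgB : BddBelow (Set.range fun g => f (simpleBids g v)) :=
    hbB.mono (by rintro _ ⟨g, rfl⟩; exact ⟨_, rfl⟩)
  have hsup : ⨆ g, f (simpleBids g v) = ⨆ b, f b := by
    refine le_antisymm (ciSup_le fun g => le_ciSup hbA _) (ciSup_le fun b => ?_)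
    obtain ⟨g, hg, -⟩ := exists_simpleBids_ERM hN hc0 hc b hv one_pos
    exact hg.trans (le_ciSup hgA g)
  have hinf : ⨅ g, f (simpleBids g v) = ⨅ b, f b := by
    refine le_antisymm (le_ciInf fun b => le_of_forall_pos_le_add fun ε hε => ?_)
      (le_ciInf fun g => ciInf_le hbB _)
    obtain ⟨g, -, hg⟩ := exists_simpleBids_ERM hN hc0 hc b hv hε
    exact (ciInf_le hgB g).trans hg.le
  change _ = if (⨆ g, f (simpleBids g v)) = 0 then 0
    else 1 - (⨅ g, f (simpleBids g v)) / ⨆ g, f (simpleBids g v)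
  rw [hsup, hinf]
  have hle : ∀ b, f b ≤ ⨆ b, f b := fun b => le_ciSup hbA b
  split_ifs with h0
  · have hall : ∀ b, f b = 0 := fun b => le_antisymm (h0 ▸ hle b) (hf0 b)
    have : ∀ vI, awareness (ERM c) I vI v = 0 := fun vI => if_pos (hall vI)
    simp [worstAwareness, this]
  · have hpos : 0 < ⨆ b, f b :=
      lt_of_le_of_ne ((hf0 fun _ => 0).trans (hle _)) (Ne.symm h0)
    have hi0 : 0 ≤ ⨅ b, f b := le_ciInf hf0
    have hw1 := worstAwareness_le_one (c := c) hv
    have hw : ∀ b, (1 - worstAwareness (ERM c) I v) * f b ≤ ⨅ b, f b := by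
      intro b
      rcases (hf0 b).eq_or_lt with h | h
      · rw [← h, mul_zero]; exact hi0
      · have h1 : awareness (ERM c) I b v ≤ worstAwareness (ERM c) I v :=
          le_ciSup (bddAbove_awareness hv) b
        unfold awareness at h1
        rw [if_neg h.ne'] at h1
        rw [← le_div_iff₀ h]
        change 1 - (⨅ b, f b) / f b ≤ _ at h1
        linarith
    refine le_antisymm (ciSup_le fun vI => awareness_le_of_forall hv ?_ vI fun b => ?_) ?_
    · rw [sub_nonneg, div_le_one hpos]
      exact (ciInf_le hbB fun _ => 0).trans (hle _)
    · change (1 - (1 - (⨅ b, f b) / ⨆ b, f b)) * f vI ≤ f b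
      refine le_trans ?_ (ciInf_le hbB b)
      rw [sub_sub_cancel, div_mul_eq_mul_div, div_le_iff₀ hpos]
      exact mul_le_mul_of_nonneg_left (hle vI) hi0
    · rcases hw1.eq_or_lt with h | h
      · rw [h]; have := div_nonneg hi0 hpos.le; linarith
      · have h1 : ⨆ b, f b ≤ (⨅ b, f b) / (1 - worstAwareness (ERM c) I v) :=
          ciSup_le fun b => by
            rw [le_div_iff₀ (by linarith), mul_comm]; exact hw b
        rw [le_div_iff₀ (by linarith)] at h1
        have : 1 - worstAwareness (ERM c) I v ≤ (⨅ b, f b) / ⨆ b, f b := by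
          rw [le_div_iff₀ hpos, mul_comm]; exact h1
        linarith

theorem ae_nonneg_restLaw {N : ℕ} {μ : Measure ℝ} [IsProbabilityMeasure μ] {I : Finset (Fin N)}
    (hμ : ∀ᵐ x ∂μ, 0 ≤ x) : ∀ᵐ v ∂(restLaw μ I), ∀ j, 0 ≤ v j :=
  Measure.ae_pi_le_pi (Filter.eventually_pi fun _ => hμ)

theorem integrable_worstAwareness {N : ℕ} (hN : 0 < N) {c : ℝ} (hc0 : 0 ≤ c) (hc : c < 1)
    {I : Finset (Fin N)} (hI : (I.card : ℝ) ≤ c * N) {μ : Measure ℝ} [IsProbabilityMeasure μ]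
    (hμ : ∀ᵐ x ∂μ, 0 ≤ x) : Integrable (worstAwareness (ERM c) I) (restLaw μ I) := by
  have hae := ae_nonneg_restLaw (I := I) hμ
  have : IsProbabilityMeasure (restLaw μ I) := by unfold restLaw; infer_instance
  refine Integrable.of_bound (C := 1) ?_ ?_
  · have hms : Measurable fun v : {j : Fin N // j ∉ I} → ℝ =>
        ⨆ g, ERM c (joinSamples I (simpleBids g v) v) :=
      Measurable.iSup fun g => measurable_ERM_simpleBids c g
    have hmi : Measurable fun v : {j : Fin N // j ∉ I} → ℝ =>
        ⨅ g, ERM c (joinSamples I (simpleBids g v) v) :=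
      Measurable.iInf fun g => measurable_ERM_simpleBids c g
    refine AEStronglyMeasurable.congr (f := fun v : {j : Fin N // j ∉ I} → ℝ =>
      if (⨆ g, ERM c (joinSamples I (simpleBids g v) v)) = 0 then 0
      else 1 - (⨅ g, ERM c (joinSamples I (simpleBids g v) v)) /
        ⨆ g, ERM c (joinSamples I (simpleBids g v) v)) ?_ ?_
    · exact (Measurable.ite (hms (measurableSet_singleton 0)) measurable_const
        (measurable_const.sub (hmi.div hms))).aestronglyMeasurable
    · filter_upwards [hae] with v hv
      exact (worstAwareness_eq hN hc0 hc hI hv).symm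
  · filter_upwards [hae] with v hv
    rw [Real.norm_eq_abs, abs_of_nonneg (worstAwareness_nonneg hv)]
    exact worstAwareness_le_one hv

/-- A strict inequality survives the small error made by simple bids, so the existential becomes a
countable union. This lemma and the next make the crossing events measurable. -/
theorem measurableSet_exists_ERM_lt {N : ℕ} (hN : 0 < N) {c : ℝ} (hc0 : 0 ≤ c) (hc : c < 1)
    (I : Finset (Fin N)) (t : ℝ) :
    MeasurableSet {v : {j : Fin N // j ∉ I} → ℝ |
      (∀ j, 0 ≤ v j) ∧ ∃ b, ERM c (joinSamples I b v) < t} := by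
  have : {v : {j : Fin N // j ∉ I} → ℝ |
      (∀ j, 0 ≤ v j) ∧ ∃ b, ERM c (joinSamples I b v) < t} =
      (⋂ j, {v | 0 ≤ v j}) ∩ ⋃ g, {v | ERM c (joinSamples I (simpleBids g v) v) < t} := by
    ext v
    simp only [Set.mem_ofPred_eq, Set.mem_inter_iff, Set.mem_iInter, Set.mem_iUnion]
    refine and_congr_right fun hv => ⟨?_, fun ⟨g, hg⟩ => ⟨_, hg⟩⟩
    rintro ⟨b, hb⟩
    obtain ⟨g, -, hg⟩ := exists_simpleBids_ERM hN hc0 hc b hv (sub_pos.2 hb)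
    exact ⟨g, by linarith⟩
  rw [this]
  exact (MeasurableSet.iInter fun j => measurableSet_le measurable_const
    (measurable_pi_apply j)).inter (MeasurableSet.iUnion fun g =>
      measurableSet_lt (measurable_ERM_simpleBids c g) measurable_const)

theorem measurableSet_exists_lt_ERM {N : ℕ} (hN : 0 < N) {c : ℝ} (hc0 : 0 ≤ c) (hc : c < 1)
    (I : Finset (Fin N)) (t : ℝ) :
    MeasurableSet {v : {j : Fin N // j ∉ I} → ℝ |
      (∀ j, 0 ≤ v j) ∧ ∃ b, t < ERM c (joinSamples I b v)} := by
  have : {v : {j : Fin N // j ∉ I} → ℝ |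
      (∀ j, 0 ≤ v j) ∧ ∃ b, t < ERM c (joinSamples I b v)} =
      (⋂ j, {v | 0 ≤ v j}) ∩ ⋃ g, {v | t < ERM c (joinSamples I (simpleBids g v) v)} := by
    ext v
    simp only [Set.mem_ofPred_eq, Set.mem_inter_iff, Set.mem_iInter, Set.mem_iUnion]
    refine and_congr_right fun hv => ⟨?_, fun ⟨g, hg⟩ => ⟨_, hg⟩⟩
    rintro ⟨b, hb⟩
    obtain ⟨g, hg, -⟩ := exists_simpleBids_ERM hN hc0 hc b hv one_pos
    exact ⟨g, hb.trans_le hg⟩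
  rw [this]
  exact (MeasurableSet.iInter fun j => measurableSet_le measurable_const
    (measurable_pi_apply j)).inter (MeasurableSet.iUnion fun g =>
      measurableSet_lt measurable_const (measurable_ERM_simpleBids c g))

theorem worstAwareness_eq_zero_of_card_eq_zero {N : ℕ} {I : Finset (Fin N)} (hI : I.card = 0)
    (P : (Fin N → ℝ) → ℝ) (v : {j : Fin N // j ∉ I} → ℝ) : worstAwareness P I v = 0 := by
  obtain rfl := Finset.card_eq_zero.1 hI
  have : ∀ vI, awareness P ∅ vI v = 0 := by
    intro vI
    unfold awareness
    split_ifs with h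
    · rfl
    · have : (⨅ b, P (joinSamples ∅ b v)) = P (joinSamples ∅ vI v) := by
        rw [ciInf_unique]
        congr 2
        exact Subsingleton.elim _ _
      rw [this, div_self h, sub_self]
  simp [worstAwareness, this]

/-! ### Anti-concentration of binomial counts -/

theorem centralBinom_sq_mul_le (t : ℕ) : t.centralBinom ^ 2 * (2 * t + 1) ≤ 16 ^ t := by
  induction t with
  | zero => simp
  | succ t ih =>
    have h := Nat.succ_mul_centralBinom_succ t
    have h1 : (t + 1) ^ 2 * ((t + 1).centralBinom ^ 2 * (2 * (t + 1) + 1)) =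
        4 * (2 * t + 1) * (2 * t + 3) * (t.centralBinom ^ 2 * (2 * t + 1)) := by
      calc _ = ((t + 1) * (t + 1).centralBinom) ^ 2 * (2 * t + 3) := by ring
        _ = _ := by rw [h]; ring
    -- The induction closes because `(2 t + 1) (2 t + 3) ≤ (2 t + 2) ^ 2`.
    have h2 : 4 * (2 * t + 1) * (2 * t + 3) * (t.centralBinom ^ 2 * (2 * t + 1)) ≤
        16 * (t + 1) ^ 2 * 16 ^ t := Nat.mul_le_mul (by nlinarith) ih
    have h3 : (t + 1) ^ 2 * ((t + 1).centralBinom ^ 2 * (2 * (t + 1) + 1)) ≤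
        (t + 1) ^ 2 * 16 ^ (t + 1) := by
      rw [h1]; refine h2.trans (le_of_eq ?_); ring
    exact Nat.le_of_mul_le_mul_left h3 (by positivity)

theorem choose_sq_mul_le (n k : ℕ) : n.choose k ^ 2 * n ≤ 4 ^ n := by
  have hmid : n.choose k ^ 2 * n ≤ n.choose (n / 2) ^ 2 * n := by
    gcongr
    exact Nat.choose_le_middle k n
  refine hmid.trans ?_
  obtain ⟨t, rfl | rfl⟩ := Nat.even_or_odd' n
  · rw [Nat.mul_div_cancel_left t two_pos, ← Nat.centralBinom_eq_two_mul_choose]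
    have h := centralBinom_sq_mul_le t
    rw [pow_mul]
    norm_num
    nlinarith
  · have h1 : (2 * t + 1) / 2 = t := by omega
    rw [h1]
    have h2 : (t + 1).centralBinom = 2 * (2 * t + 1).choose t := by
      rw [Nat.centralBinom_eq_two_mul_choose, show 2 * (t + 1) = 2 * t + 1 + 1 by ring,
        Nat.choose_succ_succ, Nat.choose_symm_half]
      ring
    have h := centralBinom_sq_mul_le (t + 1)
    rw [h2] at h
    have h3 : (16 : ℕ) ^ (t + 1) = 4 * 4 ^ (2 * t + 1) := by
      rw [show (16 : ℕ) = 4 ^ 2 by norm_num, ← pow_mul]; ring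
    rw [h3] at h
    nlinarith

theorem choose_mul_sqrt_le (n k : ℕ) : (n.choose k : ℝ) * √n ≤ 2 ^ n := by
  have h : ((n.choose k : ℝ) * √n) ^ 2 ≤ (2 ^ n) ^ 2 := by
    rw [mul_pow, Real.sq_sqrt (by positivity), ← pow_mul, mul_comm n 2, pow_mul]
    norm_num
    exact_mod_cast choose_sq_mul_le n k
  exact le_of_sq_le_sq h (by positivity)

theorem card_filter_card_inter_eq_le {ι : Type*} [Fintype ι] [DecidableEq ι] (J : Finset ι)
    (k : ℕ) : (Finset.univ.filter fun t : Finset ι => (t ∩ J).card = k).card ≤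
      J.card.choose k * 2 ^ (Fintype.card ι - J.card) := by
  rw [← Finset.card_powersetCard, ← Finset.card_compl, ← Finset.card_powerset,
    ← Finset.card_product]
  refine Finset.card_le_card_of_injOn (fun t => (t ∩ J, t \ J)) ?_ ?_
  · intro t ht
    simp only [Finset.coe_filter, Finset.mem_univ, true_and, Set.mem_ofPred_eq] at ht
    simp only [Finset.coe_product, Set.mem_prod, Finset.mem_coe, Finset.mem_powersetCard,
      Finset.mem_powerset]
    refine ⟨⟨Finset.inter_subset_right, ht⟩, fun i hi => ?_⟩
    simp only [Finset.mem_compl, Finset.mem_sdiff] at hi ⊢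
    exact hi.2
  · intro t _ t' _ h
    simp only [Prod.mk.injEq] at h
    rw [← Finset.sdiff_union_inter t J, ← Finset.sdiff_union_inter t' J, h.1, h.2]

/-- The symmetric difference with `A` is an injection that turns the statistic into the size of the
intersection with `A ∪ C`, a plain binomial count. -/
theorem card_filter_flip_eq_mul_sqrt_le {ι : Type*} [Fintype ι] [DecidableEq ι]
    {A C : Finset ι} (hAC : Disjoint A C) (k : ℕ) :
    ((Finset.univ.filter fun s : Finset ι => (A \ s).card + (C ∩ s).card = k).card : ℝ) *
      √((A.card + C.card : ℕ) : ℝ) ≤ 2 ^ Fintype.card ι := by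
  have hcard : (A ∪ C).card = A.card + C.card := Finset.card_union_of_disjoint hAC
  have h1 : (Finset.univ.filter fun s : Finset ι => (A \ s).card + (C ∩ s).card = k).card ≤
      (Finset.univ.filter fun t : Finset ι => (t ∩ (A ∪ C)).card = k).card := by
    refine Finset.card_le_card_of_injOn (fun s => symmDiff s A) ?_
      (symmDiff_left_injective A).injOn
    intro s hs
    simp only [Finset.coe_filter, Finset.mem_univ, true_and, Set.mem_ofPred_eq] at hs ⊢
    rw [← hs, ← Finset.card_union_of_disjoint]
    · congr 1
      ext i
      have : i ∈ A → i ∉ C := fun h1 => Finset.disjoint_left.1 hAC h1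
      simp only [Finset.mem_inter, Finset.mem_union, Finset.mem_symmDiff, Finset.mem_sdiff]
      tauto
    · refine Finset.disjoint_left.2 fun i hi hi' => ?_
      simp only [Finset.mem_inter, Finset.mem_sdiff] at hi hi'
      exact hi.2 hi'.2
  have h2 := h1.trans (card_filter_card_inter_eq_le (A ∪ C) k)
  rw [hcard] at h2
  have hle : A.card + C.card ≤ Fintype.card ι := hcard ▸ Finset.card_le_univ _
  have h3 : ((Finset.univ.filter fun s : Finset ι => (A \ s).card + (C ∩ s).card = k).card : ℝ) ≤
      ((A.card + C.card).choose k : ℝ) * 2 ^ (Fintype.card ι - (A.card + C.card)) := by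
    exact_mod_cast h2
  have h4 := choose_mul_sqrt_le (A.card + C.card) k
  calc _ ≤ ((A.card + C.card).choose k : ℝ) * 2 ^ (Fintype.card ι - (A.card + C.card)) *
        √((A.card + C.card : ℕ) : ℝ) := by gcongr
    _ = ((A.card + C.card).choose k : ℝ) * √((A.card + C.card : ℕ) : ℝ) *
        2 ^ (Fintype.card ι - (A.card + C.card)) := by ring
    _ ≤ 2 ^ (A.card + C.card) * 2 ^ (Fintype.card ι - (A.card + C.card)) := by gcongr
    _ = 2 ^ Fintype.card ι := by rw [← pow_add, Nat.add_sub_cancel' hle]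

/-- On `𝒮` the statistic stays within `d` of its minimum, so it takes at most `d + 1` values, and
each is taken by at most a `1 / √(|A| + |C|)` fraction of all subsets. -/
theorem card_mul_sqrt_le_of_flip_close {ι : Type*} [Fintype ι] [DecidableEq ι]
    {A C : Finset ι} (hAC : Disjoint A C) (𝒮 : Finset (Finset ι)) (d : ℕ)
    (h : ∀ s ∈ 𝒮, ∀ s' ∈ 𝒮,
      (A \ s').card + (C ∩ s').card ≤ (A \ s).card + (C ∩ s).card + d) :
    (𝒮.card : ℝ) * √((A.card + C.card : ℕ) : ℝ) ≤ (d + 1) * 2 ^ Fintype.card ι := by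
  rcases 𝒮.eq_empty_or_nonempty with rfl | hne
  · simp only [Finset.card_empty, Nat.cast_zero, zero_mul]; positivity
  obtain ⟨s₀, hs₀, hmin⟩ := Finset.exists_min_image 𝒮
    (fun s => (A \ s).card + (C ∩ s).card) hne
  set a : Finset ι → ℕ := fun s => (A \ s).card + (C ∩ s).card with ha
  have hsum : 𝒮.card = ∑ k ∈ Finset.Icc (a s₀) (a s₀ + d), (𝒮.filter fun s => a s = k).card :=
    Finset.card_eq_sum_card_fiberwise fun s hs =>
      Finset.mem_coe.2 (Finset.mem_Icc.2 ⟨hmin s hs, h s₀ hs₀ s hs⟩)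
  rw [hsum]
  push_cast
  rw [Finset.sum_mul]
  have hcard : (Finset.Icc (a s₀) (a s₀ + d)).card = d + 1 := by
    rw [Nat.card_Icc]; omega
  calc _ ≤ ∑ _k ∈ Finset.Icc (a s₀) (a s₀ + d), (2 : ℝ) ^ Fintype.card ι := by
        refine Finset.sum_le_sum fun k _ => le_trans ?_ (card_filter_flip_eq_mul_sqrt_le hAC k)
        push_cast
        refine mul_le_mul_of_nonneg_right ?_ (Real.sqrt_nonneg _)
        exact_mod_cast Finset.card_le_card (Finset.filter_subset_filter _ (Finset.subset_univ _))
    _ = _ := by rw [Finset.sum_const, hcard, nsmul_eq_mul]; push_cast; ring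

/-! ### Measure-preserving coordinate flips and interval exchanges -/

/-- Apply `σ` to the coordinates in `s`. -/
def flipCoords {ι : Type*} [DecidableEq ι] (σ : ℝ → ℝ) (s : Finset ι) (u : ι → ℝ) (i : ι) : ℝ :=
  if i ∈ s then σ (u i) else u i

theorem measurePreserving_flipCoords {ι : Type*} [Fintype ι] [DecidableEq ι] {ν : Measure ℝ}
    [IsProbabilityMeasure ν] {σ : ℝ → ℝ} (hσ : MeasurePreserving σ ν ν) (s : Finset ι) :
    MeasurePreserving (flipCoords σ s) (Measure.pi fun _ : ι => ν) (Measure.pi fun _ => ν) := by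
  have h : ∀ i : ι, MeasurePreserving (fun x => if i ∈ s then σ x else x) ν ν := by
    intro i
    split_ifs
    · exact hσ
    · exact MeasurePreserving.id ν
  exact measurePreserving_pi _ _ h

/-- If for every `u` at most a fraction `B` of the coordinate flips of `u` lies in `Y`, then `Y`
has measure at most `B`. -/
theorem measure_le_of_card_flip_le {ι : Type*} [Fintype ι] [DecidableEq ι] {ν : Measure ℝ}
    [IsProbabilityMeasure ν] {σ : ℝ → ℝ} (hσ : MeasurePreserving σ ν ν) {Y : Set (ι → ℝ)}
    (hY : MeasurableSet Y) {B : ℝ}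
    (h : ∀ u, ∀ 𝒮 : Finset (Finset ι), (∀ s ∈ 𝒮, flipCoords σ s u ∈ Y) →
      (𝒮.card : ℝ) ≤ B * 2 ^ Fintype.card ι) :
    (Measure.pi fun _ : ι => ν).real Y ≤ B := by
  classical
  set μ := Measure.pi fun _ : ι => ν with hμ
  have hmeas : ∀ s : Finset ι, MeasurableSet (flipCoords σ s ⁻¹' Y) := fun s =>
    (measurePreserving_flipCoords hσ s).measurable hY
  have hreal : ∀ s : Finset ι, ∫ u, (flipCoords σ s ⁻¹' Y).indicator (fun _ => (1 : ℝ)) u ∂μ =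
      μ.real Y := by
    intro s
    rw [integral_indicator_const _ (hmeas s), smul_eq_mul, mul_one, measureReal_def,
      measureReal_def, (measurePreserving_flipCoords hσ s).measure_preimage hY.nullMeasurableSet]
  have hint : ∀ s : Finset ι,
      Integrable ((flipCoords σ s ⁻¹' Y).indicator (fun _ => (1 : ℝ))) μ := fun s =>
    (integrable_const 1).indicator (hmeas s)
  -- All `2 ^ n` flips preserve the measure, so the measure of `Y` is the mean over `u` of the
  -- fraction of flips that land in `Y`.
  have h1 : (2 : ℝ) ^ Fintype.card ι * μ.real Y =
      ∫ u, ∑ s : Finset ι, (flipCoords σ s ⁻¹' Y).indicator (fun _ => (1 : ℝ)) u ∂μ := by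
    rw [integral_finsetSum _ fun s _ => hint s]
    simp only [hreal]
    rw [Finset.sum_const, Finset.card_univ, Fintype.card_finset, nsmul_eq_mul]
    push_cast
    ring
  have h2 : ∫ u, ∑ s : Finset ι, (flipCoords σ s ⁻¹' Y).indicator (fun _ => (1 : ℝ)) u ∂μ ≤
      ∫ _u, B * 2 ^ Fintype.card ι ∂μ := by
    refine integral_mono (integrable_finsetSum _ fun s _ => hint s) (integrable_const _)
      fun u => ?_
    have := h u (Finset.univ.filter fun s => flipCoords σ s u ∈ Y) (by simp)
    refine le_trans (le_of_eq ?_) this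
    rw [Finset.card_filter]
    push_cast
    refine Finset.sum_congr rfl fun s _ => ?_
    simp [Set.indicator_apply]
  rw [integral_const, probReal_univ, one_smul, ← h1] at h2
  have : (0 : ℝ) < 2 ^ Fintype.card ι := by positivity
  nlinarith

/-- Exchange the intervals `(r, r + τ]` and `(y, y + τ]` by translation. -/
noncomputable def swapIoc (r y τ : ℝ) (u : ℝ) : ℝ :=
  open Classical in
  if u ∈ Set.Ioc r (r + τ) then u + (y - r)
  else if u ∈ Set.Ioc y (y + τ) then u - (y - r) else u

theorem measurable_swapIoc (r y τ : ℝ) : Measurable (swapIoc r y τ) := by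
  unfold swapIoc
  exact Measurable.ite measurableSet_Ioc (measurable_id.add_const _)
    (Measurable.ite measurableSet_Ioc (measurable_id.sub_const _) measurable_id)

/-- Split a set along the two intervals and their complement. The first two pieces are exchanged by
translations and the third is fixed. -/
theorem measurePreserving_swapIoc {r y τ : ℝ} (h : r + τ ≤ y) :
    MeasurePreserving (swapIoc r y τ) volume volume := by
  refine ⟨measurable_swapIoc r y τ, Measure.ext fun s hs => ?_⟩
  rw [Measure.map_apply (measurable_swapIoc r y τ) hs]
  set R := Set.Ioc r (r + τ) with hR
  set C := Set.Ioc y (y + τ) with hC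
  have hRC : ∀ u, u ∈ C → u ∉ R := by
    intro u hu hu'
    rw [hC, Set.mem_Ioc] at hu
    rw [hR, Set.mem_Ioc] at hu'
    linarith
  have split : ∀ t : Set ℝ, MeasurableSet t →
      volume t = volume (t ∩ R) + (volume (t \ R ∩ C) + volume ((t \ R) \ C)) := fun t _ => by
    rw [measure_inter_add_sdiff _ measurableSet_Ioc, measure_inter_add_sdiff _ measurableSet_Ioc]
  have hms := measurable_swapIoc r y τ hs
  rw [split _ hms, split s hs]
  have e1 : (swapIoc r y τ ⁻¹' s) ∩ R = (fun u => u + (y - r)) ⁻¹' (s \ R ∩ C) := by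
    ext u
    simp only [Set.mem_inter_iff, Set.mem_preimage, Set.mem_sdiff]
    constructor
    · rintro ⟨hu, hu'⟩
      have hc : u + (y - r) ∈ C := by
        rw [hR, Set.mem_Ioc] at hu'; rw [hC, Set.mem_Ioc]; constructor <;> linarith
      rw [swapIoc, if_pos hu'] at hu
      exact ⟨⟨hu, hRC _ hc⟩, hc⟩
    · rintro ⟨⟨hu, -⟩, hc⟩
      have hu' : u ∈ R := by
        rw [hC, Set.mem_Ioc] at hc; rw [hR, Set.mem_Ioc]; constructor <;> linarith
      rw [swapIoc, if_pos hu']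
      exact ⟨hu, hu'⟩
  have e2 : (swapIoc r y τ ⁻¹' s) \ R ∩ C = (fun u => u + -(y - r)) ⁻¹' (s ∩ R) := by
    ext u
    simp only [Set.mem_inter_iff, Set.mem_preimage, Set.mem_sdiff]
    constructor
    · rintro ⟨⟨hu, hu'⟩, hc⟩
      rw [swapIoc, if_neg hu', if_pos hc] at hu
      refine ⟨hu, ?_⟩
      rw [hC, Set.mem_Ioc] at hc; rw [hR, Set.mem_Ioc]; constructor <;> linarith
    · rintro ⟨hu, hc⟩
      have hu' : u ∈ C := by
        rw [hR, Set.mem_Ioc] at hc; rw [hC, Set.mem_Ioc]; constructor <;> linarith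
      rw [swapIoc, if_neg (hRC u hu'), if_pos hu']
      exact ⟨⟨hu, hRC u hu'⟩, hu'⟩
  have e3 : ((swapIoc r y τ ⁻¹' s) \ R) \ C = (s \ R) \ C := by
    ext u
    simp only [Set.mem_preimage, Set.mem_sdiff]
    constructor
    · rintro ⟨⟨hu, hu'⟩, hc⟩
      rw [swapIoc, if_neg hu', if_neg hc] at hu
      exact ⟨⟨hu, hu'⟩, hc⟩
    · rintro ⟨⟨hu, hu'⟩, hc⟩
      rw [swapIoc, if_neg hu', if_neg hc]
      exact ⟨⟨hu, hu'⟩, hc⟩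
  rw [e1, e2, e3, measure_preimage_add_right, measure_preimage_add_right]
  ring

theorem measurePreserving_swapIoc_unit {r y τ : ℝ} (h : r + τ ≤ y) (hr : 0 ≤ r)
    (hy : y + τ < 1) : MeasurePreserving (swapIoc r y τ)
      (volume.restrict (Set.Ioo 0 1)) (volume.restrict (Set.Ioo 0 1)) := by
  have hpre : swapIoc r y τ ⁻¹' Set.Ioo 0 1 = Set.Ioo 0 1 := by
    ext u
    simp only [Set.mem_preimage, Set.mem_Ioo, swapIoc, Set.mem_Ioc]
    split_ifs with h1 h2
    · constructor <;> rintro ⟨_, _⟩ <;> constructor <;> linarith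
    · constructor <;> rintro ⟨_, _⟩ <;> constructor <;> linarith
    · rfl
  have := (measurePreserving_swapIoc h).restrict_preimage (s := Set.Ioo 0 1) measurableSet_Ioo
  rwa [hpre] at this

/-! ### Counts before and after an exchange -/

/-- The number of coordinates of `u` that are at most `y`. -/
noncomputable def countLE {ι : Type*} [Fintype ι] (u : ι → ℝ) (y : ℝ) : ℕ :=
  (Finset.univ.filter fun i => u i ≤ y).card

theorem countLE_mono {ι : Type*} [Fintype ι] (u : ι → ℝ) {y z : ℝ} (h : y ≤ z) :
    countLE u y ≤ countLE u z :=
  Finset.card_le_card fun i hi => by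
    simp only [Finset.mem_filter, Finset.mem_univ, true_and] at hi ⊢
    exact hi.trans h

/-- The coordinates of `u` in the interval `(r, r + τ]`. -/
noncomputable def inIoc {ι : Type*} [Fintype ι] (u : ι → ℝ) (r τ : ℝ) : Finset ι :=
  Finset.univ.filter fun i => u i ∈ Set.Ioc r (r + τ)

theorem mem_inIoc {ι : Type*} [Fintype ι] {u : ι → ℝ} {r τ : ℝ} {i : ι} :
    i ∈ inIoc u r τ ↔ u i ∈ Set.Ioc r (r + τ) := by
  simp [inIoc]

theorem card_inIoc_add_countLE {ι : Type*} [Fintype ι] (u : ι → ℝ) {r τ : ℝ} (hτ : 0 ≤ τ) :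
    (inIoc u r τ).card + countLE u r = countLE u (r + τ) := by
  classical
  unfold inIoc countLE
  rw [← Finset.card_union_of_disjoint]
  · congr 1
    ext i
    simp only [Finset.mem_union, Finset.mem_filter, Finset.mem_univ, true_and, Set.mem_Ioc]
    constructor
    · rintro (⟨-, h⟩ | h) <;> linarith
    · intro h
      rcases le_or_gt (u i) r with h' | h'
      · exact Or.inr h'
      · exact Or.inl ⟨h', h⟩
  · refine Finset.disjoint_left.2 fun i hi hi' => ?_
    simp only [Finset.mem_filter, Finset.mem_univ, true_and, Set.mem_Ioc] at hi hi'
    linarith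

theorem disjoint_inIoc {ι : Type*} [Fintype ι] (u : ι → ℝ) {r y τ : ℝ} (h : r + τ ≤ y) :
    Disjoint (inIoc u r τ) (inIoc u y τ) :=
  Finset.disjoint_left.2 fun i hi hi' => by
    rw [mem_inIoc, Set.mem_Ioc] at hi hi'
    linarith

theorem flipCoords_swapIoc_le_iff_of_le {ι : Type*} [DecidableEq ι] {r y τ z : ℝ}
    (hz : y + τ ≤ z) (h : r + τ ≤ y) (u : ι → ℝ) (s : Finset ι) (i : ι) :
    flipCoords (swapIoc r y τ) s u i ≤ z ↔ u i ≤ z := by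
  unfold flipCoords swapIoc
  simp only [Set.mem_Ioc]
  split_ifs with h1 h2 h3
  · constructor <;> intro <;> linarith
  · constructor <;> intro <;> linarith
  · rfl
  · rfl

theorem countLE_flipCoords_of_le {ι : Type*} [Fintype ι] [DecidableEq ι] {r y τ z : ℝ}
    (hz : y + τ ≤ z) (h : r + τ ≤ y) (u : ι → ℝ) (s : Finset ι) :
    countLE (flipCoords (swapIoc r y τ) s u) z = countLE u z := by
  unfold countLE
  simp only [flipCoords_swapIoc_le_iff_of_le hz h]

theorem flipCoords_swapIoc_le_iff_of_mem_Icc {ι : Type*} [DecidableEq ι] {r y τ z : ℝ}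
    (hz1 : r + τ ≤ z) (hz2 : z ≤ y) (u : ι → ℝ) (s : Finset ι) (i : ι) :
    flipCoords (swapIoc r y τ) s u i ≤ z ↔ (u i ≤ z ∧ u i ∉ Set.Ioc r (r + τ)) ∨
      ((u i ∈ Set.Ioc r (r + τ) ∧ i ∉ s) ∨ (u i ∈ Set.Ioc y (y + τ) ∧ i ∈ s)) := by
  have hR : u i ∈ Set.Ioc r (r + τ) → u i ≤ z := fun h => h.2.trans hz1
  have hC : u i ∈ Set.Ioc y (y + τ) → ¬ u i ≤ z := fun h => not_le.2 (hz2.trans_lt h.1)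
  have hR' : u i ∈ Set.Ioc r (r + τ) → ¬ u i + (y - r) ≤ z := fun h => by
    rw [Set.mem_Ioc] at h; linarith
  have hC' : u i ∈ Set.Ioc y (y + τ) → u i - (y - r) ≤ z := fun h => by
    rw [Set.mem_Ioc] at h; linarith
  unfold flipCoords swapIoc
  by_cases hs : i ∈ s <;> by_cases h1 : u i ∈ Set.Ioc r (r + τ) <;>
    by_cases h2 : u i ∈ Set.Ioc y (y + τ) <;> rw [← not_iff_not] <;> simp only [hs, h1, h2, if_true, if_false] <;> tauto

/-- For `z` between the two intervals only the last bracket depends on `s`, and it does not depend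
on `z`: the exchange shifts all these counts by the same amount. -/
theorem countLE_flipCoords_of_mem_Icc {ι : Type*} [Fintype ι] [DecidableEq ι] {r y τ z : ℝ}
    (hz1 : r + τ ≤ z) (hz2 : z ≤ y) (u : ι → ℝ) (s : Finset ι) :
    countLE (flipCoords (swapIoc r y τ) s u) z =
      (Finset.univ.filter fun i => u i ≤ z ∧ u i ∉ Set.Ioc r (r + τ)).card +
        ((inIoc u r τ \ s).card + (inIoc u y τ ∩ s).card) := by
  have hd1 : Disjoint (inIoc u r τ \ s) (inIoc u y τ ∩ s) :=
    (disjoint_inIoc u (hz1.trans hz2)).mono Finset.sdiff_subset Finset.inter_subset_left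
  have hd2 : Disjoint (Finset.univ.filter fun i => u i ≤ z ∧ u i ∉ Set.Ioc r (r + τ))
      (inIoc u r τ \ s ∪ inIoc u y τ ∩ s) := by
    refine Finset.disjoint_left.2 fun i hi hi' => ?_
    simp only [Finset.mem_filter, Finset.mem_univ, true_and, Finset.mem_union, Finset.mem_sdiff,
      Finset.mem_inter, mem_inIoc, Set.mem_Ioc] at hi hi'
    rcases hi' with ⟨h, -⟩ | ⟨h, -⟩
    · exact hi.2 h
    · linarith
  rw [← Finset.card_union_of_disjoint hd1, ← Finset.card_union_of_disjoint hd2]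
  unfold countLE
  congr 1
  ext i
  simp only [Finset.mem_filter, Finset.mem_univ, true_and, Finset.mem_union, Finset.mem_sdiff,
      Finset.mem_inter, mem_inIoc, flipCoords_swapIoc_le_iff_of_mem_Icc hz1 hz2]

theorem card_inIoc_flipCoords {ι : Type*} [Fintype ι] [DecidableEq ι] {r y τ : ℝ}
    (h : r + τ ≤ y) (u : ι → ℝ) (s : Finset ι) :
    (inIoc (flipCoords (swapIoc r y τ) s u) r τ).card +
      (inIoc (flipCoords (swapIoc r y τ) s u) y τ).card =
      (inIoc u r τ).card + (inIoc u y τ).card := by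
  rw [← Finset.card_union_of_disjoint (disjoint_inIoc _ h),
    ← Finset.card_union_of_disjoint (disjoint_inIoc _ h)]
  congr 1
  ext i
  simp only [Finset.mem_union, mem_inIoc, flipCoords]
  split_ifs with hs
  · unfold swapIoc
    simp only [Set.mem_Ioc]
    split_ifs with h1 h2
    · constructor <;> intro _
      · exact Or.inl h1
      · right; constructor <;> linarith
    · constructor <;> intro _
      · exact Or.inr h2
      · left; constructor <;> linarith
    · rfl
  · rfl

/-! ### The reservoir argument for crossing probabilities -/

/-- `P` is optimal, up to `m` extra samples, for the revenue `p * K (S p)` among prices `p` with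
`κ < K (S p)`. -/
structure IsCandidate (κ m : ℝ) (S K : ℝ → ℝ) (P : ℝ) : Prop where
  nonneg : 0 ≤ P
  guard : κ < K (S P) + m
  optimal : ∀ p, 0 ≤ p → κ < K (S p) → p * K (S p) ≤ P * (K (S P) + m)

/-- Passing from `s` to `s'` changes the count at `S P₁` by the difference `a' - a` and leaves the
count at `S P₂'` unchanged. Near-optimality of `P₁` for `s` and of `P₂'` for `s'` together give `P₁
(a' - a) ≤ (P₁ + P₂') m`. Since `P₂' < P₁`, an increase of more than `2 m` is impossible. -/
theorem reservoir_count_le {ι : Type*} [Fintype ι] [DecidableEq ι] {r y τ κ : ℝ} {m : ℕ}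
    {S : ℝ → ℝ} (hS : Antitone S) (hτ : 0 < τ) {u : ι → ℝ} {s s' : Finset ι}
    {P₁ P₂' : ℝ}
    (h₁ : IsCandidate κ m S (fun z => countLE (flipCoords (swapIoc r y τ) s u) z) P₁)
    (h₂' : IsCandidate κ m S (fun z => countLE (flipCoords (swapIoc r y τ) s' u) z) P₂')
    (hκ₁ : κ < countLE (flipCoords (swapIoc r y τ) s u) (S P₁))
    (hκ₂' : κ < countLE (flipCoords (swapIoc r y τ) s' u) (S P₂'))
    (hP₁ : r + τ ≤ S P₁) (hP₁' : S P₁ ≤ y) (hP₂' : y + τ ≤ S P₂') :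
    (inIoc u r τ \ s').card + (inIoc u y τ ∩ s').card ≤
      (inIoc u r τ \ s).card + (inIoc u y τ ∩ s).card + 2 * m := by
  set a := (inIoc u r τ \ s).card + (inIoc u y τ ∩ s).card with ha
  set a' := (inIoc u r τ \ s').card + (inIoc u y τ ∩ s').card with ha'
  by_contra hlt
  push Not at hlt
  have hry : r + τ ≤ y := hP₁.trans hP₁'
  have hPP : P₂' < P₁ := by
    by_contra hle
    have := hS (not_lt.1 hle)
    linarith
  have e1 := countLE_flipCoords_of_mem_Icc hP₁ hP₁' u s
  have e1' := countLE_flipCoords_of_mem_Icc hP₁ hP₁' u s'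
  rw [← ha] at e1
  rw [← ha'] at e1'
  have e2 := countLE_flipCoords_of_le hP₂' hry u s
  have e2' := countLE_flipCoords_of_le hP₂' hry u s'
  have hlt' : (a : ℝ) + 2 * m < a' := by exact_mod_cast hlt
  have e1r : (countLE (flipCoords (swapIoc r y τ) s' u) (S P₁) : ℝ) =
      countLE (flipCoords (swapIoc r y τ) s u) (S P₁) + (a' - a) := by
    rw [e1, e1']; push_cast; ring
  have e2r : (countLE (flipCoords (swapIoc r y τ) s' u) (S P₂') : ℝ) =
      countLE (flipCoords (swapIoc r y τ) s u) (S P₂') := by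
    rw [e2, e2']
  have hm : (0 : ℝ) ≤ m := by positivity
  have o1 := h₁.optimal P₂' h₂'.nonneg (by rw [← e2r]; exact hκ₂')
  have o2 := h₂'.optimal P₁ h₁.nonneg (by rw [e1r]; linarith)
  rw [e1r, e2r] at o2
  have hpos : 0 < P₁ := lt_of_le_of_lt h₂'.nonneg hPP
  nlinarith

/-- The price can jump across the quantiles `(y, y + τ]` only with small probability. -/
theorem measure_crossing_le {ι : Type*} [Fintype ι] {r y τ κ M : ℝ} {m : ℕ}
    {S : ℝ → ℝ} (hS : Antitone S) (hτ : 0 < τ) (hr : 0 ≤ r) (hry : r + τ ≤ y) (hy : y + τ < 1)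
    (hM : 0 < M) {Y : Set (ι → ℝ)} (hY : MeasurableSet Y)
    (hcount : ∀ u ∈ Y, M ≤ ((inIoc u r τ).card + (inIoc u y τ).card : ℕ))
    (h₁ : ∀ u ∈ Y, ∃ P, IsCandidate κ m S (fun z => countLE u z) P ∧ κ < countLE u (S P) ∧
      r + τ ≤ S P ∧ S P ≤ y)
    (h₂ : ∀ u ∈ Y, ∃ P, IsCandidate κ m S (fun z => countLE u z) P ∧ κ < countLE u (S P) ∧
      y + τ ≤ S P) :
    (Measure.pi fun _ : ι => volume.restrict (Set.Ioo (0 : ℝ) 1)).real Y ≤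
      (2 * m + 1) / √M := by
  classical
  have : IsProbabilityMeasure (volume.restrict (Set.Ioo (0 : ℝ) 1)) := ⟨by simp⟩
  refine measure_le_of_card_flip_le (measurePreserving_swapIoc_unit hry hr hy) hY
    fun u 𝒮 h𝒮 => ?_
  rcases 𝒮.eq_empty_or_nonempty with rfl | ⟨s₀, hs₀⟩
  · simp only [Finset.card_empty, Nat.cast_zero]; positivity
  have hMu := hcount _ (h𝒮 s₀ hs₀)
  rw [card_inIoc_flipCoords hry] at hMu
  have hle := card_mul_sqrt_le_of_flip_close (disjoint_inIoc u hry) 𝒮 (2 * m) fun s hs s' hs' => by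
    obtain ⟨P₁, c1, k1, l1, l1'⟩ := h₁ _ (h𝒮 s hs)
    obtain ⟨P₂, c2, k2, l2⟩ := h₂ _ (h𝒮 s' hs')
    exact reservoir_count_le hS hτ c1 c2 k1 k2 l1 l1' l2
  have hsq : √M ≤ √(((inIoc u r τ).card + (inIoc u y τ).card : ℕ) : ℝ) := Real.sqrt_le_sqrt hMu
  have hMpos : 0 < √M := Real.sqrt_pos.2 hM
  rw [div_mul_eq_mul_div, le_div_iff₀ hMpos]
  push_cast at hle
  refine le_trans (mul_le_mul_of_nonneg_left hsq (by positivity)) ?_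
  push_cast
  exact hle

/-! ### Uniform concentration of the counts -/

/-- The uniform distribution on `(0, 1)`. -/
noncomputable abbrev unitMeasure : Measure ℝ := volume.restrict (Set.Ioo (0 : ℝ) 1)

instance : IsProbabilityMeasure unitMeasure := ⟨by simp⟩

theorem unitMeasure_real_Iic {y : ℝ} (h0 : 0 ≤ y) (h1 : y ≤ 1) :
    unitMeasure.real (Set.Iic y) = y := by
  rw [measureReal_restrict_apply measurableSet_Iic, measureReal_def]
  rcases h1.eq_or_lt with rfl | h1
  · rw [Set.inter_eq_right.2 fun x hx => hx.2.le, Real.volume_Ioo]; simp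
  · have : Set.Iic y ∩ Set.Ioo 0 1 = Set.Ioc 0 y := by
      ext x
      simp only [Set.mem_inter_iff, Set.mem_Iic, Set.mem_Ioo, Set.mem_Ioc]
      constructor
      · rintro ⟨h, h', -⟩; exact ⟨h', h⟩
      · rintro ⟨h, h'⟩; exact ⟨h', h, h'.trans_lt h1⟩
    rw [this, Real.volume_Ioc, sub_zero, ENNReal.toReal_ofReal h0]

theorem countLE_eq_sum {ι : Type*} [Fintype ι] (u : ι → ℝ) (y : ℝ) :
    (countLE u y : ℝ) = ∑ i, (Set.Iic y).indicator (fun _ => (1 : ℝ)) (u i) := by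
  unfold countLE
  rw [Finset.card_filter]
  push_cast
  refine Finset.sum_congr rfl fun i _ => ?_
  simp [Set.indicator_apply]

theorem measurable_countLE {ι : Type*} [Fintype ι] (y : ℝ) :
    Measurable fun u : ι → ℝ => (countLE u y : ℝ) := by
  simp only [countLE_eq_sum]
  exact Finset.measurable_sum _ fun i _ =>
    (measurable_const.indicator measurableSet_Iic).comp (measurable_pi_apply i)

/-- Hoeffding's inequality for the sum of centred indicators, applied to it and to its negative. -/
theorem measure_countLE_deviation_le {ι : Type*} [Fintype ι] {y : ℝ} (h0 : 0 ≤ y) (h1 : y ≤ 1)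
    {t : ℝ} (ht : 0 ≤ t) :
    (Measure.pi fun _ : ι => unitMeasure).real
      {u | t ≤ |(countLE u y : ℝ) - Fintype.card ι * y|} ≤
      2 * Real.exp (-(2 * t ^ 2 / Fintype.card ι)) := by
  set μ := Measure.pi fun _ : ι => unitMeasure with hμ
  set g : ℝ → ℝ := (Set.Iic y).indicator (fun _ => (1 : ℝ)) with hg
  have hgm : Measurable g := measurable_const.indicator measurableSet_Iic
  have hgint : ∫ x, g x ∂unitMeasure = y := by
    rw [hg, integral_indicator_const _ measurableSet_Iic, unitMeasure_real_Iic h0 h1]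
    simp
  have hind : iIndepFun (fun (i : ι) (u : ι → ℝ) => g (u i) - y) μ :=
    iIndepFun_pi (X := fun (_ : ι) x => g x - y) fun i => (hgm.sub_const y).aemeasurable
  have hcomp : ∀ i : ι, ∫ u, g (u i) ∂μ = y := by
    intro i
    rw [← hgint]
    have h := integral_map (μ := μ) (φ := fun u : ι → ℝ => u i)
      (measurable_pi_apply i).aemeasurable (f := g) hgm.aestronglyMeasurable
    rw [← h, (measurePreserving_eval (fun _ : ι => unitMeasure) i).map_eq]
  have hsub : ∀ i : ι, HasSubgaussianMGF (fun u : ι → ℝ => g (u i) - y)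
      ((‖(1 : ℝ) - 0‖₊ / 2) ^ 2) μ := by
    intro i
    have := hasSubgaussianMGF_of_mem_Icc (μ := μ) (X := fun u : ι → ℝ => g (u i)) (a := 0) (b := 1)
      (hgm.comp (measurable_pi_apply i)).aemeasurable
      (Eventually.of_forall fun u => by
        by_cases h : u i ≤ y <;> simp [hg, h])
    rwa [hcomp i] at this
  have hsum : ∀ u : ι → ℝ, ∑ i, (g (u i) - y) = (countLE u y : ℝ) - Fintype.card ι * y := by
    intro u
    rw [Finset.sum_sub_distrib, ← countLE_eq_sum]
    simp
  have hexp : ∀ x : ℝ, Real.exp (-x ^ 2 / (2 * ((∑ _i : ι, (‖(1 : ℝ) - 0‖₊ / 2) ^ 2 : ℝ≥0) : ℝ))) =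
      Real.exp (-(2 * x ^ 2 / Fintype.card ι)) := by
    intro x
    congr 1
    simp
    -- For an empty index type both exponents are quotients by `0`, hence equal to `0`.
    rcases eq_or_ne (Fintype.card ι : ℝ) 0 with h | h
    · simp [h]
    · field_simp
  have hA := HasSubgaussianMGF.measure_sum_ge_le_of_iIndepFun hind (s := Finset.univ) (fun i _ => hsub i) ht
  have hB := HasSubgaussianMGF.measure_sum_ge_le_of_iIndepFun (hind.comp (fun _ x => -x) fun _ => measurable_neg)
    (s := Finset.univ) (fun i _ => (hsub i).neg) ht
  push_cast at hexp
  have hsubset : {u : ι → ℝ | t ≤ |(countLE u y : ℝ) - Fintype.card ι * y|} ⊆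
      {u | t ≤ ∑ i, (g (u i) - y)} ∪
        {u | t ≤ ∑ i, ((fun x => -x) ∘ fun u : ι → ℝ => g (u i) - y) u} := by
    intro u hu
    simp only [Set.mem_ofPred_eq, le_abs, Set.mem_union, Function.comp] at hu ⊢
    rw [Finset.sum_neg_distrib, hsum]
    exact hu
  refine (measureReal_mono hsubset).trans ((measureReal_union_le _ _).trans ?_)
  rw [two_mul, ← hexp]
  push_cast at hA hB
  exact add_le_add hA hB

/-- The empirical distribution function of uniform samples is `t`-close to its mean on the grid
`{i / N}`. -/
def gridClose {ι : Type*} [Fintype ι] (N : ℕ) (t : ℝ) : Set (ι → ℝ) :=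
  {u | ∀ i ∈ Finset.range (N + 1), |(countLE u ((i : ℝ) / N) : ℝ) -
    Fintype.card ι * ((i : ℝ) / N)| < t}

theorem measurableSet_gridClose {ι : Type*} [Fintype ι] (N : ℕ) (t : ℝ) :
    MeasurableSet (gridClose N t : Set (ι → ℝ)) := by
  have : (gridClose N t : Set (ι → ℝ)) = ⋂ i ∈ Finset.range (N + 1),
      {u | |(countLE u ((i : ℝ) / N) : ℝ) - Fintype.card ι * ((i : ℝ) / N)| < t} := by
    ext u; simp [gridClose]
  rw [this]
  refine Finset.measurableSet_biInter _ fun i _ => ?_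
  exact measurableSet_lt ((measurable_countLE _).sub_const _).norm measurable_const

theorem measure_compl_gridClose_le {ι : Type*} [Fintype ι] {N : ℕ} {t : ℝ}
    (ht : 0 ≤ t) : (Measure.pi fun _ : ι => unitMeasure).real (gridClose N t)ᶜ ≤
      (N + 1) * (2 * Real.exp (-(2 * t ^ 2 / Fintype.card ι))) := by
  have hsub : ((gridClose N t)ᶜ : Set (ι → ℝ)) ⊆ ⋃ i ∈ Finset.range (N + 1),
      {u | t ≤ |(countLE u ((i : ℝ) / N) : ℝ) - Fintype.card ι * ((i : ℝ) / N)|} := by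
    intro u hu
    simp only [gridClose, Set.mem_compl_iff, Set.mem_ofPred_eq] at hu
    push Not at hu
    simpa using hu
  refine (measureReal_mono hsub (measure_ne_top _ _)).trans ((measureReal_biUnion_finset_le _ _).trans ?_)
  calc _ ≤ ∑ _i ∈ Finset.range (N + 1), 2 * Real.exp (-(2 * t ^ 2 / Fintype.card ι)) := by
        refine Finset.sum_le_sum fun i hi => measure_countLE_deviation_le (by positivity) ?_ ht
        rw [Finset.mem_range] at hi
        have : (i : ℝ) ≤ N := by exact_mod_cast Nat.lt_succ_iff.1 hi
        exact div_le_one_of_le₀ this (by positivity)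
    _ = _ := by rw [Finset.sum_const, Finset.card_range, nsmul_eq_mul]; push_cast; ring

/-- By monotonicity the count at `y` lies between those at the neighbouring grid points, and moving
by `1 / N` changes the mean by at most `1`. -/
theorem abs_countLE_sub_le_of_gridClose {ι : Type*} [Fintype ι] {N : ℕ} (hN : 0 < N)
    (hι : Fintype.card ι ≤ N) {t : ℝ} {u : ι → ℝ} (hu : u ∈ (gridClose N t : Set (ι → ℝ)))
    {y : ℝ} (h0 : 0 ≤ y) (h1 : y ≤ 1) :
    |(countLE u y : ℝ) - Fintype.card ι * y| ≤ t + 1 := by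
  have hNr : (0 : ℝ) < N := by exact_mod_cast hN
  have hn : (Fintype.card ι : ℝ) ≤ N := by exact_mod_cast hι
  have hn0 : (0 : ℝ) ≤ Fintype.card ι := by positivity
  have key : ∀ z, |z - y| ≤ 1 / N → |Fintype.card ι * z - Fintype.card ι * y| ≤ 1 := by
    intro z hz
    rw [← mul_sub, abs_mul, abs_of_nonneg hn0]
    calc _ ≤ N * (1 / (N : ℝ)) := by gcongr
      _ = 1 := by field_simp
  have hNy : N * y ≤ N := by nlinarith
  have hNy0 : 0 ≤ N * y := by positivity
  have hup := hu ⌈(N : ℝ) * y⌉₊ (by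
    rw [Finset.mem_range, Nat.lt_succ_iff]; exact Nat.ceil_le.2 hNy)
  have hlo := hu ⌊(N : ℝ) * y⌋₊ (by
    rw [Finset.mem_range, Nat.lt_succ_iff]; exact Nat.floor_le_of_le hNy)
  have hu1 : y ≤ (⌈(N : ℝ) * y⌉₊ : ℝ) / N := by
    rw [le_div_iff₀ hNr, mul_comm]; exact Nat.le_ceil _
  have hu2 : (⌈(N : ℝ) * y⌉₊ : ℝ) / N ≤ y + 1 / N := by
    rw [div_le_iff₀ hNr, add_mul, one_div_mul_cancel hNr.ne', mul_comm y]
    exact (Nat.ceil_lt_add_one hNy0).le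
  have hl1 : (⌊(N : ℝ) * y⌋₊ : ℝ) / N ≤ y := by
    rw [div_le_iff₀ hNr, mul_comm y]; exact Nat.floor_le hNy0
  have hl2 : y ≤ (⌊(N : ℝ) * y⌋₊ : ℝ) / N + 1 / N := by
    rw [← add_div, le_div_iff₀ hNr, mul_comm y]
    exact (Nat.lt_floor_add_one _).le
  have ku := key _ (abs_le.2 ⟨by linarith [show 0 ≤ 1 / (N : ℝ) by positivity], by linarith⟩ :
    |(⌈(N : ℝ) * y⌉₊ : ℝ) / N - y| ≤ 1 / N)
  have kl := key _ (abs_le.2 ⟨by linarith, by linarith [show 0 ≤ 1 / (N : ℝ) by positivity]⟩ :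
    |(⌊(N : ℝ) * y⌋₊ : ℝ) / N - y| ≤ 1 / N)
  have mu : (countLE u y : ℝ) ≤ countLE u ((⌈(N : ℝ) * y⌉₊ : ℝ) / N) := by
    exact_mod_cast countLE_mono u hu1
  have ml : (countLE u ((⌊(N : ℝ) * y⌋₊ : ℝ) / N) : ℝ) ≤ countLE u y := by
    exact_mod_cast countLE_mono u hl1
  rw [abs_lt] at hup hlo
  rw [abs_le] at ku kl ⊢
  constructor <;> linarith

/-! ### Survival function and quantile coupling -/

/-- The survival function `p ↦ μ [p, ∞)`. -/
noncomputable def survival (μ : Measure ℝ) (p : ℝ) : ℝ := μ.real (Set.Ici p)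

theorem survival_nonneg (μ : Measure ℝ) (p : ℝ) : 0 ≤ survival μ p := measureReal_nonneg

section survival

variable (μ : Measure ℝ) [IsProbabilityMeasure μ]

theorem survival_antitone : Antitone (survival μ) := fun _ _ h =>
  measureReal_mono (Set.Ici_subset_Ici.2 h)

theorem survival_le_one (p : ℝ) : survival μ p ≤ 1 := measureReal_le_one

variable [NullSingletonClass μ]

theorem survival_eq_one_sub_cdf (p : ℝ) : survival μ p = 1 - cdf μ p := by
  have h := probReal_compl_eq_one_sub (μ := μ) (s := Set.Iic p) measurableSet_Iic
  rw [cdf_eq_real, ← h, Set.compl_Iic, survival]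
  exact measureReal_congr Ioi_ae_eq_Ici.symm

theorem continuous_survival : Continuous (survival μ) := by
  have h : survival μ = fun p => 1 - cdf μ p := funext (survival_eq_one_sub_cdf μ)
  rw [h]
  refine continuous_const.sub (continuous_iff_continuousAt.2 fun p => ?_)
  have h1 := (cdf μ).measure_singleton p
  rw [measure_cdf, measure_singleton] at h1
  have h2 : cdf μ p ≤ Function.leftLim (cdf μ) p := by
    have := ENNReal.ofReal_eq_zero.1 h1.symm
    linarith
  have h3 := (cdf μ).mono.leftLim_le (le_refl p)
  refine (cdf μ).mono.continuousAt_iff_leftLim_eq_rightLim.2 ?_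
  rw [StieltjesFunction.rightLim_eq]
  exact le_antisymm h3 h2

theorem exists_survival_eq {u : ℝ} (h0 : 0 < u) (h1 : u < 1) : ∃ p, survival μ p = u := by
  have hb : Tendsto (survival μ) atBot (𝓝 (1 - 0)) := by
    rw [show survival μ = fun p => 1 - cdf μ p from funext (survival_eq_one_sub_cdf μ)]
    exact tendsto_const_nhds.sub (tendsto_cdf_atBot μ)
  have ht : Tendsto (survival μ) atTop (𝓝 (1 - 1)) := by
    rw [show survival μ = fun p => 1 - cdf μ p from funext (survival_eq_one_sub_cdf μ)]
    exact tendsto_const_nhds.sub (tendsto_cdf_atTop μ)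
  obtain ⟨a, ha⟩ := (hb.eventually (lt_mem_nhds (show u < 1 - 0 by linarith))).exists
  obtain ⟨b, hb'⟩ := (ht.eventually (gt_mem_nhds (show 1 - 1 < u by linarith))).exists
  have := mem_range_of_exists_le_of_exists_ge (continuous_survival μ) ⟨b, hb'.le⟩ ⟨a, ha.le⟩
  exact this

/-- The value at upper quantile `u`. -/
noncomputable def upperQuantile (u : ℝ) : ℝ :=
  open Classical in if u ∈ Set.Ioo (0 : ℝ) 1 then sSup {p | u ≤ survival μ p} else 0

/-- Continuity of the survival function, which comes from the absence of atoms, puts the supremum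
into the defining set. The resulting equivalence turns counts of values into counts of quantiles. -/
theorem le_upperQuantile_iff {u : ℝ} (hu : u ∈ Set.Ioo (0 : ℝ) 1) (p : ℝ) :
    p ≤ upperQuantile μ u ↔ u ≤ survival μ p := by
  rw [upperQuantile, if_pos hu]
  obtain ⟨a, ha⟩ := exists_survival_eq μ hu.1 hu.2
  obtain ⟨b, hb⟩ := exists_survival_eq μ (u := u / 2) (by linarith [hu.1])
    (by linarith [hu.1, hu.2])
  have hne : {p | u ≤ survival μ p}.Nonempty := ⟨a, ha.ge⟩
  have hbd : BddAbove {p | u ≤ survival μ p} := by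
    refine ⟨b, fun p hp => ?_⟩
    by_contra hlt
    have h1 := survival_antitone μ (not_le.1 hlt).le
    have h2 : u ≤ survival μ p := hp
    linarith [hu.1]
  have hmem : sSup {p | u ≤ survival μ p} ∈ {p | u ≤ survival μ p} :=
    (isClosed_le continuous_const (continuous_survival μ)).csSup_mem hne hbd
  exact ⟨fun h => le_trans hmem (survival_antitone μ h), fun h => le_csSup hbd h⟩

theorem survival_upperQuantile {u : ℝ} (hu : u ∈ Set.Ioo (0 : ℝ) 1) :
    survival μ (upperQuantile μ u) = u := by
  refine le_antisymm ?_ ((le_upperQuantile_iff μ hu _).1 le_rfl)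
  obtain ⟨a, ha⟩ := exists_survival_eq μ hu.1 hu.2
  exact (survival_antitone μ ((le_upperQuantile_iff μ hu a).2 ha.ge)).trans ha.le

theorem upperQuantile_preimage_Ici (p : ℝ) : upperQuantile μ ⁻¹' Set.Ici p =
    Set.Ioo 0 1 ∩ Set.Iic (survival μ p) ∪ (Set.Ioo (0 : ℝ) 1)ᶜ ∩ {_u | p ≤ 0} := by
  ext u
  simp only [Set.mem_preimage, Set.mem_Ici, Set.mem_union, Set.mem_inter_iff, Set.mem_compl_iff,
    Set.mem_Iic, Set.mem_ofPred_eq]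
  by_cases hu : u ∈ Set.Ioo (0 : ℝ) 1
  · simp [hu, le_upperQuantile_iff μ hu]
  · simp only [hu, false_and, not_false_iff, true_and, false_or]
    rw [upperQuantile, if_neg hu]

theorem measurable_upperQuantile : Measurable (upperQuantile μ) := by
  refine measurable_of_Ici fun p => ?_
  rw [upperQuantile_preimage_Ici]
  exact (measurableSet_Ioo.inter measurableSet_Iic).union
    (measurableSet_Ioo.compl.inter (MeasurableSet.const _))

theorem measurePreserving_upperQuantile :
    MeasurePreserving (upperQuantile μ) unitMeasure μ := by
  refine ⟨measurable_upperQuantile μ, ?_⟩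
  have : IsProbabilityMeasure (unitMeasure.map (upperQuantile μ)) :=
    Measure.isProbabilityMeasure_map (measurable_upperQuantile μ).aemeasurable
  refine Measure.ext_of_Ici _ _ fun p => ?_
  rw [Measure.map_apply (measurable_upperQuantile μ) measurableSet_Ici]
  have h1 : unitMeasure (upperQuantile μ ⁻¹' Set.Ici p) = unitMeasure (Set.Iic (survival μ p)) := by
    refine measure_congr ?_
    filter_upwards [ae_restrict_mem (μ := volume) (measurableSet_Ioo (a := (0 : ℝ)) (b := 1))]
      with u hu
    exact propext (le_upperQuantile_iff μ hu p)
  rw [h1, ← ENNReal.toReal_eq_toReal_iff' (measure_ne_top _ _) (measure_ne_top _ _),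
    ← measureReal_def, ← measureReal_def,
    unitMeasure_real_Iic (survival_nonneg μ p) (survival_le_one μ p)]
  rfl

theorem upperQuantile_nonneg (h : survival μ 0 = 1) (u : ℝ) : 0 ≤ upperQuantile μ u := by
  by_cases hu : u ∈ Set.Ioo (0 : ℝ) 1
  · rw [le_upperQuantile_iff μ hu, h]; exact hu.2.le
  · rw [upperQuantile, if_neg hu]

theorem countGE_upperQuantile {ι : Type*} [Fintype ι] {u : ι → ℝ}
    (hu : ∀ i, u i ∈ Set.Ioo (0 : ℝ) 1) (p : ℝ) :
    countGE (fun i => upperQuantile μ (u i)) p = countLE u (survival μ p) := by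
  unfold countGE countLE
  simp only [fun i => le_upperQuantile_iff μ (hu i) p]

end survival

/-! ### Strong regularity: the tangent bound and the quadratic revenue gap -/

/-- The derivative of `S * z ^ β` for an integral `S` and an affine `z`, with `β * z' = 1`. -/
theorem sub_mul_rpow_eq_integral {S g : ℝ → ℝ} (hg : Integrable g)
    (hS : ∀ a b, a ≤ b → S a - S b = ∫ t in a..b, g t) {x y e k β : ℝ} (hxy : x ≤ y)
    (hβ : β * k = 1) (hz : ∀ p ∈ Set.Icc x y, 0 < e + k * p) :
    S y * (e + k * y) ^ β - S x * (e + k * x) ^ β =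
      ∫ p in x..y, (e + k * p) ^ (β - 1) * (S p - g p * (e + k * p)) := by
  have hgi : IntervalIntegrable g volume x y := hg.intervalIntegrable
  -- `S` need not be differentiable everywhere. Its integral form `T` is absolutely continuous, so
  -- the product rule holds almost everywhere and can be integrated.
  set T : ℝ → ℝ := fun p => S x - ∫ t in x..p, g t with hT
  have hTS : ∀ p ∈ Set.Icc x y, T p = S p := by
    intro p hp
    have := hS x p hp.1
    simp only [hT]; linarith
  have hTac : AbsolutelyContinuousOnInterval T x y := by
    have h1 := hgi.absolutelyContinuousOnInterval_intervalIntegral (c := x) (by simp)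
    have h2 : AbsolutelyContinuousOnInterval (fun _ : ℝ => S x) x y :=
      ContDiffOn.absolutelyContinuousOnInterval contDiffOn_const
    exact h2.sub h1
  have hwd : ∀ p ∈ Set.Icc x y,
      HasDerivAt (fun p => (e + k * p) ^ β) ((e + k * p) ^ (β - 1)) p := by
    intro p hp
    have h1 : HasDerivAt (fun p => e + k * p) k p := by
      simpa using ((hasDerivAt_id p).const_mul k).const_add e
    have h2 := h1.rpow_const (p := β) (Or.inl (hz p hp).ne')
    convert! h2 using 1
    rw [mul_comm k β, hβ, one_mul]
  have hwac : AbsolutelyContinuousOnInterval (fun p => (e + k * p) ^ β) x y := by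
    refine ContDiffOn.absolutelyContinuousOnInterval fun p hp => ?_
    rw [Set.uIcc_of_le hxy] at hp
    refine ContDiffAt.contDiffWithinAt ?_
    exact ContDiffAt.rpow_const_of_ne (by fun_prop) (hz p hp).ne'
  have h := hTac.integral_deriv_mul_eq_sub hwac
  rw [hTS y (Set.right_mem_Icc.2 hxy), hTS x (Set.left_mem_Icc.2 hxy)] at h
  rw [← h]
  refine intervalIntegral.integral_congr_ae ?_
  filter_upwards [hgi.ae_hasDerivAt_integral] with p hp1 hp2
  have hp : p ∈ Set.uIcc x y := Set.uIoc_subset_uIcc hp2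
  have hTd : HasDerivAt T (-g p) p := by
    simpa using (hp1 hp x (by simp)).const_sub (S x)
  rw [Set.uIcc_of_le hxy] at hp
  rw [hTd.deriv, (hwd p hp).deriv, hTS p hp]
  have hr : (e + k * p) ^ β = (e + k * p) ^ (β - 1) * (e + k * p) := by
    rw [← Real.rpow_add_one (hz p hp).ne']; ring_nf
  rw [hr]
  ring

theorem mul_rpow_antitone_of_le {S g : ℝ → ℝ} (hg : Integrable g)
    (hS : ∀ a b, a ≤ b → S a - S b = ∫ t in a..b, g t) {x y e k β : ℝ} (hxy : x ≤ y)
    (hβ : β * k = 1) (hz : ∀ p ∈ Set.Icc x y, 0 < e + k * p)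
    (h : ∀ p ∈ Set.Ioo x y, S p ≤ g p * (e + k * p)) :
    S y * (e + k * y) ^ β ≤ S x * (e + k * x) ^ β := by
  rw [← sub_nonpos, sub_mul_rpow_eq_integral hg hS hxy hβ hz, intervalIntegral.integral_of_le hxy,
    integral_Ioc_eq_integral_Ioo]
  refine setIntegral_nonpos measurableSet_Ioo fun p hp => ?_
  exact mul_nonpos_of_nonneg_of_nonpos
    (Real.rpow_nonneg (hz p (Set.Ioo_subset_Icc_self hp)).le _) (sub_nonpos.2 (h p hp))

theorem mul_rpow_monotone_of_le {S g : ℝ → ℝ} (hg : Integrable g)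
    (hS : ∀ a b, a ≤ b → S a - S b = ∫ t in a..b, g t) {x y e k β : ℝ} (hxy : x ≤ y)
    (hβ : β * k = 1) (hz : ∀ p ∈ Set.Icc x y, 0 < e + k * p)
    (h : ∀ p ∈ Set.Ioo x y, g p * (e + k * p) ≤ S p) :
    S x * (e + k * x) ^ β ≤ S y * (e + k * y) ^ β := by
  rw [← sub_nonneg, sub_mul_rpow_eq_integral hg hS hxy hβ hz, intervalIntegral.integral_of_le hxy,
    integral_Ioc_eq_integral_Ioo]
  refine setIntegral_nonneg measurableSet_Ioo fun p hp => ?_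
  exact mul_nonneg
    (Real.rpow_nonneg (hz p (Set.Ioo_subset_Icc_self hp)).le _) (sub_nonneg.2 (h p hp))

/-- The quadratic gap in quantile space that follows from the tangent bound. -/
theorem mul_le_one_sub_of_rpow_le {α a s t : ℝ} (hα0 : 0 < α) (hα1 : α < 1) (ha0 : 0 < a)
    (ha1 : a ≤ 1) (hs0 : 0 ≤ s) (hsa : s * a ≤ 1) (ht : 0 ≤ t)
    (h : s * (α + (1 - α) * t) ^ (1 / (1 - α)) ≤ 1) :
    t * s ≤ 1 - α * a / 4 * (s - 1) ^ 2 := by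
  rcases hs0.eq_or_lt with rfl | hs
  · nlinarith [mul_pos hα0 ha0]
  have h1α : 0 < 1 - α := by linarith
  set w := α + (1 - α) * t with hw
  have hw0 : 0 < w := by positivity
  have h1 : s ^ (1 - α) * w ≤ 1 := by
    have := Real.rpow_le_rpow (by positivity) h h1α.le
    rwa [Real.one_rpow, Real.mul_rpow hs.le (by positivity), ← Real.rpow_mul hw0.le,
      one_div_mul_cancel h1α.ne', Real.rpow_one] at this
  have h2 : s * w ≤ s ^ α := by
    have h3 : s ^ α * (s ^ (1 - α) * w) ≤ s ^ α * 1 :=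
      mul_le_mul_of_nonneg_left h1 (by positivity)
    rw [← mul_assoc, ← Real.rpow_add hs] at h3
    simpa using h3
  set r := √s with hr
  have hr0 : 0 ≤ r := Real.sqrt_nonneg _
  have hrs : r ^ 2 = s := Real.sq_sqrt hs.le
  -- Bernoulli applied directly to `s ^ α` would only give `t * s ≤ 1`. Applied to the square root
  -- `r` of `s` and then squared, it leaves the second-order term `α (r - 1) ^ 2`.
  have h4 : r ^ α ≤ 1 + α * (r - 1) := by
    have := rpow_one_add_le_one_add_mul_self (s := r - 1) (by linarith) hα0.le hα1.le
    rwa [add_sub_cancel] at this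
  have h5 : s ^ α = (r ^ α) ^ 2 := by
    rw [← hrs, ← Real.rpow_natCast, ← Real.rpow_natCast, ← Real.rpow_mul hr0,
      ← Real.rpow_mul hr0, mul_comm]
  have h6 : s ^ α ≤ (1 + α * (r - 1)) ^ 2 := by
    rw [h5]; exact pow_le_pow_left₀ (by positivity) h4 2
  have h7 : (1 - α) * (t * s) ≤ (1 - α) * (1 - α * (r - 1) ^ 2) := by
    have : s * w = α * s + (1 - α) * (t * s) := by rw [hw]; ring
    have h8 : (1 + α * (r - 1)) ^ 2 = α * r ^ 2 + (1 - α) * (1 - α * (r - 1) ^ 2) := by ring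
    rw [hrs] at h8
    linarith
  have h9 : t * s ≤ 1 - α * (r - 1) ^ 2 := le_of_mul_le_mul_left h7 h1α
  have h10 : a * (r + 1) ^ 2 ≤ 4 := by nlinarith [sq_nonneg (r - 1)]
  have h11 : (s - 1) ^ 2 = (r - 1) ^ 2 * (r + 1) ^ 2 := by rw [← hrs]; ring
  have h12 : α * a / 4 * (s - 1) ^ 2 ≤ α * (r - 1) ^ 2 := by
    rw [h11]
    have := mul_le_mul_of_nonneg_left h10 (by positivity : 0 ≤ α * (r - 1) ^ 2)
    nlinarith
  linarith

/-- What regularity is used for: there is a monopoly price `p` with the tangent bound on the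
survival function. -/
structure HasMonopolyPrice (α : ℝ) (μ : Measure ℝ) (p : ℝ) : Prop where
  pos : 0 < p
  survival_zero : survival μ 0 = 1
  tangent : ∀ x, 0 ≤ x →
    survival μ x * (α + (1 - α) * (x / p)) ^ (1 / (1 - α)) ≤ survival μ p

theorem measurableSet_supportInterior (A : ℝ) (B : EReal) :
    MeasurableSet (supportInterior A B) :=
  (measurableSet_lt measurable_const measurable_id).inter
    (measurableSet_lt measurable_coe_real_ereal measurable_const)

theorem IsStronglyRegular.nullSingletonClass {α : ℝ} {μ : Measure ℝ} (h : IsStronglyRegular α μ) :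
    NullSingletonClass μ := by
  obtain ⟨A, B, f, -, -, -, -, hμ, -⟩ := h
  refine ⟨fun x => ?_⟩
  rw [hμ]
  exact withDensity_absolutelyContinuous _ _ (by simp)

/-- Let `q` be the infimum of the points where the virtual value `φ` is non-negative. The slope
condition gives `φ p ≥ α (p - q)` to the right of `q` and `φ p ≤ -α (q - p)` to its left. Since `S =
g (p - φ)` on the support, the derivative of `S p * (α q + (1 - α) p) ^ (1 / (1 - α))` is
non-negative before `q` and non-positive after it. The product is therefore largest at `q`, which is
the tangent bound. -/
theorem IsStronglyRegular.exists_monopolyPrice {α : ℝ} {μ : Measure ℝ} [IsProbabilityMeasure μ]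
    (hα0 : 0 < α) (hα1 : α < 1) (h : IsStronglyRegular α μ) : ∃ p, HasMonopolyPrice α μ p := by
  have hatoms := h.nullSingletonClass
  obtain ⟨A, B, f, hA, hAB, hfm, hfpos, hμ, hφ⟩ := h
  set U := supportInterior A B with hU
  have hUm : MeasurableSet U := measurableSet_supportInterior A B
  set g : ℝ → ℝ := U.indicator f with hg
  have hg0 : ∀ x, 0 ≤ g x := fun x => Set.indicator_nonneg (fun y hy => (hfpos y hy).le) x
  have hgm : Measurable g := hfm.indicator hUm
  have hμg : μ = volume.withDensity fun x => ENNReal.ofReal (g x) := by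
    rw [hμ, ← withDensity_indicator hUm]
    congr 1
    funext x
    by_cases hx : x ∈ U <;> simp [hg, hx]
  have hgint : Integrable g := by
    refine ⟨hgm.aestronglyMeasurable, ?_⟩
    rw [hasFiniteIntegral_iff_ofReal (Eventually.of_forall hg0)]
    have h1 : μ Set.univ = ∫⁻ x, ENNReal.ofReal (g x) := by
      rw [hμg, withDensity_apply _ MeasurableSet.univ, Measure.restrict_univ]
    rw [← h1]
    exact measure_lt_top _ _
  have hreal : ∀ s, MeasurableSet s → μ.real s = ∫ x in s, g x := by
    intro s hs
    rw [measureReal_def, hμg, withDensity_apply _ hs,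
      integral_eq_lintegral_of_nonneg_ae (Eventually.of_forall hg0) hgm.aestronglyMeasurable]
  set S := survival μ with hSdef
  have hSanti : Antitone S := survival_antitone μ
  have hS : ∀ a b, a ≤ b → S a - S b = ∫ t in a..b, g t := by
    intro a b hab
    rw [intervalIntegral.integral_of_le hab, ← hreal _ measurableSet_Ioc]
    have h1 : S a = μ.real (Set.Ioi a) := measureReal_congr Ioi_ae_eq_Ici.symm
    have h2 : S b = μ.real (Set.Ioi b) := measureReal_congr Ioi_ae_eq_Ici.symm
    rw [h1, h2, ← Set.Ioc_union_Ioi_eq_Ioi hab,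
      measureReal_union (Set.Ioc_disjoint_Ioi le_rfl) measurableSet_Ioi]
    ring
  have hSz : ∀ p, p ≤ A → S p = 1 := by
    intro p hp
    have h1 : μ.real (Set.Ici p)ᶜ = 0 := by
      rw [hreal _ measurableSet_Ici.compl]
      refine setIntegral_eq_zero_of_forall_eq_zero fun x hx => ?_
      rw [Set.compl_Ici, Set.mem_Iio] at hx
      refine Set.indicator_of_notMem (fun hxU => ?_) _
      exact absurd hxU.1 (not_lt.2 (hx.le.trans hp))
    rw [probReal_compl_eq_one_sub measurableSet_Ici] at h1
    change μ.real (Set.Ici p) = 1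
    linarith
  have hSB : ∀ p : ℝ, B ≤ p → S p = 0 := by
    intro p hp
    change μ.real (Set.Ici p) = 0
    rw [hreal _ measurableSet_Ici]
    refine setIntegral_eq_zero_of_forall_eq_zero fun x hx => ?_
    refine Set.indicator_of_notMem (fun hxU => ?_) _
    have h1 : (p : EReal) ≤ x := EReal.coe_le_coe_iff.2 hx
    exact absurd hxU.2 (not_lt.2 (hp.trans h1))
  have hgf : ∀ p ∈ U, g p = f p := fun p hp => Set.indicator_of_mem hp f
  have hvv : ∀ p, virtualValue μ f p = p - S p / f p := by
    intro p
    rw [virtualValue, ← survival_eq_one_sub_cdf]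
  have hle : ∀ p ∈ U, ∀ c, c ≤ virtualValue μ f p → S p ≤ g p * (p - c) := by
    intro p hp c hc
    have := hfpos p hp
    rw [hvv] at hc
    rw [hgf p hp, mul_comm, ← div_le_iff₀ this]
    linarith
  have hge : ∀ p ∈ U, ∀ c, virtualValue μ f p ≤ c → g p * (p - c) ≤ S p := by
    intro p hp c hc
    have := hfpos p hp
    rw [hvv] at hc
    rw [hgf p hp, mul_comm, ← le_div_iff₀ this]
    linarith
  have h1α : 0 < 1 - α := by linarith
  set β := 1 / (1 - α) with hβ
  have hβ0 : 0 < β := by positivity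
  have hβ1 : β * (1 - α) = 1 := one_div_mul_cancel h1α.ne'
  -- monotonicity to the left of a point before which the virtual value is negative
  have left : ∀ q : ℝ, 0 < q →
      (∀ p ∈ U, p < q → virtualValue μ f p ≤ -(α * (q - p))) → ∀ x, 0 ≤ x → x ≤ q →
      S x * (α * q + (1 - α) * x) ^ β ≤ S q * (α * q + (1 - α) * q) ^ β := by
    intro q hq hneg x hx hxq
    refine mul_rpow_monotone_of_le hgint hS hxq hβ1 (fun p hp => ?_) fun p hp => ?_
    · have := hx.trans hp.1
      positivity
    · by_cases hpU : p ∈ U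
      · have := hge p hpU _ (hneg p hpU hp.2)
        linarith
      · have : g p = 0 := Set.indicator_of_notMem hpU f
        rw [this, zero_mul]
        exact survival_nonneg μ p
  set Z := {p | p ∈ U ∧ 0 ≤ virtualValue μ f p} with hZ
  have hZne : Z.Nonempty := by
    by_contra hne
    have hneg : ∀ p ∈ U, virtualValue μ f p < 0 := by
      intro p hp
      by_contra hle
      exact hne ⟨p, hp, not_lt.1 hle⟩
    -- On an unbounded support `φ` grows at least linearly and becomes positive. On a bounded one,
    -- `φ < 0` throughout would make the product monotone up to `B`, where it vanishes, although it
    -- is positive at `A`.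
    rcases eq_or_ne B ⊤ with hB | hB
    · have hUall : ∀ p, A < p → p ∈ U := fun p hp => ⟨hp, by rw [hB]; exact EReal.coe_lt_top p⟩
      have h1 : A + 1 ∈ U := hUall _ (by linarith)
      set y := A + 2 + -virtualValue μ f (A + 1) / α with hy
      have h3 : 0 < -virtualValue μ f (A + 1) / α := div_pos (by linarith [hneg _ h1]) hα0
      have h2 : y ∈ U := hUall _ (by linarith)
      have h4 := hφ _ h1 _ h2 (by linarith)
      have h5 : α * (y - (A + 1)) = α - virtualValue μ f (A + 1) := by
        rw [hy]; field_simp; ring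
      linarith [hneg _ h2]
    · have hBbot : B ≠ ⊥ := fun hb => by simp [hb] at hAB
      lift B to ℝ using ⟨hB, hBbot⟩
      have hAB' : A ≤ B := EReal.coe_le_coe_iff.1 hAB
      have hSA := hSz A le_rfl
      have hSB' := hSB B le_rfl
      have hlt : A < B := by
        rcases hAB'.eq_or_lt with h | h
        · rw [h] at hSA; linarith
        · exact h
      have h1 := left B (by linarith) (fun p hp hpB => ?_) A hA hlt.le
      · rw [hSA, hSB', zero_mul, one_mul] at h1
        have h2 : 0 < α * B + (1 - α) * A := by
          have : 0 < B := by linarith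
          positivity
        exact absurd h1 (not_le.2 (Real.rpow_pos_of_pos h2 _))
      · have h1 : ∀ᶠ p' in 𝓝[<] B, virtualValue μ f p ≤ -(α * (p' - p)) := by
          filter_upwards [Ioo_mem_nhdsLT hpB] with p' hp'
          have hp'U : p' ∈ U := ⟨hp.1.trans hp'.1, EReal.coe_lt_coe_iff.2 hp'.2⟩
          have := hφ _ hp _ hp'U hp'.1
          linarith [hneg _ hp'U]
        refine ge_of_tendsto ?_ h1
        have : Continuous fun p' => -(α * (p' - p)) := by fun_prop
        exact (this.tendsto B).mono_left nhdsWithin_le_nhds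
  have hZbdd : BddBelow Z := ⟨A, fun p hp => hp.1.1.le⟩
  set q := sInf Z with hq
  have hAq : A ≤ q := le_csInf hZne fun p hp => hp.1.1.le
  have hright : ∀ p ∈ U, q < p → α * (p - q) ≤ virtualValue μ f p := by
    intro p hp hqp
    refine le_of_forall_pos_lt_add fun ε hε => ?_
    obtain ⟨p', hp', hlt⟩ := exists_lt_of_csInf_lt hZne
      (show sInf Z < min p (q + ε / α) from lt_min hqp (by
        rw [← hq]; linarith [div_pos hε hα0]))
    have h1 := hφ _ hp'.1 _ hp (hlt.trans_le (min_le_left _ _))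
    have h2 := hp'.2
    have h3 : p' < q + ε / α := hlt.trans_le (min_le_right _ _)
    have h4 : α * p' < α * q + ε := by
      have := mul_lt_mul_of_pos_left h3 hα0
      rwa [mul_add, mul_div_cancel₀ _ hα0.ne'] at this
    nlinarith
  have hleft : ∀ p ∈ U, p < q → virtualValue μ f p ≤ -(α * (q - p)) := by
    intro p hp hpq
    obtain ⟨p₁, hp₁⟩ := hZne
    have hqp₁ : q ≤ p₁ := csInf_le hZbdd hp₁
    have h1 : ∀ᶠ p' in 𝓝[<] q, virtualValue μ f p ≤ -(α * (p' - p)) := by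
      filter_upwards [Ioo_mem_nhdsLT hpq] with p' hp'
      have hp'U : p' ∈ U := ⟨hp.1.trans hp'.1, lt_trans (EReal.coe_lt_coe_iff.2
        (hp'.2.trans_le hqp₁)) hp₁.1.2⟩
      have hneg : virtualValue μ f p' < 0 := by
        by_contra hle
        exact absurd (csInf_le hZbdd ⟨hp'U, not_lt.1 hle⟩) (not_le.2 hp'.2)
      have := hφ _ hp _ hp'U hp'.1
      linarith
    refine ge_of_tendsto ?_ h1
    have : Continuous fun p' => -(α * (p' - p)) := by fun_prop
    exact (this.tendsto q).mono_left nhdsWithin_le_nhds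
  have hq0 : 0 ≤ q := hA.trans hAq
  -- monotonicity to the right of `q`
  have right : ∀ x y, q ≤ x → x ≤ y → 0 < α * q + (1 - α) * x → (y : EReal) ≤ B →
      S y * (α * q + (1 - α) * y) ^ β ≤ S x * (α * q + (1 - α) * x) ^ β := by
    intro x y hqx hxy hzx hyB
    refine mul_rpow_antitone_of_le hgint hS hxy hβ1 (fun p hp => ?_) fun p hp => ?_
    · nlinarith [hp.1]
    · have hpU : p ∈ U := ⟨by linarith [hp.1], (EReal.coe_lt_coe_iff.2 hp.2).trans_le hyB⟩
      have := hle p hpU _ (hright p hpU (hqx.trans_lt hp.1))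
      linarith
  have hqpos : 0 < q := by
    rcases hq0.eq_or_lt with h | h
    -- If `q = 0`, the product is non-increasing on the support to the right of `0` and tends to `0`
    -- at `0`. So `S` would vanish just to the right of `0`, against its continuity and `S 0 = 1`.
    · exfalso
      have hA0 : A = 0 := by linarith
      obtain ⟨p₁, hp₁⟩ := hZne
      have hS0 : ∀ y, 0 < y → y ≤ p₁ → S y = 0 := by
        intro y hy hyp
        have hzy : 0 < ((1 - α) * y) ^ β := Real.rpow_pos_of_pos (by positivity) _
        have h1 : ∀ᶠ x in 𝓝[>] (0 : ℝ), S y * ((1 - α) * y) ^ β ≤ ((1 - α) * x) ^ β := by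
          filter_upwards [Ioo_mem_nhdsGT hy] with x hx
          have hx0 := hx.1
          have h2 := right x y (by linarith [hx.1]) hx.2.le (by rw [← h]; simp; positivity)
            ((EReal.coe_le_coe_iff.2 hyp).trans hp₁.1.2.le)
          rw [← h, mul_zero, zero_add, zero_add] at h2
          refine h2.trans ?_
          have h3 : 0 ≤ ((1 - α) * x) ^ β := Real.rpow_nonneg (by positivity) _
          exact mul_le_of_le_one_left h3 (survival_le_one μ x)
        have h2 : S y * ((1 - α) * y) ^ β ≤ 0 := by
          refine ge_of_tendsto ?_ h1
          have hc : Continuous fun x : ℝ => ((1 - α) * x) ^ β :=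
            (continuous_const.mul continuous_id).rpow_const fun _ => Or.inr hβ0.le
          have := (hc.tendsto 0).mono_left (nhdsWithin_le_nhds (s := Set.Ioi 0))
          simpa [Real.zero_rpow hβ0.ne'] using this
        have h3 : 0 ≤ S y := survival_nonneg μ y
        nlinarith
      have hp1pos : 0 < p₁ := by rw [← hA0]; exact hp₁.1.1
      have h1 : Tendsto S (𝓝[>] 0) (𝓝 (S 0)) :=
        ((continuous_survival μ).tendsto 0).mono_left nhdsWithin_le_nhds
      have h2 : Tendsto S (𝓝[>] 0) (𝓝 0) := by
        refine tendsto_const_nhds.congr' ?_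
        filter_upwards [Ioo_mem_nhdsGT hp1pos] with x hx
        exact (hS0 x hx.1 hx.2.le).symm
      have h3 := tendsto_nhds_unique h1 h2
      rw [hSz 0 hA] at h3
      exact one_ne_zero h3
    · exact h
  refine ⟨q, hqpos, hSz 0 hA, fun x hx => ?_⟩
  have hmain : S x * (α * q + (1 - α) * x) ^ β ≤ S q * (α * q + (1 - α) * q) ^ β := by
    rcases le_total x q with h | h
    · exact left q hqpos hleft x hx h
    · rcases le_total (x : EReal) B with hxB | hxB
      · exact right q x le_rfl h (by nlinarith) hxB
      · rw [hSB x hxB, zero_mul]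
        exact mul_nonneg (survival_nonneg μ q) (Real.rpow_nonneg (by nlinarith) _)
  have e1 : α * q + (1 - α) * x = q * (α + (1 - α) * (x / q)) := by
    field_simp
  have e2 : α * q + (1 - α) * q = q := by ring
  have hnn : 0 ≤ α + (1 - α) * (x / q) := by positivity
  rw [e1, e2, Real.mul_rpow hqpos.le hnn] at hmain
  have hqβ : 0 < q ^ β := Real.rpow_pos_of_pos hqpos _
  refine le_of_mul_le_mul_right ?_ hqβ
  calc _ = S x * (q ^ β * (α + (1 - α) * (x / q)) ^ β) := by ring
    _ ≤ _ := hmain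

theorem HasMonopolyPrice.rpow_le_survival {α : ℝ} {μ : Measure ℝ} {p : ℝ}
    (h : HasMonopolyPrice α μ p) : α ^ (1 / (1 - α)) ≤ survival μ p := by
  have := h.tangent 0 le_rfl
  rwa [h.survival_zero, zero_div, mul_zero, add_zero, one_mul] at this

theorem HasMonopolyPrice.revenue_gap {α : ℝ} (hα0 : 0 < α) (hα1 : α < 1) {μ : Measure ℝ}
    [IsProbabilityMeasure μ] {p : ℝ} (h : HasMonopolyPrice α μ p) {x : ℝ} (hx : 0 ≤ x) :
    x * survival μ x ≤ p * survival μ p *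
      (1 - α * α ^ (1 / (1 - α)) / 4 * (survival μ x / survival μ p - 1) ^ 2) := by
  set a := α ^ (1 / (1 - α)) with ha
  have ha0 : 0 < a := Real.rpow_pos_of_pos hα0 _
  have haq := h.rpow_le_survival
  rw [← ha] at haq
  have hq0 : 0 < survival μ p := ha0.trans_le haq
  have hp := h.pos
  have hq1 := survival_le_one μ p
  have hx1 := survival_le_one μ x
  have hx0 := survival_nonneg μ x
  have key := mul_le_one_sub_of_rpow_le (s := survival μ x / survival μ p) (t := x / p)
    hα0 hα1 ha0 (haq.trans hq1) (by positivity) (by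
      rw [div_mul_eq_mul_div, div_le_one hq0]; nlinarith) (by positivity) (by
      rw [div_mul_eq_mul_div, div_le_one hq0]; exact h.tangent x hx)
  have e : x * survival μ x = p * survival μ p * (x / p * (survival μ x / survival μ p)) := by
    field_simp
  rw [e]
  exact mul_le_mul_of_nonneg_left key (by positivity)

/-! ### Deterministic consequences of concentrated counts -/

/-- The full count lies between the honest count and the honest count plus `|I|`, so optimality
among all entries weakens to optimality up to `|I|`. The conclusion mentions the bids only through
the price. -/
theorem isCandidate_ERM {N : ℕ} (hN : 0 < N) {c : ℝ} (hc0 : 0 ≤ c) (hc : c < 1)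
    {I : Finset (Fin N)} (b : {i : Fin N // i ∈ I} → ℝ≥0) {μ : Measure ℝ}
    [IsProbabilityMeasure μ] [NullSingletonClass μ] (hμ : survival μ 0 = 1)
    {u : {j : Fin N // j ∉ I} → ℝ} (hu : ∀ i, u i ∈ Set.Ioo (0 : ℝ) 1) :
    IsCandidate (c * N) I.card (survival μ) (fun z => countLE u z)
      (ERM c (joinSamples I b fun i => upperQuantile μ (u i))) := by
  set v : {j : Fin N // j ∉ I} → ℝ := fun i => upperQuantile μ (u i) with hv
  have hv0 : ∀ j, 0 ≤ v j := fun j => upperQuantile_nonneg μ hμ _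
  have hcount : ∀ p, countLE u (survival μ p) = countGE v p := fun p =>
    (countGE_upperQuantile μ hu p).symm
  set x := joinSamples I b v with hx
  have hx0 : ∀ k, 0 ≤ x k := joinSamples_nonneg b hv0
  have hP0 := ERM_nonneg c hx0
  have hle : (countGE x (ERM c x) : ℝ) ≤ countGE v (ERM c x) + I.card := by
    exact_mod_cast countGE_joinSamples_le b v (ERM c x)
  refine ⟨hP0, ?_, fun p hp hpc => ?_⟩
  · simp only [hcount]
    exact (lt_countGE_ERM hN hc x).trans_le hle
  · simp only [hcount] at hpc ⊢
    have h1 : (countGE v p : ℝ) ≤ countGE x p := by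
      exact_mod_cast countGE_le_countGE_joinSamples b v p
    have h2 := mul_countGE_le_ERM hN hc hc0 hx0 (hpc.trans_le h1)
    calc p * (countGE v p : ℝ) ≤ p * countGE x p := by gcongr
      _ ≤ _ := h2
      _ ≤ _ := by gcongr

/-- `K` counts close to uniformly: `N` samples up to `η N`, with deviations at most `2 η N`. -/
structure CountsClose (N m η : ℝ) (K : ℝ → ℝ) : Prop where
  mono : Monotone K
  close : ∀ y, 0 ≤ y → y ≤ 1 → |K y - (N - m) * y| ≤ 2 * η * N

theorem CountsClose.le {N m η : ℝ} {K : ℝ → ℝ} (h : CountsClose N m η K) (hm0 : 0 ≤ m)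
    {y : ℝ} (h0 : 0 ≤ y) (h1 : y ≤ 1) : K y ≤ N * (y + 2 * η) := by
  have := (abs_le.1 (h.close y h0 h1)).2
  nlinarith

theorem CountsClose.ge {N m η : ℝ} {K : ℝ → ℝ} (h : CountsClose N m η K) (hm0 : 0 ≤ m)
    (hm : m ≤ η * N) {y : ℝ} (h0 : 0 ≤ y) (h1 : y ≤ 1) : N * (y - 3 * η) ≤ K y := by
  have := (abs_le.1 (h.close y h0 h1)).1
  nlinarith

section deterministic

variable {α : ℝ} {μ : Measure ℝ} [IsProbabilityMeasure μ] {p₀ a N m η c : ℝ} {K : ℝ → ℝ}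

/-- A bootstrap. The guard gives `S P ≥ c / 2`, which bounds `P` by a multiple of `p₀ / c`. The
quadratic gap then yields closeness only up to `O(η / c)`, but since `η` is small relative to `c`
this gives `S P ≥ 9/10 * S p₀` and hence `P ≤ 2 p₀`. Using the gap again with this bound gives an
error free of `c`. -/
theorem IsCandidate.survival_close (hα0 : 0 < α) (hα1 : α < 1) (hp₀ : HasMonopolyPrice α μ p₀)
    (ha : a = α ^ (1 / (1 - α))) (hN : 0 < N) (hm0 : 0 ≤ m) (hm : m ≤ η * N) (hη : 0 < η)
    (hηc : η ≤ α * a ^ 4 / 4000 * c) (hca : c ≤ 2 / 5 * a) (hK : CountsClose N m η K) {P : ℝ}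
    (hP : IsCandidate (c * N) m (survival μ) K P) :
    |survival μ P - survival μ p₀| ≤ √(36 * η / (α * a ^ 2)) ∧
      9 / 10 * a ≤ survival μ P ∧ 0 < P := by
  have ha0 : 0 < a := ha ▸ Real.rpow_pos_of_pos hα0 _
  have haq : a ≤ survival μ p₀ := ha ▸ hp₀.rpow_le_survival
  have hgap := hp₀.revenue_gap hα0 hα1 hP.nonneg
  rw [← ha] at hgap
  set q := survival μ P with hq
  set q₀ := survival μ p₀ with hq₀
  have hq0 : 0 ≤ q := survival_nonneg μ P
  have hq1 : q ≤ 1 := survival_le_one μ P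
  have hq₀1 : q₀ ≤ 1 := survival_le_one μ p₀
  have hq₀0 : 0 < q₀ := ha0.trans_le haq
  have ha1 : a ≤ 1 := haq.trans hq₀1
  have hp₀0 := hp₀.pos
  have hP0 := hP.nonneg
  have hθ : α * a ^ 4 / 4000 ≤ 1 / 4000 := by
    have : a ^ 4 ≤ 1 := pow_le_one₀ ha0.le ha1
    have : α * a ^ 4 ≤ 1 := by nlinarith [pow_pos ha0 4]
    linarith
  have hc0 : 0 < c := by
    by_contra hle
    push Not at hle
    have : α * a ^ 4 / 4000 * c ≤ 0 := mul_nonpos_of_nonneg_of_nonpos (by positivity) hle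
    linarith
  have hc1 : c ≤ 1 := by linarith
  have hηc' : 4000 * η ≤ c := by
    have := mul_le_mul_of_nonneg_right hθ hc0.le
    linarith
  -- the guard bounds the quantile from below
  have hqc : c ≤ 2 * q := by
    have h1 := hP.guard
    have h2 := hK.le hm0 hq0 hq1
    have h3 : c * N < (q + 3 * η) * N := by linarith
    have h4 := lt_of_mul_lt_mul_right h3 hN.le
    linarith
  -- comparison with the monopoly price
  have hstar : p₀ * (q₀ - 3 * η) ≤ P * (q + 3 * η) := by
    have h1 := hK.ge hm0 hm hq₀0.le hq₀1
    have h2 := hP.optimal p₀ hp₀0.le (by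
      refine lt_of_lt_of_le ?_ h1
      rw [mul_comm c N]
      exact mul_lt_mul_of_pos_left (by linarith) hN)
    have h3 := hK.le hm0 hq0 hq1
    have h4 : p₀ * (N * (q₀ - 3 * η)) ≤ P * (N * (q + 3 * η)) := by
      refine (mul_le_mul_of_nonneg_left h1 hp₀0.le).trans (h2.trans ?_)
      refine mul_le_mul_of_nonneg_left ?_ hP0
      rw [← hq]; linarith
    have h5 : N * (p₀ * (q₀ - 3 * η)) ≤ N * (P * (q + 3 * η)) := by linarith
    exact le_of_mul_le_mul_left h5 hN
  have hPpos : 0 < P := by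
    rcases hP0.eq_or_lt with h | h
    · exfalso
      rw [← h, zero_mul] at hstar
      have : 0 < p₀ * (q₀ - 3 * η) := mul_pos hp₀0 (by linarith)
      linarith
    · exact h
  set X := (q / q₀ - 1) ^ 2 with hX
  have hX0 : 0 ≤ X := sq_nonneg _
  have hPq : P * q ≤ p₀ * q₀ := by
    refine hgap.trans ?_
    have : 0 ≤ α * a / 4 * X := by positivity
    have h2 := mul_nonneg (by positivity : 0 ≤ p₀ * q₀) this
    linarith
  have hdef : p₀ * (a * (α * a / 4) * X) ≤ 3 * η * (p₀ + P) := by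
    have h1 : p₀ * (a * (α * a / 4) * X) ≤ p₀ * (q₀ * (α * a / 4) * X) := by gcongr
    have h2 : p₀ * q₀ * (1 - α * a / 4 * X) = p₀ * q₀ - p₀ * (q₀ * (α * a / 4) * X) := by ring
    rw [h2] at hgap
    linarith
  -- The factor `1 / 4000` in the bound on `η` is chosen here: `a * (α a / 4) * X * c ≤ 9 η` gives
  -- `X ≤ 36 / 4000`.
  have hXle : X ≤ 1 / 100 := by
    have h1 : P * c ≤ 2 * p₀ := by
      have h2 := mul_le_mul_of_nonneg_left hqc hP0
      have h3 := mul_le_mul_of_nonneg_left hq₀1 hp₀0.le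
      linarith
    have h2 : p₀ * (a * (α * a / 4) * X) * c ≤ p₀ * (9 * η) := by
      calc _ ≤ 3 * η * (p₀ + P) * c := by gcongr
        _ = 3 * η * (p₀ * c + P * c) := by ring
        _ ≤ 3 * η * (p₀ * 1 + 2 * p₀) := by gcongr
        _ = _ := by ring
    have h3 : (a * (α * a / 4) * X) * c ≤ 9 * η :=
      le_of_mul_le_mul_left (by linarith) hp₀0
    have h4 : (a * (α * a / 4) * X) * c ≤ (a * (α * a / 4) * (1 / 100)) * c := by
      have h5 : α * a ^ 4 ≤ α * a ^ 2 := by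
        have : a ^ 4 ≤ a ^ 2 := pow_le_pow_of_le_one ha0.le ha1 (by norm_num)
        gcongr
      have h6 : 0 < c * (α * a ^ 2) := by positivity
      have h7 := mul_le_mul_of_nonneg_left h5 hc0.le
      linarith
    have h7 := le_of_mul_le_mul_right h4 hc0
    exact le_of_mul_le_mul_left h7 (by positivity)
  have hs : |q / q₀ - 1| ≤ 1 / 10 := by
    refine abs_le_of_sq_le_sq ?_ (by norm_num)
    rw [← hX]; norm_num; linarith
  have hq9 : 9 / 10 * q₀ ≤ q := by
    have h1 := (abs_le.1 hs).1
    have h2 : 9 / 10 ≤ q / q₀ := by linarith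
    rwa [le_div_iff₀ hq₀0] at h2
  have hP2 : P ≤ 2 * p₀ := by
    by_contra hlt
    push Not at hlt
    have h1 := mul_le_mul hlt.le hq9 (by positivity) hP0
    have h2 := mul_pos hp₀0 hq₀0
    linarith
  refine ⟨?_, by linarith, hPpos⟩
  have hX2 : X ≤ 36 * η / (α * a ^ 2) := by
    rw [le_div_iff₀ (by positivity)]
    have h1 : p₀ * (a * (α * a / 4) * X) ≤ p₀ * (9 * η) := by
      have := mul_le_mul_of_nonneg_left hP2 hη.le
      linarith
    have h2 := le_of_mul_le_mul_left h1 hp₀0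
    linarith
  have hs2 : |q / q₀ - 1| ≤ √(36 * η / (α * a ^ 2)) := Real.abs_le_sqrt hX2
  have he : q - q₀ = q₀ * (q / q₀ - 1) := by field_simp
  rw [he, abs_mul, abs_of_pos hq₀0]
  exact (mul_le_of_le_one_left (abs_nonneg _) hq₀1).trans hs2

theorem CountsClose.guard_lt (ha0 : 0 < a) (hN : 0 < N) (hm0 : 0 ≤ m) (hm : m ≤ η * N)
    (hηa : η ≤ a / 4000) (hca : c ≤ 2 / 5 * a) (hK : CountsClose N m η K) {y : ℝ}
    (hy : 9 / 10 * a ≤ y) (hy1 : y ≤ 1) : c * N < K y := by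
  refine lt_of_lt_of_le ?_ (hK.ge hm0 hm (by linarith) hy1)
  rw [mul_comm c N]
  exact mul_lt_mul_of_pos_left (by linarith) hN

/-- Near-optimality of `P₂` against `P₁` bounds the relative loss by `(K q₂ + m - K q₁) / (K q₂ +
m)`. The numerator is at most `N (q₂ - q₁ + 5 η)`: two deviations of `2 η N` and `m ≤ η N`. The
denominator is at least `N a / 2`. -/
theorem IsCandidate.ratio_ge (ha0 : 0 < a) (hN : 0 < N) (hm0 : 0 ≤ m)
    (hm : m ≤ η * N) (hη : 0 < η) (hηa : η ≤ a / 4000) (hca : c ≤ 2 / 5 * a)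
    (hK : CountsClose N m η K) {P₁ P₂ : ℝ}
    (h₁ : IsCandidate (c * N) m (survival μ) K P₁)
    (h₂ : IsCandidate (c * N) m (survival μ) K P₂) (hq₁ : 9 / 10 * a ≤ survival μ P₁)
    (hle : P₂ ≤ P₁) :
    (1 - 2 / a * (survival μ P₂ - survival μ P₁ + 5 * η)) * P₁ ≤ P₂ := by
  have hqq := survival_antitone μ hle
  have hq₂1 := survival_le_one μ P₂
  have hP₁ := h₁.nonneg
  set q₁ := survival μ P₁
  set q₂ := survival μ P₂
  have hq₁0 : 0 ≤ q₁ := by linarith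
  have hopt := h₂.optimal P₁ hP₁ (hK.guard_lt ha0 hN hm0 hm hηa hca hq₁ (hqq.trans hq₂1))
  have hK1 := hK.ge hm0 hm hq₁0 (hqq.trans hq₂1)
  have hmono := hK.mono hqq
  have hD : N * (a / 2) ≤ K q₂ + m := by nlinarith
  have hDpos : 0 < K q₂ + m := lt_of_lt_of_le (by positivity) hD
  have hdiff : K q₂ + m - K q₁ ≤ N * (q₂ - q₁ + 5 * η) := by
    have h1 := (abs_le.1 (hK.close q₂ (by linarith) hq₂1)).2
    have h2 := (abs_le.1 (hK.close q₁ hq₁0 (by linarith))).1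
    nlinarith
  have hdiff2 : N * (q₂ - q₁ + 5 * η) ≤ (K q₂ + m) * (2 / a * (q₂ - q₁ + 5 * η)) := by
    have h0 : 0 ≤ q₂ - q₁ + 5 * η := by linarith
    have h1 : N ≤ (K q₂ + m) * (2 / a) := by
      rw [mul_div_assoc', le_div_iff₀ ha0]; linarith
    rw [← mul_assoc]
    exact mul_le_mul_of_nonneg_right h1 h0
  have h3 : (K q₂ + m) * ((1 - 2 / a * (q₂ - q₁ + 5 * η)) * P₁) ≤ (K q₂ + m) * P₂ := by
    have h4 : P₁ * (K q₂ + m - K q₁) ≤ P₁ * ((K q₂ + m) * (2 / a * (q₂ - q₁ + 5 * η))) :=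
      mul_le_mul_of_nonneg_left (hdiff.trans hdiff2) hP₁
    nlinarith
  exact le_of_mul_le_mul_left h3 hDpos

/-- The interval from `q₁` to `q₂` is covered by the cells strictly inside it and a bounded number
of boundary cells. Strictness on both sides is what turns an inner cell into a crossing event. -/
theorem sub_le_of_grid {y₀ τ w q₁ q₂ : ℝ} (hτ : 0 < τ) (h1 : y₀ ≤ q₁) (h2 : q₂ ≤ y₀ + w) :
    q₂ - q₁ ≤ 3 * τ + τ * ((Finset.range ⌈w / τ⌉₊).filter
      fun j : ℕ => q₁ < y₀ + j * τ ∧ y₀ + j * τ + τ < q₂).card := by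
  by_cases hlt : q₂ - q₁ ≤ 3 * τ
  · have : 0 ≤ τ * (((Finset.range ⌈w / τ⌉₊).filter
      fun j : ℕ => q₁ < y₀ + j * τ ∧ y₀ + j * τ + τ < q₂).card : ℝ) := by positivity
    linarith
  push Not at hlt
  set A₁ := (q₁ - y₀) / τ with hA₁
  set A₂ := (q₂ - y₀) / τ with hA₂
  have e1 : A₁ * τ = q₁ - y₀ := div_mul_cancel₀ _ hτ.ne'
  have e2 : A₂ * τ = q₂ - y₀ := div_mul_cancel₀ _ hτ.ne'
  have hA₁0 : 0 ≤ A₁ := div_nonneg (by linarith) hτ.le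
  have hA : A₁ + 3 < A₂ := by
    by_contra hle
    push Not at hle
    have := mul_le_mul_of_nonneg_right hle hτ.le
    nlinarith
  have hA₂0 : 0 ≤ A₂ := by linarith
  have hA₂w : A₂ ≤ w / τ := by
    rw [hA₂]; exact div_le_div_of_nonneg_right (by linarith) hτ.le
  have hsub : Finset.Ico (⌊A₁⌋₊ + 1) (⌈A₂⌉₊ - 1) ⊆ (Finset.range ⌈w / τ⌉₊).filter
      fun j : ℕ => q₁ < y₀ + j * τ ∧ y₀ + j * τ + τ < q₂ := by
    intro j hj
    rw [Finset.mem_Ico] at hj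
    have hj1 : A₁ < j := Nat.lt_of_floor_lt (by omega)
    have hj2 : ((j + 1 : ℕ) : ℝ) < A₂ := Nat.lt_ceil.1 (by omega)
    push_cast at hj2
    rw [Finset.mem_filter, Finset.mem_range, Nat.lt_ceil]
    refine ⟨by linarith, ?_, ?_⟩
    · have := mul_lt_mul_of_pos_right hj1 hτ
      linarith
    · have := mul_lt_mul_of_pos_right hj2 hτ
      linarith
  have hcard := Finset.card_le_card hsub
  rw [Nat.card_Ico] at hcard
  have h3 : (⌈A₂⌉₊ : ℝ) ≤ ((Finset.range ⌈w / τ⌉₊).filter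
      fun j : ℕ => q₁ < y₀ + j * τ ∧ y₀ + j * τ + τ < q₂).card + ⌊A₁⌋₊ + 2 := by
    exact_mod_cast (by omega : ⌈A₂⌉₊ ≤ ((Finset.range ⌈w / τ⌉₊).filter
      fun j : ℕ => q₁ < y₀ + j * τ ∧ y₀ + j * τ + τ < q₂).card + ⌊A₁⌋₊ + 2)
  have h4 := Nat.floor_le hA₁0
  have h5 := Nat.le_ceil A₂
  have h6 : A₂ - A₁ ≤ ((Finset.range ⌈w / τ⌉₊).filter
      fun j : ℕ => q₁ < y₀ + j * τ ∧ y₀ + j * τ + τ < q₂).card + 2 := by linarith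
  have h7 := mul_le_mul_of_nonneg_right h6 hτ.le
  nlinarith

end deterministic

/-! ### Crossing events and the bound on the expectation -/

theorem card_notMem {N : ℕ} (I : Finset (Fin N)) :
    (Fintype.card {j : Fin N // j ∉ I} : ℝ) = N - I.card := by
  have h : Fintype.card {j : Fin N // j ∉ I} = N - I.card := by
    rw [Fintype.card_subtype_compl, Fintype.card_fin]; simp
  have hle : I.card ≤ N := by simpa using Finset.card_le_univ I
  rw [h, Nat.cast_sub hle]

theorem countsClose_of_gridClose {N : ℕ} (hN : 0 < N) {I : Finset (Fin N)} {η : ℝ}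
    (hη : 1 ≤ η * N) {u : {j : Fin N // j ∉ I} → ℝ}
    (hu : u ∈ (gridClose N (η * N) : Set ({j : Fin N // j ∉ I} → ℝ))) :
    CountsClose N I.card η fun y => countLE u y := by
  refine ⟨fun y z h => by exact_mod_cast countLE_mono u h, fun y h0 h1 => ?_⟩
  have hcard : Fintype.card {j : Fin N // j ∉ I} ≤ N := by
    simp
  have := abs_countLE_sub_le_of_gridClose hN hcard hu h0 h1
  rw [card_notMem] at this
  linarith

/-- Well-behaved samples (given by quantiles) for which some bids push the price above quantile
`y` and others below quantile `y + τ`. -/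
def crossing {N : ℕ} (μ : Measure ℝ) (c η : ℝ) (I : Finset (Fin N)) (y τ : ℝ) :
    Set ({j : Fin N // j ∉ I} → ℝ) :=
  {u | u ∈ (gridClose N (η * N) : Set ({j : Fin N // j ∉ I} → ℝ)) ∧
    (∀ i, u i ∈ Set.Ioo (0 : ℝ) 1) ∧
    (∃ b, upperQuantile μ y < ERM c (joinSamples I b fun i => upperQuantile μ (u i))) ∧
    ∃ b, ERM c (joinSamples I b fun i => upperQuantile μ (u i)) < upperQuantile μ (y + τ)}

theorem measurable_upperQuantile_pi {ι : Type*} (μ : Measure ℝ) [IsProbabilityMeasure μ]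
    [NullSingletonClass μ] : Measurable fun (u : ι → ℝ) i => upperQuantile μ (u i) :=
  measurable_pi_lambda _ fun i => (measurable_upperQuantile μ).comp (measurable_pi_apply i)

theorem measurableSet_crossing {N : ℕ} (hN : 0 < N) {μ : Measure ℝ} [IsProbabilityMeasure μ]
    [NullSingletonClass μ] (hμ : survival μ 0 = 1) {c : ℝ} (hc0 : 0 ≤ c) (hc : c < 1) (η : ℝ)
    (I : Finset (Fin N)) (y τ : ℝ) : MeasurableSet (crossing μ c η I y τ) := by
  have h : crossing μ c η I y τ = gridClose N (η * N) ∩ (⋂ i, {u | u i ∈ Set.Ioo (0 : ℝ) 1}) ∩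
      (fun (u : {j : Fin N // j ∉ I} → ℝ) i => upperQuantile μ (u i)) ⁻¹'
        ({v | (∀ j, 0 ≤ v j) ∧ ∃ b, upperQuantile μ y < ERM c (joinSamples I b v)} ∩
          {v | (∀ j, 0 ≤ v j) ∧ ∃ b, ERM c (joinSamples I b v) < upperQuantile μ (y + τ)}) := by
    ext u
    have h0 : ∀ j, 0 ≤ upperQuantile μ (u j) := fun j => upperQuantile_nonneg μ hμ _
    simp only [crossing, Set.mem_ofPred_eq, Set.mem_inter_iff, Set.mem_iInter, Set.mem_preimage,
      h0, implies_true, true_and, and_assoc]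
  rw [h]
  refine ((measurableSet_gridClose _ _).inter (MeasurableSet.iInter fun i =>
    measurable_pi_apply i measurableSet_Ioo)).inter (measurable_upperQuantile_pi μ ?_)
  exact (measurableSet_exists_lt_ERM hN hc0 hc I _).inter
    (measurableSet_exists_ERM_lt hN hc0 hc I _)

section bound

variable {α : ℝ} {μ : Measure ℝ} [IsProbabilityMeasure μ] [NullSingletonClass μ]
  {p₀ a η c : ℝ} {N : ℕ} {I : Finset (Fin N)}

/-- The smallness conditions that follow from `η` being a small multiple of `c`. The last one gives
`ε ≤ a / 10`, so every cell of the window starts at or above quantile `9/10 * a`. -/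
theorem le_div_of_le_mul_guard (hα0 : 0 < α) (hα1 : α < 1) (ha0 : 0 < a) (ha1 : a ≤ 1)
    (hη : 0 < η) (hηc : η ≤ α * a ^ 4 / 4000 * c) (hca : c ≤ 2 / 5 * a) :
    0 < c ∧ c < 1 ∧ η ≤ c ∧ η ≤ a / 4000 ∧ 36 * η / (α * a ^ 2) ≤ (a / 10) ^ 2 := by
  have h4 : a ^ 4 ≤ 1 := pow_le_one₀ ha0.le ha1
  have h5 : α * a ^ 4 ≤ 1 := by nlinarith [pow_pos ha0 4]
  have hc0 : 0 < c := by
    by_contra hle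
    push Not at hle
    have : α * a ^ 4 / 4000 * c ≤ 0 := mul_nonpos_of_nonneg_of_nonpos (by positivity) hle
    linarith
  have h6 := mul_le_mul_of_nonneg_right h5 hc0.le
  refine ⟨hc0, by linarith, by linarith, by linarith, ?_⟩
  rw [div_le_iff₀ (by positivity)]
  have h7 : α * a ^ 4 * c ≤ α * a ^ 4 * 1 :=
    mul_le_mul_of_nonneg_left (by linarith) (by positivity)
  have h8 : 0 < α * a ^ 4 := by positivity
  nlinarith

theorem measure_crossing_le_div (hα0 : 0 < α) (hα1 : α < 1) (hp₀ : HasMonopolyPrice α μ p₀)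
    (ha : a = α ^ (1 / (1 - α))) (hN : 0 < N) (hm : (I.card : ℝ) ≤ η * N) (hη : 0 < η)
    (hηN : 1 ≤ η * N) (hηc : η ≤ α * a ^ 4 / 4000 * c) (hca : c ≤ 2 / 5 * a) {y : ℝ}
    (hy : 9 / 10 * a ≤ y) :
    (Measure.pi fun _ : {j : Fin N // j ∉ I} => unitMeasure).real
      (crossing μ c η I y (16 * η)) ≤ (2 * I.card + 1) / √(N * (16 * η)) := by
  have ha0 : 0 < a := ha ▸ Real.rpow_pos_of_pos hα0 _
  have ha1 : a ≤ 1 := (ha ▸ hp₀.rpow_le_survival : a ≤ _).trans (survival_le_one μ p₀)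
  obtain ⟨hc0, hc1, hηc', hηa, -⟩ := le_div_of_le_mul_guard hα0 hα1 ha0 ha1 hη hηc hca
  have hNr : (0 : ℝ) < N := by exact_mod_cast hN
  have hm0 : (0 : ℝ) ≤ I.card := by positivity
  have hy0 : 0 < y := by linarith
  -- Here `upperQuantile` takes its default value `0` at `y + 16 η`, no price is below that, and the
  -- event is empty.
  by_cases hy1 : 1 ≤ y + 16 * η
  · have : crossing μ c η I y (16 * η) = ∅ := by
      refine Set.eq_empty_of_forall_notMem fun u hu => ?_
      obtain ⟨-, -, -, b, hb⟩ := hu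
      have h1 : upperQuantile μ (y + 16 * η) = 0 := by
        rw [upperQuantile, if_neg fun h => absurd h.2 (not_lt.2 hy1)]
      rw [h1] at hb
      exact absurd (ERM_nonneg c (joinSamples_nonneg b fun j =>
        upperQuantile_nonneg μ hp₀.survival_zero _)) (not_le.2 hb)
    rw [this, measureReal_empty]
    positivity
  push Not at hy1
  have hmem1 : y ∈ Set.Ioo (0 : ℝ) 1 := ⟨hy0, by linarith⟩
  have hmem2 : y + 16 * η ∈ Set.Ioo (0 : ℝ) 1 := ⟨by linarith, hy1⟩
  -- The reservoir starts at quantile `a / 4` and has length at most `16 a / 4000`, so it stays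
  -- below `9/10 * a` and no attainable price has its quantile there.
  refine measure_crossing_le (r := a / 4) (κ := c * N) (survival_antitone μ) (by positivity)
    (by positivity) (by linarith) hy1 (by positivity)
    (measurableSet_crossing hN hp₀.survival_zero hc0.le hc1 η I y _) ?_ ?_ ?_
  · intro u hu
    have hK := countsClose_of_gridClose hN hηN hu.1
    have e1 : ((inIoc u (a / 4) (16 * η)).card : ℝ) =
        countLE u (a / 4 + 16 * η) - countLE u (a / 4) := by
      rw [← card_inIoc_add_countLE u (by positivity : 0 ≤ 16 * η)]; push_cast; ring
    have e2 : ((inIoc u y (16 * η)).card : ℝ) = countLE u (y + 16 * η) - countLE u y := by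
      rw [← card_inIoc_add_countLE u (by positivity : 0 ≤ 16 * η)]; push_cast; ring
    push_cast
    rw [e1, e2]
    have k1 := (abs_le.1 (hK.close (a / 4 + 16 * η) (by positivity) (by linarith))).1
    have k2 := (abs_le.1 (hK.close (a / 4) (by positivity) (by linarith))).2
    have k3 := (abs_le.1 (hK.close (y + 16 * η) (by positivity) hy1.le)).1
    have k4 := (abs_le.1 (hK.close y hy0.le hmem1.2.le)).2
    -- The two intervals together hold `32 η (N - m)` samples on average. Deviations cost at most `8
    -- η N` and the term in `m` at most `8 η N`, which leaves `16 η N`.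
    have k5 : (I.card : ℝ) * (32 * η) ≤ N * (8 * η) := by
      have : (I.card : ℝ) ≤ N * (1 / 4) := by nlinarith
      nlinarith
    linarith
  · intro u hu
    have hK := countsClose_of_gridClose hN hηN hu.1
    obtain ⟨-, hu1, ⟨b, hb⟩, -⟩ := hu
    have hP := isCandidate_ERM hN hc0.le hc1 b hp₀.survival_zero hu1
    obtain ⟨-, h9, -⟩ := hP.survival_close hα0 hα1 hp₀ ha hNr hm0 hm hη hηc hca hK
    refine ⟨_, hP, hK.guard_lt ha0 hNr hm0 hm hηa hca h9 (survival_le_one μ _), by linarith, ?_⟩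
    rw [← survival_upperQuantile μ hmem1]
    exact survival_antitone μ hb.le
  · intro u hu
    have hK := countsClose_of_gridClose hN hηN hu.1
    obtain ⟨-, hu1, -, b, hb⟩ := hu
    have hP := isCandidate_ERM hN hc0.le hc1 b hp₀.survival_zero hu1
    obtain ⟨-, h9, -⟩ := hP.survival_close hα0 hα1 hp₀ ha hNr hm0 hm hη hηc hca hK
    refine ⟨_, hP, hK.guard_lt ha0 hNr hm0 hm hηa hca h9 (survival_le_one μ _), ?_⟩
    rw [← survival_upperQuantile μ hmem2]
    exact survival_antitone μ hb.le

theorem worstAwareness_le_crossing (hα0 : 0 < α) (hα1 : α < 1) (hp₀ : HasMonopolyPrice α μ p₀)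
    (ha : a = α ^ (1 / (1 - α))) (hN : 0 < N) (hm : (I.card : ℝ) ≤ η * N) (hη : 0 < η)
    (hηN : 1 ≤ η * N) (hηc : η ≤ α * a ^ 4 / 4000 * c) (hca : c ≤ 2 / 5 * a) {ε : ℝ}
    (hε : ε = √(36 * η / (α * a ^ 2))) {u : {j : Fin N // j ∉ I} → ℝ}
    (hu : ∀ i, u i ∈ Set.Ioo (0 : ℝ) 1)
    (hgrid : u ∈ (gridClose N (η * N) : Set ({j : Fin N // j ∉ I} → ℝ))) :
    worstAwareness (ERM c) I (fun i => upperQuantile μ (u i)) ≤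
      2 / a * (53 * η + 16 * η * ∑ j ∈ Finset.range ⌈2 * ε / (16 * η)⌉₊,
        (crossing μ c η I (survival μ p₀ - ε + j * (16 * η)) (16 * η)).indicator
          (fun _ => (1 : ℝ)) u) := by
  have ha0 : 0 < a := ha ▸ Real.rpow_pos_of_pos hα0 _
  have haq : a ≤ survival μ p₀ := ha ▸ hp₀.rpow_le_survival
  have ha1 : a ≤ 1 := haq.trans (survival_le_one μ p₀)
  obtain ⟨hc0, hc1, hηc', hηa, hεa⟩ := le_div_of_le_mul_guard hα0 hα1 ha0 ha1 hη hηc hca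
  have hεa' : ε ≤ a / 10 := hε ▸ Real.sqrt_le_left (by positivity) |>.2 hεa
  have hNr : (0 : ℝ) < N := by exact_mod_cast hN
  have hm0 : (0 : ℝ) ≤ I.card := by positivity
  have hK := countsClose_of_gridClose hN hηN hgrid
  have hv0 : ∀ j, 0 ≤ upperQuantile μ (u j) := fun j =>
    upperQuantile_nonneg μ hp₀.survival_zero _
  set y₀ := survival μ p₀ - ε with hy₀
  set T := ∑ j ∈ Finset.range ⌈2 * ε / (16 * η)⌉₊,
        (crossing μ c η I (y₀ + j * (16 * η)) (16 * η)).indicator (fun _ => (1 : ℝ)) u with hT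
  have hT0 : 0 ≤ T := Finset.sum_nonneg fun j _ => Set.indicator_nonneg (fun _ _ => zero_le_one) _
  have hD : 0 ≤ 2 / a * (53 * η + 16 * η * T) := by positivity
  refine worstAwareness_le_of_forall hv0 hD fun b₁ b₂ => ?_
  have h₁ := isCandidate_ERM hN hc0.le hc1 b₁ hp₀.survival_zero hu
  have h₂ := isCandidate_ERM hN hc0.le hc1 b₂ hp₀.survival_zero hu
  obtain ⟨l₁, q₁, pos₁⟩ := h₁.survival_close hα0 hα1 hp₀ ha hNr hm0 hm hη hηc hca hK
  obtain ⟨l₂, q₂, pos₂⟩ := h₂.survival_close hα0 hα1 hp₀ ha hNr hm0 hm hη hηc hca hK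
  rw [← hε, abs_le] at l₁ l₂
  set P₁ := ERM c (joinSamples I b₁ fun i => upperQuantile μ (u i)) with hP₁
  set P₂ := ERM c (joinSamples I b₂ fun i => upperQuantile μ (u i)) with hP₂
  rcases lt_or_ge P₁ P₂ with hlt | hle
  · nlinarith
  have hratio := h₁.ratio_ge ha0 hNr hm0 hm hη hηa hca hK h₂ q₁ hle
  refine le_trans (mul_le_mul_of_nonneg_right ?_ pos₁.le) hratio
  have hgr := sub_le_of_grid (y₀ := y₀) (τ := 16 * η) (w := 2 * ε) (q₁ := survival μ P₁)
    (q₂ := survival μ P₂) (by positivity) (by linarith) (by linarith)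
  have hcard : (((Finset.range ⌈2 * ε / (16 * η)⌉₊).filter fun j : ℕ =>
      survival μ P₁ < y₀ + j * (16 * η) ∧ y₀ + j * (16 * η) + 16 * η < survival μ P₂).card : ℝ) ≤
      T := by
    rw [Finset.card_filter, hT]
    push_cast
    refine Finset.sum_le_sum fun j _ => ?_
    split_ifs with hj
    · have hyj0 : 0 < y₀ + j * (16 * η) := by
        have : 0 ≤ (j : ℝ) * (16 * η) := by positivity
        linarith
      have hq₂1 := survival_le_one μ P₂
      have m1 : y₀ + j * (16 * η) ∈ Set.Ioo (0 : ℝ) 1 := ⟨hyj0, by linarith⟩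
      have m2 : y₀ + j * (16 * η) + 16 * η ∈ Set.Ioo (0 : ℝ) 1 := ⟨by linarith, by linarith⟩
      have hmem : u ∈ crossing μ c η I (y₀ + j * (16 * η)) (16 * η) := by
        refine ⟨hgrid, hu, ⟨b₁, ?_⟩, ⟨b₂, ?_⟩⟩
        · rw [← hP₁]
          by_contra hle'
          have := (le_upperQuantile_iff μ m1 P₁).1 (not_lt.1 hle')
          linarith
        · rw [← hP₂]
          refine lt_of_le_of_ne ((le_upperQuantile_iff μ m2 P₂).2 hj.2.le) fun heq => ?_
          have := survival_upperQuantile μ m2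
          rw [← heq] at this
          linarith
      rw [Set.indicator_of_mem hmem]
    · exact Set.indicator_nonneg (fun _ _ => zero_le_one) _
  have h2a : 0 < 2 / a := by positivity
  -- `53 = 3 * 16 + 5`: three cell widths from the grid, and the `5 η` from the ratio bound.
  have hfin : survival μ P₂ - survival μ P₁ + 5 * η ≤ 53 * η + 16 * η * T := by
    have := mul_le_mul_of_nonneg_left hcard (by positivity : 0 ≤ 16 * η)
    linarith
  have := mul_le_mul_of_nonneg_left hfin h2a.le
  linarith

/-- Change variables to uniform quantiles. Off the concentration event use the trivial bound `1`; on
it, integrate the crossing bound cell by cell. -/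
theorem deltaWorst_le_add (hα0 : 0 < α) (hα1 : α < 1) (hp₀ : HasMonopolyPrice α μ p₀)
    (ha : a = α ^ (1 / (1 - α))) (hN : 0 < N) (hm : (I.card : ℝ) ≤ η * N) (hη : 0 < η)
    (hηN : 1 ≤ η * N) (hηc : η ≤ α * a ^ 4 / 4000 * c) (hca : c ≤ 2 / 5 * a) {ε : ℝ}
    (hε : ε = √(36 * η / (α * a ^ 2)))
    (hint : Integrable (worstAwareness (ERM c) I) (restLaw μ I)) :
    DeltaWorst μ (ERM c) I ≤
      (N + 1) * (2 * Real.exp (-(2 * (η * N) ^ 2 / (N - I.card)))) +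
      2 / a * (53 * η + 16 * η * (⌈2 * ε / (16 * η)⌉₊ *
        ((2 * I.card + 1) / √(N * (16 * η))))) := by
  have ha0 : 0 < a := ha ▸ Real.rpow_pos_of_pos hα0 _
  have haq : a ≤ survival μ p₀ := ha ▸ hp₀.rpow_le_survival
  have ha1 : a ≤ 1 := haq.trans (survival_le_one μ p₀)
  obtain ⟨hc0, hc1, hηc', hηa, hεa⟩ := le_div_of_le_mul_guard hα0 hα1 ha0 ha1 hη hηc hca
  have hεa' : ε ≤ a / 10 := hε ▸ Real.sqrt_le_left (by positivity) |>.2 hεa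
  set ν := Measure.pi fun _ : {j : Fin N // j ∉ I} => unitMeasure with hν
  have hmp : MeasurePreserving (fun (u : {j : Fin N // j ∉ I} → ℝ) i => upperQuantile μ (u i))
      ν (restLaw μ I) :=
    measurePreserving_pi _ _ fun _ => measurePreserving_upperQuantile μ
  have hmap : DeltaWorst μ (ERM c) I =
      ∫ u, worstAwareness (ERM c) I (fun i => upperQuantile μ (u i)) ∂ν := by
    unfold DeltaWorst
    rw [← hmp.map_eq]
    exact integral_map hmp.measurable.aemeasurable (by
      rw [hmp.map_eq]; exact hint.aestronglyMeasurable)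
  set y : ℕ → ℝ := fun j => survival μ p₀ - ε + j * (16 * η) with hy
  set L := ⌈2 * ε / (16 * η)⌉₊ with hL
  set G : Set ({j : Fin N // j ∉ I} → ℝ) := gridClose N (η * N) with hG
  have hGm : MeasurableSet G := measurableSet_gridClose _ _
  have hXm : ∀ j, MeasurableSet (crossing μ c η I (y j) (16 * η)) := fun j =>
    measurableSet_crossing hN hp₀.survival_zero hc0.le hc1 η I _ _
  have hi1 : Integrable (Gᶜ.indicator fun _ => (1 : ℝ)) ν :=
    (integrable_const 1).indicator hGm.compl
  have hi2 : ∀ j, Integrable ((crossing μ c η I (y j) (16 * η)).indicator fun _ => (1 : ℝ)) ν :=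
    fun j => (integrable_const 1).indicator (hXm j)
  have hi3 : Integrable (fun u => 2 / a * (53 * η + 16 * η * ∑ j ∈ Finset.range L,
        (crossing μ c η I (y j) (16 * η)).indicator (fun _ => (1 : ℝ)) u)) ν :=
    ((integrable_const _).add ((integrable_finsetSum _ fun j _ => hi2 j).const_mul _)).const_mul _
  have hae : ∀ᵐ u ∂ν, ∀ i, u i ∈ Set.Ioo (0 : ℝ) 1 :=
    Measure.ae_pi_le_pi (Filter.eventually_pi fun _ => ae_restrict_mem measurableSet_Ioo)
  have hbound : ∀ᵐ u ∂ν, worstAwareness (ERM c) I (fun i => upperQuantile μ (u i)) ≤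
      Gᶜ.indicator (fun _ => (1 : ℝ)) u + 2 / a * (53 * η + 16 * η * ∑ j ∈ Finset.range L,
        (crossing μ c η I (y j) (16 * η)).indicator (fun _ => (1 : ℝ)) u) := by
    filter_upwards [hae] with u hu
    by_cases hgrid : u ∈ G
    · rw [Set.indicator_of_notMem (by simpa using hgrid), zero_add]
      exact worstAwareness_le_crossing hα0 hα1 hp₀ ha hN hm hη hηN hηc hca hε hu hgrid
    · rw [Set.indicator_of_mem (by simpa using hgrid)]
      have h1 := worstAwareness_le_one (c := c) (I := I) (v := fun i => upperQuantile μ (u i))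
        fun j => upperQuantile_nonneg μ hp₀.survival_zero _
      have h2 : 0 ≤ ∑ j ∈ Finset.range L,
        (crossing μ c η I (y j) (16 * η)).indicator (fun _ => (1 : ℝ)) u :=
        Finset.sum_nonneg fun j _ => Set.indicator_nonneg (fun _ _ => zero_le_one) _
      have h3 : 0 ≤ 2 / a * (53 * η + 16 * η * ∑ j ∈ Finset.range L,
        (crossing μ c η I (y j) (16 * η)).indicator (fun _ => (1 : ℝ)) u) := by positivity
      linarith
  have hintu : Integrable (fun u => worstAwareness (ERM c) I fun i => upperQuantile μ (u i)) ν :=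
    hmp.integrable_comp hint.aestronglyMeasurable |>.2 hint
  rw [hmap]
  refine (integral_mono_ae hintu (hi1.add hi3) hbound).trans ?_
  simp only [Pi.add_apply]
  rw [integral_add hi1 hi3, integral_const_mul (2 / a), integral_add (integrable_const _)
    ((integrable_finsetSum _ fun j _ => hi2 j).const_mul _), integral_const_mul (16 * η),
    integral_finsetSum _ fun j _ => hi2 j, integral_const, probReal_univ, one_smul,
    integral_indicator_const _ hGm.compl, smul_eq_mul, mul_one]
  have hG1 : ν.real Gᶜ ≤ (N + 1) * (2 * Real.exp (-(2 * (η * N) ^ 2 / (N - I.card)))) := by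
    have := measure_compl_gridClose_le (ι := {j : Fin N // j ∉ I}) (N := N) (t := η * N)
      (by positivity)
    rwa [card_notMem] at this
  have hX1 : ∑ j ∈ Finset.range L,
      ∫ u, (crossing μ c η I (y j) (16 * η)).indicator (fun _ => (1 : ℝ)) u ∂ν ≤
      L * ((2 * I.card + 1) / √(N * (16 * η))) := by
    calc _ ≤ ∑ _j ∈ Finset.range L, (2 * I.card + 1) / √(N * (16 * η)) := by
          refine Finset.sum_le_sum fun j _ => ?_
          rw [integral_indicator_const _ (hXm j), smul_eq_mul, mul_one]
          refine measure_crossing_le_div hα0 hα1 hp₀ ha hN hm hη hηN hηc hca ?_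
          have : 0 ≤ (j : ℝ) * (16 * η) := by positivity
          simp only [hy]
          linarith
      _ = _ := by rw [Finset.sum_const, Finset.card_range, nsmul_eq_mul]
  have h2a : 0 < 2 / a := by positivity
  gcongr

end bound

/-! ### Numerical estimates and conclusion -/

/-- Since `n - k ≤ n`, this choice of `η` makes the exponent at least `2 log n`, and a factor `n ^
(-2)` beats the union bound over `n + 1` grid points. -/
theorem exceptional_event_bound {n k η : ℝ} (hn : 1 ≤ n) (hk0 : 0 ≤ k) (hk : k < n)
    (hη2 : η ^ 2 = Real.log n / n) :
    (n + 1) * (2 * Real.exp (-(2 * (η * n) ^ 2 / (n - k)))) ≤ 4 * (1 / √n) := by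
  have hn0 : 0 < n := by linarith
  have hd : 0 < n - k := sub_pos.2 hk
  have h1 : 2 * Real.log n ≤ 2 * (η * n) ^ 2 / (n - k) := by
    have e : 2 * (η * n) ^ 2 = 2 * Real.log n * n := by
      rw [mul_pow, hη2]
      field_simp
    rw [le_div_iff₀ hd, e]
    exact mul_le_mul_of_nonneg_left (by linarith) (by have := Real.log_nonneg hn; linarith)
  have h2 : Real.exp (-(2 * (η * n) ^ 2 / (n - k))) ≤ 1 / n ^ 2 :=
    calc Real.exp (-(2 * (η * n) ^ 2 / (n - k))) ≤ Real.exp (-(2 * Real.log n)) :=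
          Real.exp_le_exp.2 (neg_le_neg h1)
      _ = 1 / n ^ 2 := by
        rw [Real.exp_neg, two_mul, Real.exp_add, Real.exp_log hn0, one_div, sq]
  have hs : √n ≤ n := by
    rw [Real.sqrt_le_left hn0.le]
    exact le_self_pow₀ hn two_ne_zero
  calc (n + 1) * (2 * Real.exp (-(2 * (η * n) ^ 2 / (n - k))))
      ≤ (n + n) * (2 * (1 / n ^ 2)) :=
        mul_le_mul (by linarith) (by linarith) (by positivity) (by linarith)
    _ = 4 * (1 / n) := by field_simp; norm_num
    _ ≤ 4 * (1 / √n) :=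
        mul_le_mul_of_nonneg_left (one_div_le_one_div_of_le (Real.sqrt_pos.2 hn0) hs) (by norm_num)

/-- The powers of `η` cancel: width times number of cells is of order `√η`, while each crossing
probability is of order `k / √(n η)`. -/
theorem crossing_sum_bound {n k η γ : ℝ} (hn0 : 0 < n) (hk : 1 ≤ k) (hη0 : 0 < η) (hη1 : η < 1)
    (hγ : 0 < γ) :
    16 * η * (⌈2 * √(36 * η / γ) / (16 * η)⌉₊ * ((2 * k + 1) / √(n * (16 * η)))) ≤
      (16 + 2 * √(36 / γ)) * (k / √n) := by
  have hs0 : 0 < √n := Real.sqrt_pos.2 hn0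
  set s := √n with hs
  have hσ0 : 0 ≤ √(36 / γ) := Real.sqrt_nonneg _
  set σ := √(36 / γ) with hσ
  set r := √η with hr
  have hr0 : 0 < r := Real.sqrt_pos.2 hη0
  have hr2 : r ^ 2 = η := Real.sq_sqrt hη0.le
  have hr1 : r ≤ 1 := by rw [hr]; exact (Real.sqrt_le_sqrt hη1.le).trans_eq Real.sqrt_one
  have e1 : √(36 * η / γ) = σ * r := by
    rw [hσ, hr, ← Real.sqrt_mul (by positivity)]; congr 1; ring
  have e2 : √(n * (16 * η)) = 4 * s * r := by
    rw [show n * (16 * η) = 4 ^ 2 * (n * η) by ring, Real.sqrt_mul (by norm_num),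
      Real.sqrt_sq (by norm_num), Real.sqrt_mul hn0.le, mul_assoc]
  rw [e1, e2]
  have hL : 16 * η * (⌈2 * (σ * r) / (16 * η)⌉₊ : ℝ) ≤ (16 + 2 * σ) * r := by
    have h1 : (⌈2 * (σ * r) / (16 * η)⌉₊ : ℝ) ≤ 2 * (σ * r) / (16 * η) + 1 :=
      (Nat.ceil_lt_add_one (by positivity)).le
    calc _ ≤ 16 * η * (2 * (σ * r) / (16 * η) + 1) := by gcongr
      _ = 2 * σ * r + 16 * (r * r) := by rw [← hr2]; field_simp
      _ ≤ 2 * σ * r + 16 * (1 * r) := by gcongr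
      _ = _ := by ring
  calc _ = 16 * η * (⌈2 * (σ * r) / (16 * η)⌉₊ : ℝ) * ((2 * k + 1) / (4 * s * r)) := by
        ring
    _ ≤ (16 + 2 * σ) * r * ((2 * k + k + k) / (4 * s * r)) := by
        gcongr
        linarith
    _ = (16 + 2 * σ) * (k / s) := by field_simp; ring
    _ ≤ _ := by gcongr

theorem deltaWorst_le_mul_log {α : ℝ} {μ : Measure ℝ} [IsProbabilityMeasure μ]
    [NullSingletonClass μ] {p₀ a η c : ℝ} {N : ℕ} {I : Finset (Fin N)} (hα0 : 0 < α)
    (hα1 : α < 1) (hp₀ : HasMonopolyPrice α μ p₀) (ha : a = α ^ (1 / (1 - α))) (hN : 0 < N)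
    (hlog : 1 ≤ Real.log N) (hη : η = √(Real.log N / N)) (hI : 1 ≤ I.card)
    (hm : (I.card : ℝ) ≤ η * N) (hηc : η ≤ α * a ^ 4 / 4000 * c) (hca : c ≤ 2 / 5 * a)
    (hint : Integrable (worstAwareness (ERM c) I) (restLaw μ I)) :
    DeltaWorst μ (ERM c) I ≤ (4 + 2 / a * (69 + 2 * √(36 / (α * a ^ 2)))) *
      (I.card * Real.log N ^ 3 / √N) := by
  have ha0 : 0 < a := ha ▸ Real.rpow_pos_of_pos hα0 _
  have haq : a ≤ survival μ p₀ := ha ▸ hp₀.rpow_le_survival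
  have ha1 : a ≤ 1 := haq.trans (survival_le_one μ p₀)
  have hNr : (0 : ℝ) < N := by exact_mod_cast hN
  have hN1 : (1 : ℝ) ≤ N := by exact_mod_cast hN
  have hη0 : 0 < η := by rw [hη]; positivity
  have hm1 : (1 : ℝ) ≤ I.card := by exact_mod_cast hI
  obtain ⟨hc0, hc1, hηc', -, -⟩ := le_div_of_le_mul_guard hα0 hα1 ha0 ha1 hη0 hηc hca
  have hmain := deltaWorst_le_add hα0 hα1 hp₀ ha hN hm hη0 (hm1.trans hm) hηc hca rfl hint
  set σ := √(36 / (α * a ^ 2)) with hσ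
  have hσ0 : 0 ≤ σ := Real.sqrt_nonneg _
  set s := √(N : ℝ) with hs
  have hs0 : 0 < s := Real.sqrt_pos.2 hNr
  have hs2 : s ^ 2 = N := Real.sq_sqrt hNr.le
  have hs1 : 1 ≤ s := by rw [hs]; exact Real.one_le_sqrt.2 hN1
  set R := I.card * Real.log N ^ 3 / s with hR
  -- The terms to absorb are of order `m / √N` and `√(log N / N)`, so the cube of the logarithm
  -- leaves room to spare.
  have hlog3 : Real.log N ≤ Real.log N ^ 3 := le_self_pow₀ hlog (by norm_num)
  have hmR : (I.card : ℝ) / s ≤ R := by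
    rw [hR]
    gcongr
    nlinarith
  have h1R : 1 / s ≤ R := le_trans (by gcongr) hmR
  have hηR : η ≤ R := by
    rw [hη, Real.sqrt_div' _ hNr.le, hR, ← hs]
    have : √(Real.log N) ≤ Real.log N := by
      rw [Real.sqrt_le_left (by linarith)]
      nlinarith
    gcongr
    nlinarith
  have hη2 : η ^ 2 = Real.log N / N := by rw [hη]; exact Real.sq_sqrt (by positivity)
  have hηlt : η < 1 := by linarith
  have hT1 : (N + 1) * (2 * Real.exp (-(2 * (η * N) ^ 2 / (N - I.card)))) ≤ 4 * R :=
    (exceptional_event_bound hN1 (by linarith) (hm.trans_lt (mul_lt_of_lt_one_left hNr hηlt))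
      hη2).trans (mul_le_mul_of_nonneg_left h1R (by norm_num))
  have hT2 : 16 * η * (⌈2 * √(36 * η / (α * a ^ 2)) / (16 * η)⌉₊ *
      ((2 * I.card + 1) / √(N * (16 * η)))) ≤ (16 + 2 * σ) * R :=
    (crossing_sum_bound hNr hm1 hη0 hηlt (by positivity)).trans
      (mul_le_mul_of_nonneg_left hmR (by linarith))
  have h2a : 0 < 2 / a := by positivity
  calc _ ≤ _ := hmain
    _ ≤ 4 * R + 2 / a * (53 * R + (16 + 2 * σ) * R) := by gcongr
    _ = _ := by ring

theorem IsStronglyRegular.mono {α β : ℝ} {μ : Measure ℝ} (h : IsStronglyRegular β μ)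
    (hαβ : α ≤ β) : IsStronglyRegular α μ := by
  obtain ⟨A, B, f, hA, hAB, hfm, hfpos, hμ, hφ⟩ := h
  refine ⟨A, B, f, hA, hAB, hfm, hfpos, hμ, fun x hx y hy hxy => ?_⟩
  exact (mul_le_mul_of_nonneg_right hαβ (sub_nonneg.2 hxy.le)).trans (hφ x hx y hy hxy)

theorem IsStronglyRegular.ae_nonneg {α : ℝ} {μ : Measure ℝ} (h : IsStronglyRegular α μ) :
    ∀ᵐ x ∂μ, 0 ≤ x := by
  obtain ⟨A, B, f, hA, -, -, -, hμ, -⟩ := h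
  rw [hμ]
  refine (withDensity_absolutelyContinuous _ _).ae_le ?_
  filter_upwards [ae_restrict_mem (measurableSet_supportInterior A B)] with x hx
  exact hA.trans hx.1.le

/-- The range of `c` extends to `2/5` of the quantile constant, rather than `1/4`, so that the case
`α = 1` can be deduced from `α = 1/2`. -/
theorem exists_deltaWorst_le_of_lt_one (α : ℝ) (hα0 : 0 < α) (hα1 : α < 1) :
    ∃ C : ℝ, 0 < C ∧
      ∀ m : ℕ → ℕ,
        Tendsto (fun N : ℕ => (m N : ℝ) / Real.sqrt (N : ℝ)) atTop (𝓝 0) →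
        ∃ N₀ : ℕ, ∀ N : ℕ, N₀ ≤ N →
          ∀ (μ : Measure ℝ) [IsProbabilityMeasure μ], IsStronglyRegular α μ →
          ∀ c : ℝ, (Real.log (N : ℝ) / (N : ℝ)) ^ ((1 : ℝ) / 3) ≤ c →
            c ≤ 2 / 5 * α ^ (1 / (1 - α)) →
            ∀ I : Finset (Fin N), I.card = m N →
              Integrable (worstAwareness (ERM c) I) (restLaw μ I) ∧
              DeltaWorst μ (ERM c) I ≤
                C * ((m N : ℝ) * Real.log (N : ℝ) ^ 3 / Real.sqrt (N : ℝ)) := by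
  set a := α ^ (1 / (1 - α)) with ha
  have ha0 : 0 < a := Real.rpow_pos_of_pos hα0 _
  refine ⟨4 + 2 / a * (69 + 2 * √(36 / (α * a ^ 2))), by positivity, fun m hm => ?_⟩
  have hx : Tendsto (fun N : ℕ => Real.log (N : ℝ) / (N : ℝ)) atTop (𝓝 0) :=
    (Real.isLittleO_log_id_atTop.tendsto_div_nhds_zero).comp tendsto_natCast_atTop_atTop
  have hx6 : Tendsto (fun N : ℕ => (Real.log (N : ℝ) / (N : ℝ)) ^ ((1 : ℝ) / 6)) atTop (𝓝 0) := by
    have := hx.rpow_const (p := (1 : ℝ) / 6) (Or.inr (by norm_num))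
    rwa [Real.zero_rpow (by norm_num)] at this
  have hlogt : Tendsto (fun N : ℕ => Real.log (N : ℝ)) atTop atTop :=
    Real.tendsto_log_atTop.comp tendsto_natCast_atTop_atTop
  have hev : ∀ᶠ N : ℕ in atTop, 0 < N ∧ 1 ≤ Real.log (N : ℝ) ∧ (m N : ℝ) / √(N : ℝ) ≤ 1 ∧
      (Real.log (N : ℝ) / (N : ℝ)) ^ ((1 : ℝ) / 6) ≤ α * a ^ 4 / 4000 := by
    filter_upwards [eventually_gt_atTop 0, hlogt.eventually_ge_atTop 1,
      hm.eventually (ge_mem_nhds one_pos),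
      hx6.eventually (ge_mem_nhds (show 0 < α * a ^ 4 / 4000 by positivity))] with N h1 h2 h3 h4
    exact ⟨h1, h2, h3, h4⟩
  obtain ⟨N₀, hN₀⟩ := eventually_atTop.1 hev
  refine ⟨N₀, fun N hN μ _ hμ c hc hca I hI => ?_⟩
  obtain ⟨hN0, hlog, hmN, hθ⟩ := hN₀ N hN
  rcases Nat.eq_zero_or_pos (m N) with h0 | hpos
  · have hw : worstAwareness (ERM c) I = fun _ => 0 :=
      funext fun v => worstAwareness_eq_zero_of_card_eq_zero (hI.trans h0) _ v
    refine ⟨by rw [hw]; exact integrable_zero _ _ _, ?_⟩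
    unfold DeltaWorst
    rw [hw, h0]
    simp
  have hatoms := hμ.nullSingletonClass
  obtain ⟨p₀, hp₀⟩ := hμ.exists_monopolyPrice hα0 hα1
  have haq : a ≤ survival μ p₀ := hp₀.rpow_le_survival
  have ha1 : a ≤ 1 := haq.trans (survival_le_one μ p₀)
  have hNr : (0 : ℝ) < N := by exact_mod_cast hN0
  set x := Real.log (N : ℝ) / (N : ℝ) with hxdef
  have hx0 : 0 < x := by positivity
  have hη0 : 0 < √x := Real.sqrt_pos.2 hx0
  -- The exponents split as `1/2 = 1/6 + 1/3`: the guard dominates `x ^ (1/3)`, and the remaining `x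
  -- ^ (1/6)` tends to `0`.
  have hηc : √x ≤ α * a ^ 4 / 4000 * c := by
    have h1 : √x = x ^ ((1 : ℝ) / 6) * x ^ ((1 : ℝ) / 3) := by
      rw [Real.sqrt_eq_rpow, ← Real.rpow_add hx0]; norm_num
    rw [h1]
    exact mul_le_mul hθ hc (by positivity) (by positivity)
  have hmη : (I.card : ℝ) ≤ √x * N := by
    rw [hI]
    have h1 : (m N : ℝ) ≤ √(N : ℝ) := by
      rwa [div_le_one (Real.sqrt_pos.2 hNr)] at hmN
    have h2 : √(N : ℝ) ≤ √x * N := by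
      rw [Real.sqrt_le_left (by positivity), mul_pow, Real.sq_sqrt hx0.le, hxdef]
      have : Real.log (N : ℝ) / N * (N : ℝ) ^ 2 = Real.log N * N := by field_simp
      rw [this]
      nlinarith
    exact h1.trans h2
  obtain ⟨hc0, hc1, hηc', -, -⟩ := le_div_of_le_mul_guard hα0 hα1 ha0 ha1 hη0 hηc hca
  have hint : Integrable (worstAwareness (ERM c) I) (restLaw μ I) :=
    integrable_worstAwareness hN0 hc0.le hc1 (hmη.trans (by gcongr)) hμ.ae_nonneg
  refine ⟨hint, ?_⟩
  have := deltaWorst_le_mul_log hα0 hα1 hp₀ ha hN0 hlog (by rw [hxdef]) (by omega) hmη hηc hca hint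
  rwa [hI] at this

theorem mainTheorem9 (α : ℝ) (hα0 : 0 < α) (hα1 : α ≤ 1) :
    ∃ C : ℝ, 0 < C ∧
      ∀ m : ℕ → ℕ,
        Tendsto (fun N : ℕ => (m N : ℝ) / Real.sqrt (N : ℝ)) atTop (𝓝 0) →
        ∃ N₀ : ℕ, ∀ N : ℕ, N₀ ≤ N →
          ∀ (μ : Measure ℝ) [IsProbabilityMeasure μ], IsStronglyRegular α μ →
          ∀ c : ℝ,
            (m N : ℝ) / (N : ℝ) ≤ (Real.log (N : ℝ) / (N : ℝ)) ^ ((1 : ℝ) / 3) →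
            (Real.log (N : ℝ) / (N : ℝ)) ^ ((1 : ℝ) / 3) ≤ c →
            c ≤ quantileConst α / 4 →
            ∀ I : Finset (Fin N), I.card = m N →
              Integrable (worstAwareness (ERM c) I) (restLaw μ I) ∧
              DeltaWorst μ (ERM c) I ≤
                C * ((m N : ℝ) * Real.log (N : ℝ) ^ 3 / Real.sqrt (N : ℝ)) := by
  rcases hα1.lt_or_eq with h | rfl
  · obtain ⟨C, hC, hmain⟩ := exists_deltaWorst_le_of_lt_one α hα0 h
    refine ⟨C, hC, fun m hm => ?_⟩
    obtain ⟨N₀, hN₀⟩ := hmain m hm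
    refine ⟨N₀, fun N hN μ _ hμ c _ hc hcq I hI => hN₀ N hN μ hμ c hc (hcq.trans ?_) I hI⟩
    rw [quantileConst, if_neg h.ne]
    linarith [Real.rpow_pos_of_pos hα0 (1 / (1 - α))]
  -- For `α = 1` the exponent `1 / (1 - α)` is meaningless, but `1`-strong regularity implies
  -- `1/2`-strong regularity. The quantile constant at `1/2` is `1/4`, and `exp (-1) ≤ 2/5` makes
  -- the range of `c` fit.
  · obtain ⟨C, hC, hmain⟩ := exists_deltaWorst_le_of_lt_one (1 / 2) (by norm_num) (by norm_num)
    refine ⟨C, hC, fun m hm => ?_⟩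
    obtain ⟨N₀, hN₀⟩ := hmain m hm
    refine ⟨N₀, fun N hN μ _ hμ c _ hc hcq I hI =>
      hN₀ N hN μ (hμ.mono (by norm_num)) c hc (hcq.trans ?_) I hI⟩
    rw [quantileConst, if_pos rfl]
    have h1 : (1 / 2 : ℝ) ^ (1 / (1 - 1 / 2) : ℝ) = 1 / 4 := by
      rw [show (1 / (1 - 1 / 2) : ℝ) = ((2 : ℕ) : ℝ) by norm_num, Real.rpow_natCast]; norm_num
    have h2 : Real.exp (-1) ≤ 2 / 5 := by
      rw [Real.exp_neg, inv_le_comm₀ (Real.exp_pos 1) (by norm_num)]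
      have := Real.exp_one_gt_d9
      norm_num at this ⊢
      linarith
    rw [h1]
    linarith
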